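/- Everything is smooth. Let $M$ be a homology $4$-sphere, i.e. a closed connected smooth $4$-manifold with $H_n(M;\mathbb Z)\cong H_n(S^4;\mathbb Z)$ for all $n$, and let $S\subset M$ be a $2$-knot, i.e. a smoothly embedded $2$-sphere. Let $N(S)$ be an open tubular neighborhood of $S$: a smooth plane bundle $V$ over $S$ with a smooth fibrewise inner product is embedded in $M$, diffeomorphically onto an open set, so that the zero section is $S$, and $N(S)$ is the image of the open unit disc bundle of $V$. Let $E(S)=M\setminus N(S)$ be the exterior, so that $\partial E(S)$ is the image of the unit circle bundle of $V$. Let $x_0\in\partial E(S)$, let $G(S)=\pi_1(E(S),x_0)$, and let $m\in G(S)$ be the class of the meridian through $x_0$, that is, of the unit circle of the fibre of $V$ that contains $x_0$, travelled once from $x_0$ to $x_0$ (in either direction). A cord is a properly embedded arc in $E(S)$: a smooth embedding $c:[0,1]\to E(S)$ with $c^{-1}(\partial E(S))=\{0,1\}$ which is transverse to $\partial E(S)$ at its two end points. Two cords are isotopic if they are joined by a smooth family of cords (the end points may move in $\partial E(S)$). Then there is a bijection $$\{\text{cords in }E(S)\}/\text{isotopy}\;\longrightarrow\;\langle m\rangle\backslash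 G(S)/\langle m\rangle .$$ It sends the class of a cord $c$ to the double coset of $[p\cdot c\cdot q]$, for any path $p$ in $\partial E(S)$ from $x_0$ to $c(0)$ and any path $q$ in $\partial E(S)$ from $c(1)$ to $x_0$. -/

import Mathlib

open scoped Manifold ContDiff Topology unitInterval Bundle

noncomputable section

namespace CordLemma

universe u v

/-- The unit sphere `S²` in `ℝ³`, with Mathlib's smooth structure. -/
abbrev Sphere2 : Type := Metric.sphere (0 : EuclideanSpace ℝ (Fin 3)) 1

/-- The unit sphere `S⁴` in `ℝ⁵`. -/
abbrev Sphere4 : Type := Metric.sphere (0 : EuclideanSpace ℝ (Fin 5)) 1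

/-- The Euclidean plane, model fibre of normal bundles of surfaces in 4-manifolds. -/
abbrev Plane : Type := EuclideanSpace ℝ (Fin 2)

/-- Singular homology `H_n(X; ℤ)`. -/
abbrev integralHomology (n : ℕ) (X : Type u) [TopologicalSpace X] : ModuleCat.{u} ℤ :=
  ((AlgebraicTopology.singularHomologyFunctor (ModuleCat.{u} ℤ) n).obj
    (ModuleCat.of ℤ (ULift.{u} ℤ))).obj (TopCat.of X)

/-- `X` has the integral homology of `S⁴`, that is `H_n(X; ℤ) ≅ H_n(S⁴; ℤ)` for all `n`.
(The universe lift of `S⁴` only puts it into the universe of `X`.) -/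
def HasHomologyOfSphere4 (X : Type u) [TopologicalSpace X] : Prop :=
  ∀ n : ℕ, Nonempty (integralHomology n X ≅ integralHomology n (ULift.{u} Sphere4))

theorem norm_circle {W : Type*} [NormedAddCommGroup W] [InnerProductSpace ℝ W] {a b : W} (ha : ‖a‖ = 1) (hb : ‖b‖ = 1)
    (hab : inner ℝ a b = 0) (θ : ℝ) : ‖Real.cos θ • a + Real.sin θ • b‖ = 1 := by
  have h : ‖Real.cos θ • a + Real.sin θ • b‖ ^ 2 = 1 := by
    rw [norm_add_sq_real, norm_smul, norm_smul, inner_smul_left, inner_smul_right, hab, ha, hb]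
    simp
  have h0 := norm_nonneg (Real.cos θ • a + Real.sin θ • b)
  nlinarith

section TubularNeighborhood

variable {M : Type u} [TopologicalSpace M] [ChartedSpace (EuclideanSpace ℝ (Fin 4)) M]
  {V : Sphere2 → Type v} [TopologicalSpace (Bundle.TotalSpace Plane V)]
  [∀ x, NormedAddCommGroup (V x)] [∀ x, InnerProductSpace ℝ (V x)]
  [FiberBundle Plane V] [VectorBundle ℝ Plane V]

/-- A tubular neighborhood of the embedded sphere `f : S² → M`, parametrized by a smooth plane
bundle `V` over `S²` with a fibrewise inner product: a diffeomorphism from the total space of `V`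
onto an open subset of `M` which restricts to `f` on the zero section. -/
structure TubularNeighborhood (f : Sphere2 → M) (V : Sphere2 → Type v)
    [TopologicalSpace (Bundle.TotalSpace Plane V)]
    [∀ x, NormedAddCommGroup (V x)] [∀ x, InnerProductSpace ℝ (V x)]
    [FiberBundle Plane V] [VectorBundle ℝ Plane V] where
  /-- The parametrization. -/
  toFun : Bundle.TotalSpace Plane V → M
  injective : Function.Injective toFun
  isLocalDiffeomorph :
    IsLocalDiffeomorph ((𝓡 2).prod 𝓘(ℝ, Plane)) (𝓡 4) ∞ toFun
  zeroSection : ∀ x : Sphere2, toFun ⟨x, 0⟩ = f x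

namespace TubularNeighborhood

variable {f : Sphere2 → M} (ν : TubularNeighborhood f V)

/-- The open tubular neighborhood `N(S)`: the image of the open unit disc bundle. -/
def openNbhd : Set M := ν.toFun '' {ξ | ‖ξ.2‖ < 1}

/-- The exterior `E(S) = M - N(S)`. -/
def exterior : Set M := ν.openNbhdᶜ

/-- The boundary `∂E(S)`: the image of the unit circle bundle. -/
def boundary : Set M := ν.toFun '' {ξ | ‖ξ.2‖ = 1}

theorem boundary_subset_exterior : ν.boundary ⊆ ν.exterior := by
  rintro _ ⟨ξ, hξ, rfl⟩ ⟨η, hη, h⟩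
  have h' := ν.injective h
  subst h'
  have h1 : ‖η.2‖ = 1 := hξ
  have h2 : ‖η.2‖ < 1 := hη
  linarith

theorem continuous : Continuous ν.toFun := ν.isLocalDiffeomorph.contMDiff.continuous

/-- The point of `∂E(S)` given by a unit vector `a` in the fibre over `x`. -/
def boundaryPoint {x : Sphere2} (a : V x) (ha : ‖a‖ = 1) : ν.exterior :=
  ⟨ν.toFun ⟨x, a⟩, ν.boundary_subset_exterior ⟨⟨x, a⟩, ha, rfl⟩⟩

/-- The meridian of `S` over `x`: the unit circle of the fibre of the tubular neighborhood over
`x`, travelled once, as a loop in `E(S)`. Here `a, b` is an orthonormal basis of the fibre; the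
base point is the point of `∂E(S)` given by `a`. -/
def meridianLoop {x : Sphere2} {a b : V x} (ha : ‖a‖ = 1) (hb : ‖b‖ = 1)
    (hab : inner ℝ a b = 0) : Path (ν.boundaryPoint a ha) (ν.boundaryPoint a ha) where
  toFun t := ν.boundaryPoint
    (Real.cos (2 * Real.pi * t) • a + Real.sin (2 * Real.pi * t) • b)
    (norm_circle ha hb hab _)
  continuous_toFun := by
    refine Continuous.subtype_mk (ν.continuous.comp ?_) _
    refine (FiberBundle.continuous_totalSpaceMk Plane V x).comp ?_
    fun_prop
  source' := by simp
  target' := by simp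

/-- The class of the meridian in `G(S) = π₁(E(S))`. -/
def meridian {x : Sphere2} {a b : V x} (ha : ‖a‖ = 1) (hb : ‖b‖ = 1)
    (hab : inner ℝ a b = 0) : FundamentalGroup ν.exterior (ν.boundaryPoint a ha) :=
  FundamentalGroup.fromPath (Path.Homotopic.Quotient.mk (ν.meridianLoop ha hb hab))

end TubularNeighborhood

end TubularNeighborhood

section Cord

variable {M : Type u} [TopologicalSpace M] [ChartedSpace (EuclideanSpace ℝ (Fin 4)) M]

/-- The vectors tangent to a smooth hypersurface `B` of `M`: the velocities of the smooth curves
of `M` that run inside `B`. -/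
def tangentsTo (B : Set M) : Set (TangentBundle (𝓡 4) M) :=
  {ξ | ∃ γ : ℝ → M, ContMDiff 𝓘(ℝ, ℝ) (𝓡 4) ∞ γ ∧ (∀ s, γ s ∈ B) ∧
    ξ = ⟨γ 0, mfderiv 𝓘(ℝ, ℝ) (𝓡 4) γ 0 1⟩}

/-- A cord in `E`: a properly embedded smooth arc in the codimension-zero submanifold `E` of `M`
with boundary `B`. That is a smooth injective immersion of `[0,1]` with values in `E` which meets
`B` exactly at its two end points, transversally. -/
structure Cord (E B : Set M) where
  /-- The parametrized arc. -/
  toFun : I → M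
  smooth : ContMDiff (𝓡∂ 1) (𝓡 4) ∞ toFun
  injective : Function.Injective toFun
  immersion : ∀ t, mfderiv (𝓡∂ 1) (𝓡 4) toFun t 1 ≠ 0
  mem : ∀ t, toFun t ∈ E
  mem_boundary_iff : ∀ t, toFun t ∈ B ↔ t = 0 ∨ t = 1
  transverse : ∀ t, t = 0 ∨ t = 1 →
    (⟨toFun t, mfderiv (𝓡∂ 1) (𝓡 4) toFun t 1⟩ : TangentBundle (𝓡 4) M) ∉ tangentsTo B

namespace Cord

variable {E B : Set M}

/-- The cord as a path in the space `E`. -/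
def toPath (c : Cord E B) :
    Path (⟨c.toFun 0, c.mem 0⟩ : E) (⟨c.toFun 1, c.mem 1⟩ : E) where
  toFun t := ⟨c.toFun t, c.mem t⟩
  continuous_toFun := c.smooth.continuous.subtype_mk _
  source' := rfl
  target' := rfl

/-- Two cords are isotopic if a smooth family of cords joins them. The end points may move
in `B`. -/
def Isotopic (c d : Cord E B) : Prop :=
  ∃ H : I × I → M, ContMDiff ((𝓡∂ 1).prod (𝓡∂ 1)) (𝓡 4) ∞ H ∧
    (∀ s, ∃ e : Cord E B, ∀ t, e.toFun t = H (s, t)) ∧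
    (∀ t, H (0, t) = c.toFun t) ∧ (∀ t, H (1, t) = d.toFun t)

/-- A smooth self-map of `[0,1]`, the cut-off function `s ↦ smoothTransition (3 s - k)`. -/
def cutoff (k : ℝ) (s : I) : I :=
  ⟨Real.smoothTransition (3 * (s : ℝ) - k),
    Real.smoothTransition.nonneg _, Real.smoothTransition.le_one _⟩

theorem contMDiff_cutoff (k : ℝ) : ContMDiff (𝓡∂ 1) (𝓡∂ 1) ∞ (cutoff k) := by
  have h : ContMDiff (𝓡∂ 1) 𝓘(ℝ, ℝ) ∞
      (fun s : I ↦ Real.smoothTransition (3 * (s : ℝ) - k)) := by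
    have h1 : ContDiff ℝ ∞ (fun x : ℝ ↦ Real.smoothTransition (3 * x - k)) :=
      Real.smoothTransition.contDiff.comp (by fun_prop)
    exact h1.contMDiff.comp contMDiff_subtypeVal_Icc
  exact contMDiff_iff_comp_subtypeVal_Icc.2 ⟨h.continuous.subtype_mk _, h⟩

theorem Isotopic.refl (c : Cord E B) : c.Isotopic c :=
  ⟨fun p ↦ c.toFun p.2, c.smooth.comp contMDiff_snd, fun _ ↦ ⟨c, fun _ ↦ rfl⟩,
    fun _ ↦ rfl, fun _ ↦ rfl⟩

theorem Isotopic.symm {c d : Cord E B} (h : c.Isotopic d) : d.Isotopic c := by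
  obtain ⟨H, hH, hc, h0, h1⟩ := h
  have hs : ContMDiff (𝓡∂ 1) (𝓡∂ 1) ∞ (fun s : I ↦ unitInterval.symm s) := by
    refine contMDiff_iff_comp_subtypeVal_Icc.2 ⟨unitInterval.continuous_symm, ?_⟩
    have h2 : ContDiff ℝ ∞ (fun x : ℝ ↦ 1 - x) := by fun_prop
    exact h2.contMDiff.comp contMDiff_subtypeVal_Icc
  refine ⟨fun p ↦ H (unitInterval.symm p.1, p.2),
    hH.comp ((hs.comp contMDiff_fst).prodMk contMDiff_snd), fun s ↦ hc (unitInterval.symm s), ?_, ?_⟩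
  · intro t; simp [h1]
  · intro t; simp [h0]

theorem Isotopic.trans {c d e : Cord E B} (h : c.Isotopic d) (h' : d.Isotopic e) :
    c.Isotopic e := by
  obtain ⟨H, hH, hc, h0, h1⟩ := h
  obtain ⟨K, hK, hd, k0, k1⟩ := h'
  have key : ∀ (F : I × I → M), ContMDiff ((𝓡∂ 1).prod (𝓡∂ 1)) (𝓡 4) ∞ F → ∀ k : ℝ,
      ContMDiff ((𝓡∂ 1).prod (𝓡∂ 1)) (𝓡 4) ∞ (fun p : I × I ↦ F (cutoff k p.1, p.2)) :=
    fun F hF k ↦ hF.comp (((contMDiff_cutoff k).comp contMDiff_fst).prodMk contMDiff_snd)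
  have cut1 : ∀ (k : ℝ) (s : I), k + 1 ≤ 3 * (s : ℝ) → cutoff k s = 1 := fun k s hs ↦
    Subtype.ext (Real.smoothTransition.one_of_one_le (by linarith))
  have cut0 : ∀ (k : ℝ) (s : I), 3 * (s : ℝ) ≤ k → cutoff k s = 0 := fun k s hs ↦
    Subtype.ext (Real.smoothTransition.zero_of_nonpos (by linarith))
  have hcont : Continuous fun p : I × I ↦ (p.1 : ℝ) :=
    continuous_subtype_val.comp continuous_fst
  let L : I × I → M := fun p ↦
    if (p.1 : ℝ) < 1 / 2 then H (cutoff 0 p.1, p.2) else K (cutoff 2 p.1, p.2)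
  have L1 : ∀ p : I × I, (p.1 : ℝ) < 2 / 3 → L p = H (cutoff 0 p.1, p.2) := by
    intro p hp
    by_cases hlt : (p.1 : ℝ) < 1 / 2
    · simp only [L, if_pos hlt]
    · simp only [L, if_neg hlt]
      rw [cut0 2 p.1 (by linarith), cut1 0 p.1 (by linarith), h1, k0]
  have L2 : ∀ p : I × I, 1 / 3 < (p.1 : ℝ) → L p = K (cutoff 2 p.1, p.2) := by
    intro p hp
    by_cases hlt : (p.1 : ℝ) < 1 / 2
    · simp only [L, if_pos hlt]
      rw [cut0 2 p.1 (by linarith), cut1 0 p.1 (by linarith), h1, k0]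
    · simp only [L, if_neg hlt]
  refine ⟨L, ?_, ?_, ?_, ?_⟩
  · intro p
    by_cases hp : (p.1 : ℝ) < 2 / 3
    · refine (key H hH 0 p).congr_of_eventuallyEq ?_
      filter_upwards [hcont.continuousAt.eventually_lt continuousAt_const hp] with q hq
      exact L1 q hq
    · refine (key K hK 2 p).congr_of_eventuallyEq ?_
      have hp' : 1 / 3 < (p.1 : ℝ) := by linarith
      filter_upwards [continuousAt_const.eventually_lt hcont.continuousAt hp'] with q hq
      exact L2 q hq
  · intro s
    by_cases hlt : (s : ℝ) < 1 / 2
    · obtain ⟨g, hg⟩ := hc (cutoff 0 s)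
      exact ⟨g, fun t ↦ by simp only [L, if_pos hlt, hg]⟩
    · obtain ⟨g, hg⟩ := hd (cutoff 2 s)
      exact ⟨g, fun t ↦ by simp only [L, if_neg hlt, hg]⟩
  · intro t
    rw [L1 _ (by norm_num), cut0 0 _ (by norm_num), h0]
  · intro t
    rw [L2 _ (by norm_num), cut1 2 _ (by norm_num), k1]

/-- Isotopy is an equivalence relation on cords. -/
instance isotopySetoid (E B : Set M) : Setoid (Cord E B) where
  r := Isotopic
  iseqv := ⟨Isotopic.refl, Isotopic.symm, Isotopic.trans⟩

/-- The set of isotopy classes of cords. -/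
def IsotopyClass (E B : Set M) : Type u := Quotient (isotopySetoid E B)

/-- The isotopy class of a cord. -/
def isotopyClass (c : Cord E B) : IsotopyClass E B := Quotient.mk _ c

end Cord

end Cord

end CordLemma

end

/-!
An isotopy class of cords is determined by purely homotopical data. Let `E` be the exterior and `B`
its boundary, and call a continuous path of `E` with end points in `B` an arc. Then

* cords up to isotopy are the same as arcs up to homotopy through arcs: every arc is homotopic to a
  cord (`exists_cord_homotopicWith`), and cords which are homotopic through arcs are isotopic
  (`Cord.isotopic_of_homotopicWith`);
* `B` is path connected (`TubularNeighborhood.exists_path_boundary`), and the loops in `B` at the base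
  point represent in the fundamental group of `E` exactly the powers of the meridian
  (`TubularNeighborhood.mem_zpowers_of_mem_boundary`, `TubularNeighborhood.meridianPowClass_eq`).

Given this, join the end points of an arc `c` to the base point by paths `p`, `q` in `B`. Other choices
of `p` and `q` change the class of `p · c · q` by loops in `B`, and so does a homotopy of `c` whose end
points move in `B` (`doubleCoset_eq`). Conversely `c` is homotopic through arcs to `u · c · v` for all
paths `u`, `v` in `B`, so that the double coset determines the homotopy class of `c`
(`homotopicWith_of_doubleCoset_eq`). Every class is attained, as a loop at the base point is itself
an arc.

The first point is a matter of general position. Consider a family of arcs, that is, a map `H` on the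
square such that each `t ↦ H (s, t)` is an arc. It can be made smooth (`exists_smoothing`), then
transverse to `B` at the ends of the arcs and disjoint from `B` elsewhere (`exists_transverse`), then
such that no arc has both end points at the same place (`exists_endpoints_ne`), and finally such that
all arcs are embedded (`exists_embedded`). The last step depends on the dimension of the manifold: a
double point of one of the arcs is described by three parameters `s`, `t`, `t'`, a critical point by
two, and neither occurs generically in dimension `4`. Each step removes a set of defects by
displacements in charts, supported near one parameter; `exists_removing` combines finitely many of
them. Only charts in which `E` is a half space are used (`HalfSpaceChart`); near `B` they come from
the norm of the tubular neighborhood (`TubularNeighborhood.exists_halfSpaceChart`). In place of Sard's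
theorem it suffices that a `C¹` image of a space of smaller dimension has dense complement, by the
theory of Hausdorff dimension (`dimH_solutions_lt`).

For the second point, `B` is a circle bundle over the sphere. Homotopies in the sphere lift to it
(`exists_lift`), and the sphere is simply connected (`Sphere2.homotopic_refl`), so a loop in `B` can be
deformed into the fibre over the base point, which is the meridian.
-/

noncomputable section

namespace CordLemma

/-! ### Dimension of images, and displacements in a chart -/

section

open Set Filter Module

/-- The model space of 4-manifolds. -/
abbrev R4 : Type := EuclideanSpace ℝ (Fin 4)

section GeneralPosition

/-- The dimension bound for `C¹` images, for maps which need only be differentiable within a convex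
set. This covers parameters in an interval or a square without extending the map. -/
theorem dimH_image_le_finrank {F₁ F₂ : Type*} [NormedAddCommGroup F₁] [NormedSpace ℝ F₁]
    [FiniteDimensional ℝ F₁] [NormedAddCommGroup F₂] [NormedSpace ℝ F₂] {f : F₁ → F₂}
    {C s : Set F₁} (hC : Convex ℝ C) (hs : s ⊆ C) (hf : ∀ x ∈ s, ContDiffWithinAt ℝ 1 f C x) :
    dimH (f '' s) ≤ finrank ℝ F₁ := by
  have h1 : dimH (f '' s) ≤ dimH s := dimH_image_le_of_locally_lipschitzOn fun x hx ↦
    let ⟨K, u, hu, hL⟩ := (hf x hx).exists_lipschitzOnWith hC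
    ⟨K, u, nhdsWithin_mono _ hs hu, hL⟩
  exact h1.trans ((dimH_mono (subset_univ s)).trans_eq (Real.dimH_univ_eq_finrank F₁))

theorem exists_norm_lt_notMem {F : Type*} [NormedAddCommGroup F] [NormedSpace ℝ F]
    [FiniteDimensional ℝ F] {A : Set F} (hA : dimH A < finrank ℝ F) {δ : ℝ} (hδ : 0 < δ) :
    ∃ v : F, ‖v‖ < δ ∧ v ∉ A := by
  obtain ⟨v, hv, hv'⟩ := (dense_compl_of_dimH_lt_finrank hA).exists_mem_open Metric.isOpen_ball
    ⟨(0 : F), Metric.mem_ball_self hδ⟩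
  exact ⟨v, by simpa using hv', hv⟩

end GeneralPosition

variable {M : Type*} [TopologicalSpace M]

theorem continuousAt_chart_comp {X : Type*} [TopologicalSpace X] {ψ : OpenPartialHomeomorph M R4}
    (H : C(X, M)) {q : X} (hq : H q ∈ ψ.source) : ContinuousAt (fun x ↦ ψ (H x)) q :=
  (ψ.continuousAt hq).comp H.continuous.continuousAt

section Shift

variable {X : Type*} [TopologicalSpace X] [CompactSpace X]

open Classical in
/-- Any small displacement `D`, supported in a closed set that `H` sends into the domain of the
chart `ψ`, can be added to `H` in the chart `ψ`; the result is close to `H` in the compact-open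
topology. -/
theorem exists_add_in_chart (H : C(X, M)) (ψ : OpenPartialHomeomorph M R4) {K : Set X}
    (hK : IsClosed K) (hKs : ∀ x ∈ K, H x ∈ ψ.source) {N : Set C(X, M)} (hN : N ∈ 𝓝 H) :
    ∃ δ > 0, ∀ D : C(X, R4), (∀ x ∉ K, D x = 0) → (∀ x, ‖D x‖ < δ) →
      ∃ H' ∈ N, (∀ x, H x ∈ ψ.source → H' x ∈ ψ.source ∧ ψ (H' x) = ψ (H x) + D x) ∧
        ∀ x ∉ K, H' x = H x := by
  have hcont : ∀ x, H x ∈ ψ.source → ContinuousAt (fun x ↦ ψ (H x)) x := fun x hx ↦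
    continuousAt_chart_comp H hx
  have hadd : ∀ x, H x ∈ ψ.source →
      Tendsto (fun z : R4 × X ↦ ψ (H z.2) + z.1) (𝓝 (0, x)) (𝓝 (ψ (H x))) := fun x hx ↦ by
    have h2 : ContinuousAt (fun z : R4 × X ↦ ψ (H z.2) + z.1) (0, x) :=
      (ContinuousAt.comp (g := fun x ↦ ψ (H x)) (f := Prod.snd) (x := ((0 : R4), x))
        (hcont x hx) continuousAt_snd).fun_add continuousAt_fst
    simpa [ContinuousAt] using h2
  have htar : ∀ᶠ v : R4 in 𝓝 0, ∀ x ∈ K, ψ (H x) + v ∈ ψ.target := by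
    refine hK.isCompact.eventually_forall_of_forall_eventually fun x hx ↦ ?_
    exact (hadd x (hKs x hx)).eventually (ψ.open_target.mem_nhds (ψ.map_source (hKs x hx)))
  have hU : ∀ (K' : Set X), IsCompact K' → ∀ U : Set M, IsOpen U → MapsTo H K' U →
      ∀ᶠ v : R4 in 𝓝 0, ∀ x ∈ K ∩ K', ψ.symm (ψ (H x) + v) ∈ U := by
    intro K' hK' U hU hmaps
    refine (hK'.inter_left hK).eventually_forall_of_forall_eventually fun x hx ↦ ?_
    have hx' := hKs x hx.1
    have h3 : Tendsto (fun z : R4 × X ↦ ψ.symm (ψ (H z.2) + z.1)) (𝓝 (0, x)) (𝓝 (H x)) := by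
      have := (ψ.continuousAt_symm (ψ.map_source hx')).tendsto
      rw [ψ.left_inv hx'] at this
      exact this.comp (hadd x hx')
    exact h3.eventually (hU.mem_nhds (hmaps hx.2))
  -- `S D` has the junk value `H` unless the shifted map is continuous, so that `hlim` below can be
  -- stated as a limit in `C(X, M)`
  let sh : C(X, R4) → X → M := fun D x ↦ if x ∈ K then ψ.symm (ψ (H x) + D x) else H x
  let S : C(X, R4) → C(X, M) := fun D ↦ if h : Continuous (sh D) then ⟨sh D, h⟩ else H
  have hsrc : ∀ D : C(X, R4), (∀ x ∉ K, D x = 0) → ∀ x, H x ∈ ψ.source →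
      sh D x = ψ.symm (ψ (H x) + D x) := by
    intro D hD x hx
    by_cases hxK : x ∈ K
    · simp [sh, hxK]
    · simp [sh, hxK, hD x hxK, hx]
  have hS : ∀ D : C(X, R4), (∀ x ∉ K, D x = 0) → (∀ x ∈ K, ψ (H x) + D x ∈ ψ.target) →
      ∀ x, S D x = sh D x := by
    intro D hD ht
    have : Continuous (sh D) := by
      refine continuous_iff_continuousAt.2 fun x ↦ ?_
      by_cases hxK : x ∈ K
      · have hx := hKs x hxK
        have h4 : ContinuousAt (fun x ↦ ψ.symm (ψ (H x) + D x)) x :=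
          ContinuousAt.comp (g := ψ.symm) (f := fun x ↦ ψ (H x) + D x)
            (ψ.continuousAt_symm (ht x hxK)) ((hcont x hx).fun_add D.continuous.continuousAt)
        refine h4.congr ?_
        filter_upwards [H.continuous.continuousAt (ψ.open_source.mem_nhds hx)] with y hy
        exact (hsrc D hD y hy).symm
      · refine H.continuous.continuousAt.congr ?_
        filter_upwards [hK.isOpen_compl.mem_nhds hxK] with y hy
        exact (if_neg hy).symm
    intro x
    simp [S, this]
  have hlim : Tendsto S (𝓝 0 ⊓ 𝓟 {D | ∀ x ∉ K, D x = 0}) (𝓝 H) := by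
    refine ContinuousMap.tendsto_nhds_compactOpen.2 fun K' hK' U hUo hmaps ↦ ?_
    obtain ⟨r, hr, hr'⟩ := Metric.eventually_nhds_iff.1 (htar.and (hU K' hK' U hUo hmaps))
    rw [eventually_inf_principal]
    filter_upwards [Metric.ball_mem_nhds (0 : C(X, R4)) hr] with D hDr hD x hx
    have hDx : ∀ x, dist (D x) 0 < r := fun x ↦ by
      rw [dist_zero_right]
      exact (D.norm_coe_le_norm x).trans_lt (by simpa using hDr)
    rw [hS D hD fun y hy ↦ (hr' (hDx y)).1 y hy]
    by_cases hxK : x ∈ K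
    · simpa [sh, hxK] using (hr' (hDx x)).2 x ⟨hxK, hx⟩
    · simpa [sh, hxK] using hmaps hx
  have hev := hlim.eventually hN
  rw [eventually_inf_principal] at hev
  obtain ⟨r, hr, hr'⟩ := Metric.eventually_nhds_iff.1 hev
  obtain ⟨r₂, hr₂, hr₂'⟩ := Metric.eventually_nhds_iff.1 htar
  refine ⟨min r r₂, lt_min hr hr₂, fun D hD hDn ↦ ?_⟩
  have ht : ∀ x ∈ K, ψ (H x) + D x ∈ ψ.target := fun x hx ↦
    hr₂' (by simpa using (hDn x).trans_le (min_le_right _ _)) x hx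
  refine ⟨S D, ?_, ?_, ?_⟩
  · refine hr' ?_ hD
    rw [dist_zero_right, ContinuousMap.norm_lt_iff D hr]
    exact fun x ↦ (hDn x).trans_le (min_le_left _ _)
  · intro x hx
    have htx : ψ (H x) + D x ∈ ψ.target := by
      by_cases hxK : x ∈ K
      · exact ht x hxK
      · rw [hD x hxK, add_zero]; exact ψ.map_source hx
    rw [hS D hD ht, hsrc D hD x hx]
    exact ⟨ψ.map_target htx, ψ.right_inv htx⟩
  · intro x hx
    rw [hS D hD ht]
    simp [sh, hx]

end Shift

end

/-! ### Removing defects locally -/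

section

open Set Filter Module

/-- The model with corners of the square `[0,1] × [0,1]`. -/
abbrev squareModel := (𝓡∂ 1).prod (𝓡∂ 1)

variable {M : Type*} [TopologicalSpace M]

/-- From local to global in a general position argument. Suppose that near each `b ∈ C` the defects
of every admissible map close to `H` can be removed, by an arbitrarily small change which creates no
new defects anywhere. Then all defects in the compact set `C` can be removed.

The hypothesis concerns all maps in the open set `O`, and the change stays in any prescribed
neighborhood `N`, so that the finitely many local changes can be made one after the other. -/
theorem exists_removing {X β : Type*} [TopologicalSpace X] [TopologicalSpace β]
    {Adm : C(X, M) → Prop} {R : C(X, M) → C(X, M) → Prop} {bad : C(X, M) → Set β}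
    (hrefl : ∀ H, Adm H → R H H) (htrans : ∀ H₁ H₂ H₃, R H₁ H₂ → R H₂ H₃ → R H₁ H₃)
    {C : Set β} (hC : IsCompact C) {H : C(X, M)} (hH : Adm H)
    (hloc : ∀ b ∈ C, ∃ O : Set C(X, M), IsOpen O ∧ H ∈ O ∧ ∃ T ∈ 𝓝 b, ∀ H₁ ∈ O, Adm H₁ →
      ∀ N ∈ 𝓝 H₁, ∃ H₂ ∈ N, Adm H₂ ∧ R H₁ H₂ ∧ bad H₂ ⊆ bad H₁ \ T) :
    ∃ H', Adm H' ∧ R H H' ∧ bad H' ⊆ bad H \ C := by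
  choose! O hO hHO T hT hstep using hloc
  obtain ⟨s, hs, hcov⟩ := hC.elim_nhds_subcover T hT
  suffices h : ∀ s : Finset β, (∀ b ∈ s, b ∈ C) → ∀ H, Adm H → (∀ b ∈ s, H ∈ O b) →
      ∃ H', Adm H' ∧ R H H' ∧ bad H' ⊆ bad H \ ⋃ b ∈ s, T b by
    obtain ⟨H', h1, h2, h3⟩ := h s hs H hH fun b hb ↦ hHO b (hs b hb)
    exact ⟨H', h1, h2, h3.trans (sdiff_subset_sdiff_right hcov)⟩
  clear hcov hs s hHO hH H
  classical
  intro s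
  induction s using Finset.induction_on with
  | empty => exact fun _ H hH _ ↦ ⟨H, hH, hrefl H hH, by simp⟩
  | insert b s hb ih =>
    intro hs H hH hHO
    have hN : (⋂ c ∈ s, O c) ∈ 𝓝 H := (Filter.biInter_finset_mem s).2 fun c hc ↦
      (hO c (hs c (Finset.mem_insert_of_mem hc))).mem_nhds (hHO c (Finset.mem_insert_of_mem hc))
    obtain ⟨H₂, hH₂, h1, h2, h3⟩ := hstep b (hs b (Finset.mem_insert_self b s)) H
      (hHO b (Finset.mem_insert_self b s)) hH _ hN
    obtain ⟨H₃, k1, k2, k3⟩ := ih (fun c hc ↦ hs c (Finset.mem_insert_of_mem hc)) H₂ h1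
      (fun c hc ↦ mem_iInter₂.1 hH₂ c hc)
    refine ⟨H₃, k1, htrans _ _ _ h2 k2, fun x hx ↦ ?_⟩
    have hx2 := k3 hx
    have hx3 := h3 hx2.1
    refine ⟨hx3.1, fun hx4 ↦ ?_⟩
    rw [Finset.set_biUnion_insert] at hx4
    exact hx4.elim hx3.2 hx2.2

theorem exists_bump {q : I × I} {W : Set (I × I)} (hW : W ∈ 𝓝 q) :
    ∃ χ : I × I → ℝ, ContMDiff squareModel 𝓘(ℝ, ℝ) ∞ χ ∧ tsupport χ ⊆ W ∧
      (∀ᶠ x in 𝓝 q, χ x = 1) ∧ ∀ x, 0 ≤ χ x ∧ χ x ≤ 1 := by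
  have hbasis : (𝓝 q).HasBasis (fun _ : SmoothBumpFunction squareModel q ↦ True)
      fun f ↦ tsupport f := SmoothBumpFunction.nhds_basis_tsupport q
  obtain ⟨f, hf, hfW⟩ := hbasis.mem_iff.1 hW
  exact ⟨f, f.contMDiff, hfW, f.eventuallyEq_one, fun x ↦ ⟨f.nonneg, f.le_one⟩⟩

/-- A continuous family `t ↦ H (s, t)`, `s ∈ [0,1]`, of arcs in `E` with end points in `B`. -/
def IsArcFamily (E B : Set M) (H : C(I × I, M)) : Prop :=
  (∀ q, H q ∈ E) ∧ ∀ q, q.2 = 0 ∨ q.2 = 1 → H q ∈ B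

/-- `H₂` is deformed from `H₁` through families of arcs, and agrees with `H₁` at parameters
outside `U`. -/
def DeformsOver (E B : Set M) (U : Set I) (H₁ H₂ : C(I × I, M)) : Prop :=
  H₁.HomotopicWith H₂ (IsArcFamily E B) ∧ ∀ q, q.1 ∉ U → H₂ q = H₁ q

variable {E B : Set M} {U : Set I}

theorem DeformsOver.refl {H : C(I × I, M)} (h : IsArcFamily E B H) : DeformsOver E B U H H :=
  ⟨.refl H h, fun _ _ ↦ rfl⟩

theorem DeformsOver.trans {H₁ H₂ H₃ : C(I × I, M)} (h : DeformsOver E B U H₁ H₂)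
    (h' : DeformsOver E B U H₂ H₃) : DeformsOver E B U H₁ H₃ :=
  ⟨h.1.trans h'.1, fun q hq ↦ (h'.2 q hq).trans (h.2 q hq)⟩

variable [ChartedSpace (EuclideanSpace ℝ (Fin 4)) M]

/-- A chart of `M` in which `E` is a half space and `B` its boundary hyperplane. The chart may
miss `B`, so that interior charts, suitably translated, are included. -/
structure HalfSpaceChart (E B : Set M) (ψ : OpenPartialHomeomorph M R4) : Prop where
  contMDiffOn : ContMDiffOn (𝓡 4) (𝓡 4) ∞ ψ ψ.source
  contMDiffOn_symm : ContMDiffOn (𝓡 4) (𝓡 4) ∞ ψ.symm ψ.target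
  mem_iff : ∀ x ∈ ψ.source, x ∈ E ↔ 0 ≤ ψ x 0
  mem_boundary_iff : ∀ x ∈ ψ.source, x ∈ B ↔ ψ x 0 = 0

variable {ψ : OpenPartialHomeomorph M R4}

/-- A family of arcs may be displaced by any small `D` in a half-space chart, provided that the arcs
stay in the half space and their end points in the boundary hyperplane: the multiples `r • D`,
`r ∈ [0,1]`, then deform the family through families of arcs. -/
theorem HalfSpaceChart.exists_deformation (hψ : HalfSpaceChart E B ψ) {H : C(I × I, M)}
    (hH : IsArcFamily E B H) {K : Set (I × I)}
    (hK : IsClosed K) (hKs : ∀ q ∈ K, H q ∈ ψ.source) (hKU : ∀ q ∈ K, q.1 ∈ U)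
    {N : Set C(I × I, M)} (hN : N ∈ 𝓝 H) :
    ∃ δ > 0, ∀ D : C(I × I, R4), (∀ q ∉ K, D q = 0) → (∀ q, ‖D q‖ < δ) →
      (∀ q, H q ∈ ψ.source → 0 ≤ ψ (H q) 0 + D q 0) →
      (∀ q, H q ∈ ψ.source → (q.2 = 0 ∨ q.2 = 1) → D q 0 = 0) →
      ∃ H' ∈ N, IsArcFamily E B H' ∧ DeformsOver E B U H H' ∧
        (∀ q, H q ∈ ψ.source → H' q ∈ ψ.source ∧ ψ (H' q) = ψ (H q) + D q) ∧
        ∀ q ∉ K, H' q = H q := by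
  obtain ⟨δ₁, hδ₁, h₁⟩ := exists_add_in_chart H ψ hK hKs hN
  -- the displacements `r • D`, applied to all `r` at once so as to be continuous in `r`
  obtain ⟨δ₂, hδ₂, h₂⟩ := exists_add_in_chart (X := I × (I × I)) (H.comp ⟨Prod.snd, continuous_snd⟩)
    ψ (K := Prod.snd ⁻¹' K) (hK.preimage continuous_snd) (fun x hx ↦ hKs _ hx) univ_mem
  refine ⟨min δ₁ δ₂, lt_min hδ₁ hδ₂, fun D hD hDn hpos hend ↦ ?_⟩
  obtain ⟨H', hN', hc, hoff⟩ := h₁ D hD fun x ↦ (hDn x).trans_le (min_le_left _ _)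
  have hnorm : ∀ (r : I) q, ‖(r : ℝ) • D q‖ < δ₂ := fun r q ↦ by
    rw [norm_smul]
    have h1 : ‖(r : ℝ)‖ ≤ 1 := by
      rw [Real.norm_of_nonneg r.2.1]; exact r.2.2
    have h2 := (hDn q).trans_le (min_le_right δ₁ δ₂)
    nlinarith [norm_nonneg (D q), norm_nonneg (r : ℝ)]
  obtain ⟨F, -, hFc, hFoff⟩ := h₂ ⟨fun z ↦ (z.1 : ℝ) • D z.2, by fun_prop⟩
    (fun x hx ↦ by simp [hD x.2 hx]) (fun x ↦ hnorm x.1 x.2)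
  simp only [ContinuousMap.comp_apply, ContinuousMap.coe_mk] at hFc hFoff
  have hF : ∀ r : I, IsArcFamily E B ⟨fun q ↦ F (r, q), by fun_prop⟩ := by
    intro r
    constructor
    · intro q
      by_cases hq : H q ∈ ψ.source
      · obtain ⟨h3, h4⟩ := hFc (r, q) hq
        refine (hψ.mem_iff _ h3).2 ?_
        have h5 := hpos q hq
        have h6 := (hψ.mem_iff _ hq).1 (hH.1 q)
        rw [h4]
        simp only [PiLp.add_apply, PiLp.smul_apply, smul_eq_mul]
        nlinarith [r.2.1, r.2.2]
      · have : q ∉ K := fun h ↦ hq (hKs q h)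
        simpa [hFoff (r, q) this] using hH.1 q
    · intro q hq'
      by_cases hq : H q ∈ ψ.source
      · obtain ⟨h3, h4⟩ := hFc (r, q) hq
        refine (hψ.mem_boundary_iff _ h3).2 ?_
        have h6 := (hψ.mem_boundary_iff _ hq).1 (hH.2 q hq')
        rw [h4]
        simp [hend q hq hq', h6]
      · have : q ∉ K := fun h ↦ hq (hKs q h)
        simpa [hFoff (r, q) this] using hH.2 q hq'
  have hF0 : ∀ q, F (0, q) = H q := by
    intro q
    by_cases hq : H q ∈ ψ.source
    · obtain ⟨h3, h4⟩ := hFc (0, q) hq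
      exact ψ.injOn h3 hq (by simpa using h4)
    · exact hFoff (0, q) fun h ↦ hq (hKs q h)
  have hF1 : ∀ q, F (1, q) = H' q := by
    intro q
    by_cases hq : H q ∈ ψ.source
    · obtain ⟨h3, h4⟩ := hFc (1, q) hq
      obtain ⟨h5, h6⟩ := hc q hq
      exact ψ.injOn h3 h5 (by rw [h4, h6]; simp)
    · rw [hoff q fun h ↦ hq (hKs q h)]
      exact hFoff (1, q) fun h ↦ hq (hKs q h)
  refine ⟨H', hN', ?_, ⟨⟨⟨⟨F, hF0, hF1⟩, hF⟩⟩, fun q hq ↦ hoff q fun h ↦ hq (hKU q h)⟩, hc, hoff⟩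
  convert hF 1 using 1
  ext q
  exact (hF1 q).symm

theorem HalfSpaceChart.contMDiffAt_comp (hψ : HalfSpaceChart E B ψ) {H : I × I → M} {q : I × I}
    (hq : H q ∈ ψ.source) (h : ContMDiffAt squareModel (𝓡 4) ∞ H q) :
    ContMDiffAt squareModel (𝓡 4) ∞ (fun x ↦ ψ (H x)) q :=
  ((hψ.contMDiffOn _ hq).contMDiffAt (ψ.open_source.mem_nhds hq)).comp q h

theorem HalfSpaceChart.contMDiffAt_of_comp (hψ : HalfSpaceChart E B ψ) {H : I × I → M} {q : I × I}
    (hq : ∀ᶠ x in 𝓝 q, H x ∈ ψ.source)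
    (h : ContMDiffAt squareModel (𝓡 4) ∞ (fun x ↦ ψ (H x)) q) :
    ContMDiffAt squareModel (𝓡 4) ∞ H q := by
  have h1 := ((hψ.contMDiffOn_symm _ (ψ.map_source hq.self_of_nhds)).contMDiffAt
    (ψ.open_target.mem_nhds (ψ.map_source hq.self_of_nhds))).comp q h
  refine h1.congr_of_eventuallyEq ?_
  filter_upwards [hq] with x hx
  exact (ψ.left_inv hx).symm

end

/-! ### Smoothing -/

section

open Set Filter Module

variable {M : Type*} [TopologicalSpace M]
  [ChartedSpace (EuclideanSpace ℝ (Fin 4)) M] {E B : Set M} {ψ : OpenPartialHomeomorph M R4}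

/-- In a half-space chart, a family of arcs is approximated by a smooth map that still satisfies the
conditions defining a family of arcs. At each parameter these conditions cut out a convex set, and
they are locally satisfied by constants, so a smooth partition of unity yields the map. -/
theorem HalfSpaceChart.exists_smooth_approx (hψ : HalfSpaceChart E B ψ) {H : C(I × I, M)}
    (hH : IsArcFamily E B H) {K : Set (I × I)} (hK : IsClosed K) (hKs : ∀ q ∈ K, H q ∈ ψ.source)
    {δ : ℝ} (hδ : 0 < δ) : ∃ P : I × I → R4, ContMDiff squareModel (𝓡 4) ∞ P ∧ ∀ q ∈ K,
      ‖P q - ψ (H q)‖ < δ ∧ 0 ≤ P q 0 ∧ (q.2 = 0 ∨ q.2 = 1 → P q 0 = 0) := by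
  let t : I × I → Set R4 := fun q ↦
    {v | q ∈ K → ‖v - ψ (H q)‖ < δ ∧ 0 ≤ v 0 ∧ (q.2 = 0 ∨ q.2 = 1 → v 0 = 0)}
  have ht : ∀ q, Convex ℝ (t q) := by
    intro q v hv w hw a b ha hb hab hq
    obtain ⟨v1, v2, v3⟩ := hv hq
    obtain ⟨w1, w2, w3⟩ := hw hq
    refine ⟨?_, ?_, fun h ↦ ?_⟩
    · have := (convex_ball (ψ (H q)) δ) (mem_ball_iff_norm.2 v1) (mem_ball_iff_norm.2 w1) ha hb hab
      exact mem_ball_iff_norm.1 this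
    · simp only [PiLp.add_apply, PiLp.smul_apply, smul_eq_mul]; positivity
    · simp [v3 h, w3 h]
  obtain ⟨P, hP⟩ := exists_contMDiffMap_forall_mem_convex_of_local_const (n := (⊤ : ℕ∞)) squareModel ht
    (fun q ↦ by
      by_cases hq : q ∈ K
      · have hs := hKs q hq
        refine ⟨ψ (H q), ?_⟩
        have h1 : ∀ᶠ y in 𝓝 q, ‖ψ (H q) - ψ (H y)‖ < δ := by
          have h2 := (continuousAt_chart_comp H hs).eventually (Metric.ball_mem_nhds _ hδ)
          filter_upwards [h2] with y hy
          rwa [dist_comm, dist_eq_norm] at hy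
        have h3 : ∀ᶠ y : I × I in 𝓝 q, (y.2 = 0 ∨ y.2 = 1) → ψ (H q) 0 = 0 := by
          by_cases hq2 : q.2 = 0 ∨ q.2 = 1
          · exact Eventually.of_forall fun y _ ↦ (hψ.mem_boundary_iff _ hs).1 (hH.2 q hq2)
          · push Not at hq2
            filter_upwards [continuousAt_snd.eventually_ne hq2.1,
              continuousAt_snd.eventually_ne hq2.2] with y h4 h5 h6
            exact (h6.elim h4 h5).elim
        filter_upwards [h1, h3] with y h4 h5 _
        exact ⟨h4, (hψ.mem_iff _ hs).1 (hH.1 q), h5⟩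
      · refine ⟨0, ?_⟩
        filter_upwards [hK.isOpen_compl.mem_nhds hq] with y hy hy'
        exact (hy hy').elim)
  exact ⟨P, P.contMDiff, fun q hq ↦ hP q hq⟩

/-- A family of arcs which is smooth outside the parameters in `C` can be made smooth by a
deformation over a neighborhood `U` of `C`. -/
theorem exists_smoothing (hE : ∀ y ∈ E, ∃ ψ, HalfSpaceChart E B ψ ∧ y ∈ ψ.source)
    {H : C(I × I, M)} (hH : IsArcFamily E B H) {C U : Set I} (hC : IsCompact C) (hU : IsOpen U)
    (hCU : C ⊆ U) (hsm : ∀ q, q.1 ∉ C → ContMDiffAt squareModel (𝓡 4) ∞ H q) :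
    ∃ H' : C(I × I, M), IsArcFamily E B H' ∧ DeformsOver E B U H H' ∧
      ContMDiff squareModel (𝓡 4) ∞ H' := by
  obtain ⟨H', h1, h2, h3⟩ := exists_removing (Adm := IsArcFamily E B) (R := DeformsOver E B U)
    (bad := fun H ↦ {q | ¬ ContMDiffAt squareModel (𝓡 4) ∞ H q}) (fun _ h ↦ .refl h)
    (fun _ _ _ ↦ .trans) (hC.prod isCompact_univ) hH (fun b hb ↦ by
      obtain ⟨ψ, hψ, hbψ⟩ := hE _ (hH.1 b)
      obtain ⟨χ, hχ, hχW, hχ1, hχI⟩ := exists_bump (q := b)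
        (W := {q | H q ∈ ψ.source ∧ q.1 ∈ U}) (inter_mem
          (H.continuous.continuousAt (ψ.open_source.mem_nhds hbψ))
          (continuousAt_fst (hU.mem_nhds (hCU hb.1))))
      have hK := isClosed_tsupport χ
      refine ⟨{H | MapsTo H (tsupport χ) ψ.source},
        ContinuousMap.isOpen_setOfPred_mapsTo hK.isCompact ψ.open_source, fun q hq ↦ (hχW hq).1,
        {q | ∀ᶠ x in 𝓝 q, χ x = 1}, eventually_eventually_nhds.2 hχ1, ?_⟩
      intro H₁ hO hH₁ N hN
      -- interpolate in the chart between `H₁` and a smooth approximation `P`, by means of `χ`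
      obtain ⟨δ, hδ, hdef⟩ := hψ.exists_deformation hH₁ hK hO (fun q hq ↦ (hχW hq).2) hN
      obtain ⟨P, hP, hPK⟩ := hψ.exists_smooth_approx hH₁ hK hO hδ
      have hχ0 : ∀ q ∉ tsupport χ, χ q = 0 := fun q hq ↦ image_eq_zero_of_notMem_tsupport hq
      have hD : Continuous fun q ↦ χ q • (P q - ψ (H₁ q)) := by
        refine continuous_iff_continuousAt.2 fun q ↦ ?_
        by_cases hq : q ∈ tsupport χ
        · exact hχ.continuous.continuousAt.smul
            (hP.continuous.continuousAt.sub (continuousAt_chart_comp H₁ (hO hq)))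
        · refine (continuousAt_const (y := (0 : R4))).congr ?_
          filter_upwards [hK.isOpen_compl.mem_nhds hq] with x hx
          simp [hχ0 x hx]
      obtain ⟨H₂, hN₂, hA, hdf, hch, hoff⟩ := hdef ⟨_, hD⟩ (fun q hq ↦ by simp [hχ0 q hq])
        (fun q ↦ by
          by_cases hq : q ∈ tsupport χ
          · have h1 := (hPK q hq).1
            have h2 := hχI q
            simp only [ContinuousMap.coe_mk, norm_smul, Real.norm_of_nonneg h2.1]
            nlinarith [norm_nonneg (P q - ψ (H₁ q))]
          · simpa [hχ0 q hq] using hδ)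
        (fun q hq' ↦ by
          have h0 := (hψ.mem_iff _ hq').1 (hH₁.1 q)
          by_cases hq : q ∈ tsupport χ
          · have h1 := (hPK q hq).2.1
            have h2 := hχI q
            simp only [ContinuousMap.coe_mk, PiLp.smul_apply, PiLp.sub_apply, smul_eq_mul]
            nlinarith [mul_nonneg h2.1 h1, mul_nonneg (sub_nonneg.2 h2.2) h0]
          · simpa [hχ0 q hq] using h0)
        (fun q hq' hq2 ↦ by
          have h0 := (hψ.mem_boundary_iff _ hq').1 (hH₁.2 q hq2)
          by_cases hq : q ∈ tsupport χ
          · simp [(hPK q hq).2.2 hq2, h0]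
          · simp [hχ0 q hq])
      refine ⟨H₂, hN₂, hA, hdf, fun q hq ↦ ?_⟩
      simp only [Set.mem_sdiff, mem_ofPred_eq] at hq ⊢
      refine ⟨fun hs ↦ hq ?_, fun h1 ↦ hq ?_⟩
      · by_cases hqK : q ∈ tsupport χ
        · have hev : ∀ᶠ x in 𝓝 q, H₁ x ∈ ψ.source :=
            H₁.continuous.continuousAt (ψ.open_source.mem_nhds (hO hqK))
          refine hψ.contMDiffAt_of_comp (hev.mono fun x hx ↦ (hch x hx).1) ?_
          have h2 := hψ.contMDiffAt_comp (hO hqK) hs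
          refine (h2.add (hχ.contMDiffAt.smul (hP.contMDiffAt.sub h2))).congr_of_eventuallyEq ?_
          exact hev.mono fun x hx ↦ (hch x hx).2
        · refine hs.congr_of_eventuallyEq ?_
          filter_upwards [hK.isOpen_compl.mem_nhds hqK] with x hx using hoff x hx
      · have hqK : q ∈ tsupport χ := subset_tsupport _ (by simp [h1.self_of_nhds])
        have hev : ∀ᶠ x in 𝓝 q, H₁ x ∈ ψ.source :=
          H₁.continuous.continuousAt (ψ.open_source.mem_nhds (hO hqK))
        refine hψ.contMDiffAt_of_comp (hev.mono fun x hx ↦ (hch x hx).1) ?_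
        refine hP.contMDiffAt.congr_of_eventuallyEq ?_
        filter_upwards [hev, h1] with x hx hx1
        simp [(hch x hx).2, hx1])
  refine ⟨H', h1, h2, fun q ↦ by_contra fun hq ↦ ?_⟩
  obtain ⟨h4, h5⟩ := h3 hq
  exact h4 (hsm q fun h ↦ h5 ⟨h, mem_univ _⟩)

end

/-! ### Velocities of curves in charts -/

section

open Set Filter Module

/-- The retraction of `ℝ` onto `[0,1]`. -/
abbrev pr : ℝ → I := projIcc 0 1 zero_le_one

section Calculus

variable {F : Type*} [NormedAddCommGroup F] [NormedSpace ℝ F]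

theorem contDiffWithinAt_comp_pr {g : I → F} {t : I} (h : ContMDiffAt (𝓡∂ 1) 𝓘(ℝ, F) ∞ g t) :
    ContDiffWithinAt ℝ ∞ (fun τ : ℝ ↦ g (pr τ)) (Icc 0 1) t :=
  contMDiffWithinAt_iff_contDiffWithinAt.1 (contMDiffWithinAt_comp_projIcc_iff.2 h)

theorem differentiableWithinAt_comp_pr {g : I → F} {t : I}
    (h : ContMDiffAt (𝓡∂ 1) 𝓘(ℝ, F) ∞ g t) :
    DifferentiableWithinAt ℝ (fun τ : ℝ ↦ g (pr τ)) (Icc 0 1) t :=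
  (contDiffWithinAt_comp_pr h).differentiableWithinAt (by simp)

/-- The derivative of a vector-valued function on `[0,1]`, one-sided at the end points. -/
def velocity (g : I → F) (t : I) : F := derivWithin (fun τ : ℝ ↦ g (pr τ)) (Icc 0 1) t

theorem hasDerivWithinAt_velocity {g : I → F} {t : I} (h : ContMDiffAt (𝓡∂ 1) 𝓘(ℝ, F) ∞ g t) :
    HasDerivWithinAt (fun τ : ℝ ↦ g (pr τ)) (velocity g t) (Icc 0 1) t :=
  (differentiableWithinAt_comp_pr h).hasDerivWithinAt

theorem velocity_eq {g : I → F} {t : I} {v : F}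
    (h : HasDerivWithinAt (fun τ : ℝ ↦ g (pr τ)) v (Icc 0 1) t) : velocity g t = v :=
  h.derivWithin (uniqueDiffOn_Icc zero_lt_one _ t.2)

theorem tendsto_pr (t : I) : Tendsto pr (𝓝[Icc 0 1] t) (𝓝 t) := by
  have : ContinuousAt pr t := continuous_projIcc.continuousAt
  have h := this.tendsto
  rw [show pr (t : ℝ) = t from projIcc_val zero_le_one t] at h
  exact h.mono_left nhdsWithin_le_nhds

theorem velocity_congr {g g' : I → F} {t : I} (h : g' =ᶠ[𝓝 t] g) :
    velocity g' t = velocity g t := by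
  refine Filter.EventuallyEq.derivWithin_eq ((tendsto_pr t).eventually h) ?_
  simpa using h.self_of_nhds

theorem velocity_coord {g : I → R4} {t : I} (h : ContMDiffAt (𝓡∂ 1) 𝓘(ℝ, R4) ∞ g t) (i : Fin 4) :
    velocity (fun τ ↦ g τ i) t = velocity g t i :=
  velocity_eq ((EuclideanSpace.proj i : R4 →L[ℝ] ℝ).hasFDerivAt.comp_hasDerivWithinAt _
    (hasDerivWithinAt_velocity h))

theorem velocity_nonneg {g : I → ℝ} (h : ContMDiffAt (𝓡∂ 1) 𝓘(ℝ, ℝ) ∞ g 0)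
    (hmin : ∀ᶠ t in 𝓝 (0 : I), g 0 ≤ g t) : 0 ≤ velocity g 0 := by
  have h1 : IsLocalMinOn (fun τ : ℝ ↦ g (pr τ)) (Icc 0 1) ((0 : I) : ℝ) := by
    filter_upwards [(tendsto_pr 0).eventually hmin] with τ hτ
    simpa using hτ
  have h2 := h1.hasFDerivWithinAt_nonneg (hasDerivWithinAt_velocity h).hasFDerivWithinAt
    (y := 1) (by
      have := sub_mem_posTangentConeAt_of_segment_subset (s := Icc (0 : ℝ) 1) (x := 0) (y := 1) (by
        rw [segment_eq_Icc zero_le_one])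
      simpa using this)
  simpa using h2

theorem velocity_nonpos {g : I → ℝ} (h : ContMDiffAt (𝓡∂ 1) 𝓘(ℝ, ℝ) ∞ g 1)
    (hmin : ∀ᶠ t in 𝓝 (1 : I), g 1 ≤ g t) : velocity g 1 ≤ 0 := by
  have h1 : IsLocalMinOn (fun τ : ℝ ↦ g (pr τ)) (Icc 0 1) ((1 : I) : ℝ) := by
    filter_upwards [(tendsto_pr 1).eventually hmin] with τ hτ
    simpa using hτ
  have h2 := h1.hasFDerivWithinAt_nonneg (hasDerivWithinAt_velocity h).hasFDerivWithinAt
    (y := -1) (by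
      have := sub_mem_posTangentConeAt_of_segment_subset (s := Icc (0 : ℝ) 1) (x := 1) (y := 0) (by
        rw [segment_symm, segment_eq_Icc zero_le_one])
      simpa using this)
  simpa using h2

end Calculus

variable {M : Type*} [TopologicalSpace M]
  [ChartedSpace (EuclideanSpace ℝ (Fin 4)) M] {E B : Set M} {ψ : OpenPartialHomeomorph M R4}

theorem HalfSpaceChart.mdifferentiable (hψ : HalfSpaceChart E B ψ) :
    ψ.MDifferentiable (𝓡 4) (𝓡 4) :=
  ⟨hψ.contMDiffOn.mdifferentiableOn (by simp), hψ.contMDiffOn_symm.mdifferentiableOn (by simp)⟩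

theorem HalfSpaceChart.mfderiv_mfderiv_one (hψ : HalfSpaceChart E B ψ) {c : I → M} {t : I}
    (ht : c t ∈ ψ.source) (hc : ContMDiffAt (𝓡∂ 1) (𝓡 4) ∞ c t) :
    mfderiv (𝓡 4) (𝓡 4) ψ (c t) (mfderiv (𝓡∂ 1) (𝓡 4) c t 1) = velocity (fun τ ↦ ψ (c τ)) t := by
  have h1 : mfderivWithin 𝓘(ℝ, ℝ) (𝓡 4) ((ψ ∘ c) ∘ pr) (Icc 0 1) (t : ℝ) 1 =
    mfderiv (𝓡∂ 1) (𝓡 4) (ψ ∘ c) t 1 := mfderivWithin_comp_projIcc_one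
  rw [mfderiv_comp t (hψ.mdifferentiable.mdifferentiableAt ht)
    (hc.mdifferentiableAt (by simp)), mfderivWithin_eq_fderivWithin] at h1
  refine h1.symm.trans ?_
  exact fderivWithin_derivWithin

theorem HalfSpaceChart.velocity_eq_zero_iff (hψ : HalfSpaceChart E B ψ) {c : I → M} {t : I}
    (ht : c t ∈ ψ.source) (hc : ContMDiffAt (𝓡∂ 1) (𝓡 4) ∞ c t) :
    velocity (fun τ ↦ ψ (c τ)) t = 0 ↔ mfderiv (𝓡∂ 1) (𝓡 4) c t 1 = 0 := by
  rw [← hψ.mfderiv_mfderiv_one ht hc]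
  constructor
  · intro h
    exact hψ.mdifferentiable.mfderiv_injective ht (h.trans (map_zero _).symm)
  · intro h
    rw [h]; exact map_zero _

/-- The coordinates of a tangent vector in the chart `ψ`. -/
def chartCoord (ψ : OpenPartialHomeomorph M R4) (ξ : TangentBundle (𝓡 4) M) : R4 :=
  mfderiv (𝓡 4) (𝓡 4) ψ ξ.1 ξ.2

theorem HalfSpaceChart.tangent_ext (hψ : HalfSpaceChart E B ψ) {ξ η : TangentBundle (𝓡 4) M}
    (hξ : ξ.1 ∈ ψ.source) (h : ξ.1 = η.1)
    (h' : chartCoord ψ ξ = chartCoord ψ η) : ξ = η := by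
  obtain ⟨x, v⟩ := ξ
  obtain ⟨y, w⟩ := η
  obtain rfl : x = y := h
  have : v = w := hψ.mdifferentiable.mfderiv_injective hξ h'
  rw [this]

theorem HalfSpaceChart.mem_tangentsTo_iff (hψ : HalfSpaceChart E B ψ) {ξ : TangentBundle (𝓡 4) M}
    (hξ : ξ.1 ∈ ψ.source) (hξB : ξ.1 ∈ B) :
    ξ ∈ tangentsTo B ↔ chartCoord ψ ξ 0 = 0 := by
  have key : ∀ γ : ℝ → M, γ 0 ∈ ψ.source → ContMDiffAt 𝓘(ℝ, ℝ) (𝓡 4) ∞ γ 0 → ∀ w : R4,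
      HasDerivAt (fun s ↦ ψ (γ s)) w 0 →
      chartCoord ψ ⟨γ 0, mfderiv 𝓘(ℝ, ℝ) (𝓡 4) γ 0 1⟩ = w := by
    intro γ h0 hγ w hw
    have h1 := mfderiv_comp (0 : ℝ) (hψ.mdifferentiable.mdifferentiableAt h0)
      (hγ.mdifferentiableAt (by simp))
    have h2 : mfderiv 𝓘(ℝ, ℝ) (𝓡 4) (ψ ∘ γ) 0 = fderiv ℝ (ψ ∘ γ) 0 := mfderiv_eq_fderiv
    rw [h2] at h1
    have h3 : fderiv ℝ (ψ ∘ γ) 0 1 = w := hw.hasFDerivAt.fderiv ▸ by simp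
    rw [h1] at h3
    exact h3
  constructor
  · rintro ⟨γ, hγ, hB, rfl⟩
    have hev : ∀ᶠ s in 𝓝 (0 : ℝ), γ s ∈ ψ.source :=
      hγ.continuous.continuousAt (ψ.open_source.mem_nhds hξ)
    have h1 : DifferentiableAt ℝ (fun s ↦ ψ (γ s)) 0 := by
      have h2 := ((hψ.contMDiffOn _ hξ).contMDiffAt (ψ.open_source.mem_nhds hξ)).comp (0 : ℝ)
        (hγ 0)
      exact (contMDiffAt_iff_contDiffAt.1 h2).differentiableAt (by simp)
    rw [key γ hξ (hγ 0) _ h1.hasDerivAt]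
    have h4 := (EuclideanSpace.proj 0 : R4 →L[ℝ] ℝ).hasFDerivAt.comp_hasDerivAt _ h1.hasDerivAt
    have h5 : (fun s ↦ ψ (γ s) 0) =ᶠ[𝓝 0] fun _ ↦ (0 : ℝ) := by
      filter_upwards [hev] with s hs using (hψ.mem_boundary_iff _ hs).1 (hB s)
    exact (h4.congr_of_eventuallyEq h5.symm).unique (hasDerivAt_const _ _)
  · intro h
    obtain ⟨r, hr, hball⟩ := Metric.isOpen_iff.1 ψ.open_target _ (ψ.map_source hξ)
    set w : R4 := chartCoord ψ ξ with hw
    -- the bounded parameter `ε * sin (s / ε)` keeps the curve inside the chart for all `s`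
    obtain ⟨ε, hε, hεr⟩ : ∃ ε > 0, ε * (‖w‖ + 1) < r := ⟨r / (2 * (‖w‖ + 1)), by positivity, by
      field_simp; linarith⟩
    have hκ : ContDiff ℝ ∞ fun s : ℝ ↦ ψ ξ.1 + (ε * Real.sin (s / ε)) • w := by fun_prop
    have hmem : ∀ s : ℝ, ψ ξ.1 + (ε * Real.sin (s / ε)) • w ∈ ψ.target := fun s ↦ by
      refine hball ?_
      rw [mem_ball_iff_norm, add_sub_cancel_left, norm_smul, norm_mul, Real.norm_of_nonneg hε.le,
        Real.norm_eq_abs]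
      have := Real.abs_sin_le_one (s / ε)
      have h1 : ε * |Real.sin (s / ε)| * ‖w‖ ≤ ε * 1 * ‖w‖ := by gcongr
      nlinarith
    have hγ0 : ψ.symm (ψ ξ.1 + (ε * Real.sin (0 / ε)) • w) = ξ.1 := by simp [ψ.left_inv hξ]
    have hγ : ContMDiff 𝓘(ℝ, ℝ) (𝓡 4) ∞
        fun s : ℝ ↦ ψ.symm (ψ ξ.1 + (ε * Real.sin (s / ε)) • w) :=
      hψ.contMDiffOn_symm.comp_contMDiff hκ.contMDiff hmem
    refine ⟨_, hγ, fun s ↦ ?_, ?_⟩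
    · refine (hψ.mem_boundary_iff _ (ψ.map_target (hmem s))).2 ?_
      rw [ψ.right_inv (hmem s)]
      simp [h, (hψ.mem_boundary_iff _ hξ).1 hξB]
    · refine hψ.tangent_ext hξ hγ0.symm ?_
      refine ((key _ (by rw [hγ0]; exact hξ) (hγ 0) w ?_).trans hw).symm
      have h1 : HasDerivAt (fun s : ℝ ↦ ψ ξ.1 + (ε * Real.sin (s / ε)) • w) w 0 := by
        have h2 : HasDerivAt (fun s : ℝ ↦ ε * Real.sin (s / ε)) 1 0 := by
          have := (((hasDerivAt_id (0 : ℝ)).div_const ε).sin).const_mul ε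
          simpa [hε.ne'] using this
        simpa using (h2.smul_const w).const_add (ψ ξ.1)
      refine h1.congr_of_eventuallyEq (Eventually.of_forall fun s ↦ ?_)
      exact ψ.right_inv (hmem s)

end

/-! ### Transversality at the boundary -/

section

open Set Filter Module

variable {M : Type*} [TopologicalSpace M]
  [ChartedSpace (EuclideanSpace ℝ (Fin 4)) M] {E B : Set M} {ψ : OpenPartialHomeomorph M R4}

theorem contMDiffAt_slice {H' N : Type*} [TopologicalSpace H'] [TopologicalSpace N]
    {F : Type*} [NormedAddCommGroup F] [NormedSpace ℝ F] {J : ModelWithCorners ℝ F H'}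
    [ChartedSpace H' N] {G : I × I → N} {q : I × I} (h : ContMDiffAt squareModel J ∞ G q) :
    ContMDiffAt (𝓡∂ 1) J ∞ (fun t ↦ G (q.1, t)) q.2 :=
  ContMDiffAt.comp (I' := squareModel) (g := G) (f := fun t ↦ (q.1, t)) q.2 h
    (contMDiffAt_const.prodMk contMDiffAt_id)

/-- Adding a smooth displacement in a chart keeps a family smooth. -/
theorem HalfSpaceChart.contMDiff_of_add (hψ : HalfSpaceChart E B ψ) {H H' : C(I × I, M)}
    {K : Set (I × I)} (hK : IsClosed K) (hKs : ∀ q ∈ K, H q ∈ ψ.source) {D : I × I → R4}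
    (hD : ContMDiff squareModel (𝓡 4) ∞ D) (hH : ContMDiff squareModel (𝓡 4) ∞ H)
    (hch : ∀ q, H q ∈ ψ.source → H' q ∈ ψ.source ∧ ψ (H' q) = ψ (H q) + D q)
    (hoff : ∀ q ∉ K, H' q = H q) : ContMDiff squareModel (𝓡 4) ∞ H' := by
  intro q
  by_cases hq : q ∈ K
  · have hev : ∀ᶠ x in 𝓝 q, H x ∈ ψ.source :=
      H.continuous.continuousAt (ψ.open_source.mem_nhds (hKs q hq))
    refine hψ.contMDiffAt_of_comp (hev.mono fun x hx ↦ (hch x hx).1) ?_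
    refine ((hψ.contMDiffAt_comp (hKs q hq) (hH q)).add (hD q)).congr_of_eventuallyEq ?_
    exact hev.mono fun x hx ↦ (hch x hx).2
  · refine (hH q).congr_of_eventuallyEq ?_
    filter_upwards [hK.isOpen_compl.mem_nhds hq] with x hx using hoff x hx

/-- The velocity vector at `q = (s, t)` of the arc `t ↦ H (s, t)`. -/
def velocityVector (H : I × I → M) (q : I × I) : TangentBundle (𝓡 4) M :=
  ⟨H (q.1, q.2), mfderiv (𝓡∂ 1) (𝓡 4) (fun t ↦ H (q.1, t)) q.2 1⟩

theorem HalfSpaceChart.chartCoord_velocityVector (hψ : HalfSpaceChart E B ψ) {H : I × I → M}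
    {q : I × I} (hq : H q ∈ ψ.source) (hs : ContMDiffAt squareModel (𝓡 4) ∞ H q) :
    chartCoord ψ (velocityVector H q) = velocity (fun t ↦ ψ (H (q.1, t))) q.2 :=
  hψ.mfderiv_mfderiv_one (c := fun t ↦ H (q.1, t)) hq (contMDiffAt_slice hs)

theorem velocityVector_congr {H H' : I × I → M} {q : I × I} (h : H' =ᶠ[𝓝 q] H) :
    velocityVector H' q = velocityVector H q := by
  have h1 : (fun t ↦ H' (q.1, t)) =ᶠ[𝓝 q.2] fun t ↦ H (q.1, t) :=
    (Continuous.prodMk_right q.1).continuousAt.eventually h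
  have h2 : H' (q.1, q.2) = H (q.1, q.2) := h.self_of_nhds
  exact Bundle.TotalSpace.ext h2 (heq_of_eq (DFunLike.congr_fun h1.mfderiv_eq 1))

/-- The parameters at which the family `H` of arcs touches `B` in the interior of an arc, or
meets it non-transversally at an end point. -/
def boundaryDefect (B : Set M) (H : I × I → M) : Set (I × I) :=
  {q | H q ∈ B ∧ ((q.2 = 0 ∨ q.2 = 1) → velocityVector H q ∈ tangentsTo B)}

theorem boundaryDefect_congr {H H' : I × I → M} {q : I × I} (h : H' =ᶠ[𝓝 q] H) :
    q ∈ boundaryDefect B H' ↔ q ∈ boundaryDefect B H := by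
  simp only [boundaryDefect, mem_ofPred_eq, velocityVector_congr h, h.self_of_nhds]

theorem HalfSpaceChart.contMDiffAt_coord (hψ : HalfSpaceChart E B ψ) {H : I × I → M}
    {q : I × I} (hq : H q ∈ ψ.source) (hs : ContMDiffAt squareModel (𝓡 4) ∞ H q) (i : Fin 4) :
    ContMDiffAt (𝓡∂ 1) 𝓘(ℝ, ℝ) ∞ (fun t ↦ ψ (H (q.1, t)) i) q.2 :=
  ((EuclideanSpace.proj i : R4 →L[ℝ] ℝ).contMDiff.contMDiffAt).comp q.2
    (contMDiffAt_slice (hψ.contMDiffAt_comp hq hs))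

theorem HalfSpaceChart.mem_boundaryDefect_iff (hψ : HalfSpaceChart E B ψ) {H : I × I → M}
    {q : I × I} (hq : H q ∈ ψ.source) (hs : ContMDiffAt squareModel (𝓡 4) ∞ H q) :
    q ∈ boundaryDefect B H ↔ ψ (H q) 0 = 0 ∧
      ((q.2 = 0 ∨ q.2 = 1) → velocity (fun t ↦ ψ (H (q.1, t)) 0) q.2 = 0) := by
  simp only [boundaryDefect, mem_ofPred_eq, ← hψ.mem_boundary_iff _ hq]
  refine and_congr_right fun hB ↦ imp_congr_right fun _ ↦ ?_
  rw [hψ.mem_tangentsTo_iff (ξ := velocityVector H q) hq hB, hψ.chartCoord_velocityVector hq hs,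
    velocity_coord (contMDiffAt_slice (hψ.contMDiffAt_comp hq hs))]

/-- A smooth family of arcs can be deformed so that the interiors of the arcs avoid `B` and the ends
are transverse to `B`. It suffices to push the arcs into `E`. In a half-space chart the `0`-th
coordinate is nonnegative, hence its velocity is nonnegative at the start and nonpositive at the end
of an arc; therefore the push cannot create a tangency. -/
theorem exists_transverse (hE : ∀ y ∈ E, ∃ ψ, HalfSpaceChart E B ψ ∧ y ∈ ψ.source)
    {H : C(I × I, M)} (hH : IsArcFamily E B H) (hsm : ContMDiff squareModel (𝓡 4) ∞ H)
    {C U : Set I} (hC : IsCompact C) (hU : IsOpen U)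
    (hCU : C ⊆ U) (hgood : ∀ q, q.1 ∉ C → q ∉ boundaryDefect B H) :
    ∃ H' : C(I × I, M), IsArcFamily E B H' ∧ DeformsOver E B U H H' ∧
      ContMDiff squareModel (𝓡 4) ∞ H' ∧ boundaryDefect B H' = ∅ := by
  obtain ⟨H', h1, h2, h3⟩ := exists_removing
    (Adm := fun H ↦ IsArcFamily E B H ∧ ContMDiff squareModel (𝓡 4) ∞ H)
    (R := DeformsOver E B U) (bad := fun H ↦ boundaryDefect B H) (fun _ h ↦ .refl h.1)
    (fun _ _ _ ↦ .trans) (hC.prod isCompact_univ) ⟨hH, hsm⟩ (fun b hb ↦ by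
      obtain ⟨ψ, hψ, hbψ⟩ := hE _ (hH.1 b)
      obtain ⟨χ, hχ, hχW, hχ1, hχI⟩ := exists_bump (q := b)
        (W := {q | H q ∈ ψ.source ∧ q.1 ∈ U}) (inter_mem
          (H.continuous.continuousAt (ψ.open_source.mem_nhds hbψ))
          (continuousAt_fst (hU.mem_nhds (hCU hb.1))))
      have hK := isClosed_tsupport χ
      refine ⟨{H | MapsTo H (tsupport χ) ψ.source},
        ContinuousMap.isOpen_setOfPred_mapsTo hK.isCompact ψ.open_source, fun q hq ↦ (hχW hq).1,
        {q | χ q = 1}, hχ1, ?_⟩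
      rintro H₁ hO ⟨hH₁, hs₁⟩ N hN
      obtain ⟨δ, hδ, hdef⟩ := hψ.exists_deformation hH₁ hK hO (fun q hq ↦ (hχW hq).2) hN
      have hχ0 : ∀ q ∉ tsupport χ, χ q = 0 := fun q hq ↦ image_eq_zero_of_notMem_tsupport hq
      -- the push `η χ(s,t) t (1 - t)` into the interior has nonzero derivative at the end points
      obtain ⟨η, hη, hηδ⟩ := exists_between hδ
      let d : I × I → ℝ := fun q ↦ η * χ q * (q.2 * (1 - q.2))
      have hval : ContMDiff squareModel 𝓘(ℝ, ℝ) ∞ fun q : I × I ↦ (q.2 : ℝ) :=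
        contMDiff_subtypeVal_Icc.comp contMDiff_snd
      have hd : ContMDiff squareModel 𝓘(ℝ, ℝ) ∞ d :=
        (contMDiff_const.mul hχ).mul (hval.mul (contMDiff_const.sub hval))
      let D : I × I → R4 := fun q ↦ d q • EuclideanSpace.single 0 1
      have hDs : ContMDiff squareModel (𝓡 4) ∞ D := hd.smul contMDiff_const
      have hd0 : ∀ q, 0 ≤ d q := fun q ↦ by
        have := (hχI q).1
        have := q.2.2.1
        have := sub_nonneg.2 q.2.2.2
        positivity
      have hD0 : ∀ q, D q 0 = d q := fun q ↦ by simp [D]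
      obtain ⟨H₂, hN₂, hA, hdf, hch, hoff⟩ := hdef ⟨D, hDs.continuous⟩
        (fun q hq ↦ by simp [D, d, hχ0 q hq])
        (fun q ↦ by
          have h1 := hχI q
          have h2 := q.2.2
          have h3 : (q.2 : ℝ) * (1 - q.2) ≤ 1 := by nlinarith [h2.1, h2.2]
          have h4 : 0 ≤ (q.2 : ℝ) * (1 - q.2) := mul_nonneg h2.1 (sub_nonneg.2 h2.2)
          have h5 : d q ≤ η * 1 * 1 := by
            simp only [d]
            gcongr
            exact h1.2
          simp only [ContinuousMap.coe_mk, D, norm_smul, Real.norm_of_nonneg (hd0 q)]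
          simp
          linarith)
        (fun q hq ↦ by
          have h0 := (hψ.mem_iff _ hq).1 (hH₁.1 q)
          simp only [ContinuousMap.coe_mk, hD0]
          linarith [hd0 q])
        (fun q hq hq2 ↦ by
          simp only [ContinuousMap.coe_mk, hD0, d]
          rcases hq2 with h | h <;> simp [h])
      have hs₂ : ContMDiff squareModel (𝓡 4) ∞ H₂ := hψ.contMDiff_of_add hK hO hDs hs₁ hch hoff
      refine ⟨H₂, hN₂, ⟨hA, hs₂⟩, hdf, fun q hq ↦ ?_⟩
      by_cases hqs : H₁ q ∈ ψ.source
      · obtain ⟨hqs', hadd⟩ := hch q hqs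
        rw [hψ.mem_boundaryDefect_iff hqs' (hs₂ q)] at hq
        rw [Set.mem_sdiff, hψ.mem_boundaryDefect_iff hqs (hs₁ q)]
        have h0 := (hψ.mem_iff _ hqs).1 (hH₁.1 q)
        have hsum : ψ (H₁ q) 0 + d q = 0 := by
          rw [← hq.1, hadd, ← hD0]; rfl
        have hz : ψ (H₁ q) 0 = 0 := by linarith [hd0 q]
        by_cases hend : q.2 = 0 ∨ q.2 = 1
        · have hev : ∀ᶠ t in 𝓝 q.2, H₁ (q.1, t) ∈ ψ.source :=
            (H₁.continuous.comp (Continuous.prodMk_right q.1)).continuousAt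
              (ψ.open_source.mem_nhds hqs)
          have hv1 := hψ.contMDiffAt_coord hqs (hs₁ q) 0
          have hv2 : velocity (fun t ↦ d (q.1, t)) q.2 = η * χ q * (1 - 2 * q.2) := by
            have hχs : ContMDiffAt (𝓡∂ 1) 𝓘(ℝ, ℝ) ∞ (fun t ↦ χ (q.1, t)) q.2 :=
              contMDiffAt_slice (hχ q)
            have h6 := (((hasDerivWithinAt_velocity hχs).const_mul η).mul
              ((hasDerivWithinAt_id (q.2 : ℝ) (Icc 0 1)).mul
                ((hasDerivWithinAt_id (q.2 : ℝ) (Icc 0 1)).const_sub 1)))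
            refine velocity_eq ((h6.congr (fun τ hτ ↦ ?_) ?_).congr_deriv ?_)
            · simp [d, pr, projIcc_of_mem zero_le_one hτ]
            · simp [d, pr]
            · have hq' : χ (q.1, q.2) = χ q := rfl
              rcases hend with h | h
              · rw [h] at hq'; simp [h, pr, hq']
              · rw [h] at hq'; simp [h, pr, hq']; ring
          have hv3 : velocity (fun t ↦ ψ (H₂ (q.1, t)) 0) q.2 =
              velocity (fun t ↦ ψ (H₁ (q.1, t)) 0) q.2 + η * χ q * (1 - 2 * q.2) := by
            rw [← hv2]
            have hds : ContMDiffAt (𝓡∂ 1) 𝓘(ℝ, ℝ) ∞ (fun t ↦ d (q.1, t)) q.2 :=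
              contMDiffAt_slice (hd q)
            refine (velocity_congr ?_).trans
              (velocity_eq (g := fun t ↦ ψ (H₁ (q.1, t)) 0 + d (q.1, t))
                ((hasDerivWithinAt_velocity hv1).add (hasDerivWithinAt_velocity hds)))
            filter_upwards [hev] with t ht
            rw [(hch _ ht).2]
            simp only [PiLp.add_apply]
            rw [← hD0]; rfl
          have hv4 := hq.2 hend
          rw [hv3] at hv4
          have hmin : ∀ᶠ t in 𝓝 q.2, ψ (H₁ (q.1, q.2)) 0 ≤ ψ (H₁ (q.1, t)) 0 := by
            filter_upwards [hev] with t ht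
            have h7 := (hψ.mem_iff _ ht).1 (hH₁.1 _)
            have h8 : ψ (H₁ (q.1, q.2)) 0 = 0 := hz
            rwa [h8]
          have hχq := (hχI q).1
          have : velocity (fun t ↦ ψ (H₁ (q.1, t)) 0) q.2 = 0 ∧ η * χ q = 0 := by
            obtain ⟨s, t⟩ := q
            simp only at hend hv1 hmin hv4 ⊢
            have h9 := mul_nonneg hη.le hχq
            rcases hend with rfl | rfl
            · have := velocity_nonneg hv1 hmin
              simp only [Icc.coe_zero] at hv4
              constructor <;> linarith
            · have := velocity_nonpos hv1 hmin
              simp only [Icc.coe_one] at hv4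
              constructor <;> linarith
          refine ⟨⟨hz, fun _ ↦ this.1⟩, fun h1 ↦ ?_⟩
          have h10 : χ q = 1 := h1
          rw [h10] at this
          linarith [this.2]
        · refine ⟨⟨hz, fun h ↦ (hend h).elim⟩, fun h1 ↦ ?_⟩
          have h10 : χ q = 1 := h1
          push Not at hend
          have h11 : 0 < (q.2 : ℝ) := unitInterval.pos_iff_ne_zero.2 hend.1
          have h12 : 0 < 1 - (q.2 : ℝ) := sub_pos.2 (unitInterval.lt_one_iff_ne_one.2 hend.2)
          have h13 : 0 < d q := by simp only [d, h10]; positivity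
          linarith
      · have hqK : q ∉ tsupport χ := fun h ↦ hqs (hO h)
        refine ⟨(boundaryDefect_congr ?_).1 hq, fun h1 ↦ ?_⟩
        · filter_upwards [hK.isOpen_compl.mem_nhds hqK] with x hx using hoff x hx
        · have h10 : χ q = 1 := h1
          simp [hχ0 q hqK] at h10)
  refine ⟨H', h1.1, h2, h1.2, eq_empty_of_forall_notMem fun q hq ↦ ?_⟩
  obtain ⟨h4, h5⟩ := h3 hq
  exact hgood q (fun h ↦ h5 ⟨h, mem_univ _⟩) h4

end

/-! ### Separating the end points -/

section

open Set Filter Module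

variable {M : Type*} [TopologicalSpace M]
  [ChartedSpace (EuclideanSpace ℝ (Fin 4)) M] {E B : Set M} {ψ : OpenPartialHomeomorph M R4}

/-- The two end points of each arc can be made distinct, by moving the initial points along `B` in a
generic direction: the coincidences depend on the one parameter `s`, while `B` has dimension `3`. -/
theorem exists_endpoints_ne (hE : ∀ y ∈ E, ∃ ψ, HalfSpaceChart E B ψ ∧ y ∈ ψ.source)
    {H : C(I × I, M)} (hH : IsArcFamily E B H) (hsm : ContMDiff squareModel (𝓡 4) ∞ H)
    (htr : boundaryDefect B H = ∅) {C U : Set I} (hC : IsCompact C) (hU : IsOpen U)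
    (hCU : C ⊆ U) (hgood : ∀ s ∉ C, H (s, 0) ≠ H (s, 1)) :
    ∃ H' : C(I × I, M), IsArcFamily E B H' ∧ DeformsOver E B U H H' ∧
      ContMDiff squareModel (𝓡 4) ∞ H' ∧ boundaryDefect B H' = ∅ ∧
      ∀ s, H' (s, 0) ≠ H' (s, 1) := by
  obtain ⟨H', h1, h2, h3⟩ := exists_removing
    (Adm := fun H ↦ IsArcFamily E B H ∧ ContMDiff squareModel (𝓡 4) ∞ H ∧ boundaryDefect B H = ∅)
    (R := DeformsOver E B U) (bad := fun H ↦ {s : I | H (s, 0) = H (s, 1)}) (fun _ h ↦ .refl h.1)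
    (fun _ _ _ ↦ .trans) hC ⟨hH, hsm, htr⟩ (fun s₀ hs₀ ↦ by
      obtain ⟨ψ, hψ, hbψ⟩ := hE _ (hH.1 (s₀, 0))
      obtain ⟨χ, hχ, hχW, hχ1, hχI⟩ := exists_bump (q := (s₀, 0))
        (W := {q | H q ∈ ψ.source ∧ q.1 ∈ U ∧ q.2 ≠ 1}) (inter_mem
          (H.continuous.continuousAt (ψ.open_source.mem_nhds hbψ))
          (inter_mem (continuousAt_fst (hU.mem_nhds (hCU hs₀)))
            (continuousAt_snd.eventually_ne zero_ne_one)))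
      have hK := isClosed_tsupport χ
      refine ⟨{H | MapsTo H (tsupport χ) ψ.source},
        ContinuousMap.isOpen_setOfPred_mapsTo hK.isCompact ψ.open_source, fun q hq ↦ (hχW hq).1,
        {s | χ (s, 0) = 1},
        (Continuous.prodMk_left (0 : I)).continuousAt.eventually hχ1, ?_⟩
      rintro H₁ hO ⟨hH₁, hs₁, ht₁⟩ N hN
      obtain ⟨δ, hδ, hdef⟩ := hψ.exists_deformation hH₁ hK hO (fun q hq ↦ (hχW hq).2.1) hN
      have hχ0 : ∀ q ∉ tsupport χ, χ q = 0 := fun q hq ↦ image_eq_zero_of_notMem_tsupport hq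
      -- Generic is `v = a - a 0 • e`, the tangential part of a generic `a : ℝ⁴`. It fails for the
      -- parameter `s` only if `χ (s, 0) • v` is the difference of the end points, and then
      -- `a = G (s, a 0)` lies in a set of dimension at most `2`.
      let e : R4 := EuclideanSpace.single 0 1
      let g : I → R4 := fun s ↦ (χ (s, 0))⁻¹ • (ψ (H₁ (s, 1)) - ψ (H₁ (s, 0)))
      let G : ℝ × ℝ → R4 := fun z ↦ z.2 • e + g (pr z.1)
      let S : Set (ℝ × ℝ) := {z | z.1 ∈ Icc (0 : ℝ) 1 ∧ χ (pr z.1, 0) ≠ 0 ∧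
        H₁ (pr z.1, 0) ∈ ψ.source ∧ H₁ (pr z.1, 1) ∈ ψ.source}
      have hline : ∀ t : I, ContMDiff (𝓡∂ 1) squareModel ∞ fun s : I ↦ (s, t) := fun t ↦
        contMDiff_id.prodMk contMDiff_const
      have hG : dimH (G '' S) < finrank ℝ R4 := by
        refine (dimH_image_le_finrank (C := Icc (0 : ℝ) 1 ×ˢ univ)
          ((convex_Icc 0 1).prod convex_univ) (fun z hz ↦ ⟨hz.1, mem_univ _⟩) ?_).trans_lt
          (by norm_num [finrank_prod])
        rintro ⟨x, r⟩ ⟨hx, hz1, hz2, hz3⟩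
        obtain ⟨s, rfl⟩ : ∃ s : I, (s : ℝ) = x := ⟨⟨x, hx⟩, rfl⟩
        simp only [pr, projIcc_val] at hz1 hz2 hz3
        have hg : ContMDiffAt (𝓡∂ 1) (𝓡 4) ∞ g s := by
          have k1 : ContMDiffAt (𝓡∂ 1) (𝓡 4) ∞ (fun s ↦ ψ (H₁ (s, 1))) s :=
            ContMDiffAt.comp (g := fun q ↦ ψ (H₁ q)) s (hψ.contMDiffAt_comp hz3 (hs₁ _))
              (hline 1 s)
          have k0 : ContMDiffAt (𝓡∂ 1) (𝓡 4) ∞ (fun s ↦ ψ (H₁ (s, 0))) s :=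
            ContMDiffAt.comp (g := fun q ↦ ψ (H₁ q)) s (hψ.contMDiffAt_comp hz2 (hs₁ _))
              (hline 0 s)
          exact (((hχ.comp (hline 0)) s).inv₀ hz1).smul (k1.sub k0)
        have hg' := contDiffWithinAt_comp_pr hg
        have hg2 : ContDiffWithinAt ℝ ∞ (fun z : ℝ × ℝ ↦ g (pr z.1)) (Icc (0 : ℝ) 1 ×ˢ univ)
            ((s : ℝ), r) :=
          ContDiffWithinAt.comp (g := fun x : ℝ ↦ g (pr x)) (f := Prod.fst) (t := Icc 0 1) ((s : ℝ), r) hg'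
            contDiffWithinAt_fst fun z hz ↦ hz.1
        exact ((contDiffWithinAt_snd.smul contDiffWithinAt_const).add hg2).of_le (by simp)
      obtain ⟨a, haδ, haG⟩ := exists_norm_lt_notMem hG (half_pos hδ)
      let v : R4 := a - a 0 • e
      have hv0 : v 0 = 0 := by simp [v, e]
      have hvn : ‖v‖ < δ := by
        have k1 : ‖a 0 • e‖ ≤ ‖a‖ := by
          simpa [norm_smul, e] using PiLp.norm_apply_le a 0
        have := norm_sub_le a (a 0 • e)
        simp only [v]; linarith
      let D : I × I → R4 := fun q ↦ χ q • v
      have hDs : ContMDiff squareModel (𝓡 4) ∞ D := hχ.smul contMDiff_const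
      have hD0 : ∀ q, D q 0 = 0 := fun q ↦ by simp [D, hv0]
      obtain ⟨H₂, hN₂, hA, hdf, hch, hoff⟩ := hdef ⟨D, hDs.continuous⟩
        (fun q hq ↦ by simp [D, hχ0 q hq])
        (fun q ↦ by
          have h1 := hχI q
          simp only [ContinuousMap.coe_mk, D, norm_smul, Real.norm_of_nonneg h1.1]
          nlinarith [norm_nonneg v])
        (fun q hq ↦ by
          have h0 := (hψ.mem_iff _ hq).1 (hH₁.1 q)
          simpa only [ContinuousMap.coe_mk, hD0, add_zero] using h0)
        (fun q hq hq2 ↦ hD0 q)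
      have hs₂ : ContMDiff squareModel (𝓡 4) ∞ H₂ := hψ.contMDiff_of_add hK hO hDs hs₁ hch hoff
      have hcoord : ∀ q, H₁ q ∈ ψ.source → ψ (H₂ q) 0 = ψ (H₁ q) 0 := fun q hq ↦ by
        rw [(hch q hq).2]
        simp [hD0]
      have ht₂ : boundaryDefect B H₂ = ∅ := by
        refine eq_empty_of_forall_notMem fun q hq ↦ ?_
        refine (ht₁ ▸ notMem_empty q : q ∉ boundaryDefect B H₁) ?_
        by_cases hqs : H₁ q ∈ ψ.source
        · rw [hψ.mem_boundaryDefect_iff (hch q hqs).1 (hs₂ q)] at hq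
          rw [hψ.mem_boundaryDefect_iff hqs (hs₁ q), ← hcoord q hqs]
          refine ⟨hq.1, fun h ↦ (velocity_congr ?_).trans (hq.2 h)⟩
          have hev : ∀ᶠ t in 𝓝 q.2, H₁ (q.1, t) ∈ ψ.source :=
            (H₁.continuous.comp (Continuous.prodMk_right q.1)).continuousAt
              (ψ.open_source.mem_nhds hqs)
          exact hev.mono fun t ht ↦ (hcoord _ ht).symm
        · have hqK : q ∉ tsupport χ := fun h ↦ hqs (hO h)
          refine (boundaryDefect_congr ?_).1 hq
          filter_upwards [hK.isOpen_compl.mem_nhds hqK] with x hx using hoff x hx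
      refine ⟨H₂, hN₂, ⟨hA, hs₂, ht₂⟩, hdf, fun s hs ↦ ?_⟩
      have hs' : H₂ (s, 0) = H₂ (s, 1) := hs
      rw [hoff (s, 1) fun h ↦ (hχW h).2.2 rfl] at hs'
      by_cases hχs : χ (s, 0) = 0
      · refine ⟨?_, fun h ↦ ?_⟩
        · refine Eq.trans ?_ hs'
          by_cases hss : H₁ (s, 0) ∈ ψ.source
          · obtain ⟨k1, k2⟩ := hch _ hss
            exact ψ.injOn hss k1 (by rw [k2]; simp [D, hχs])
          · exact (hoff _ fun h ↦ hss (hO h)).symm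
        · have : χ (s, 0) = 1 := h
          rw [hχs] at this
          exact zero_ne_one this
      · exfalso
        have hsK : (s, (0 : I)) ∈ tsupport χ := subset_tsupport _ hχs
        obtain ⟨k1, k2⟩ := hch _ (hO hsK)
        refine haG ⟨((s : ℝ), a 0), ⟨s.2, ?_, ?_, ?_⟩, ?_⟩
        · simpa [pr] using hχs
        · simpa [pr] using hO hsK
        · rw [hs'] at k1
          simpa [pr] using k1
        · rw [hs'] at k2
          have k3 : ψ (H₁ (s, 1)) - ψ (H₁ (s, 0)) = χ (s, 0) • v := by
            rw [k2]; simp [D]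
          simp only [G, g, pr, projIcc_val, k3, smul_smul, inv_mul_cancel₀ hχs, one_smul, v]
          abel)
  exact ⟨H', h1.1, h2, h1.2.1, h1.2.2, fun s hs ↦ hgood s (fun hsC ↦ (h3 hs).2 hsC) (h3 hs).1⟩

end

/-! ### Dimension estimates for double points -/

section

open Set Filter Module

section Calculus

variable {F : Type*} [NormedAddCommGroup F] [NormedSpace ℝ F]

/-- The square `[0,1] × [0,1]` as a subset of `ℝ × ℝ`. -/
abbrev unitSquare : Set (ℝ × ℝ) := Icc 0 1 ×ˢ Icc 0 1

theorem contDiffWithinAt_comp_pr_pr {f : I × I → F} {q : I × I}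
    (h : ContMDiffAt squareModel 𝓘(ℝ, F) ∞ f q) :
    ContDiffWithinAt ℝ ∞ (fun z : ℝ × ℝ ↦ f (pr z.1, pr z.2)) unitSquare (q.1, q.2) := by
  refine contMDiffWithinAt_iff_contDiffWithinAt.1 ?_
  have h1 : ContMDiffWithinAt 𝓘(ℝ, ℝ × ℝ) (𝓡∂ 1) ∞ (fun z : ℝ × ℝ ↦ pr z.1) unitSquare
      ((q.1 : ℝ), (q.2 : ℝ)) :=
    ContMDiffWithinAt.comp (I' := 𝓘(ℝ, ℝ)) (g := pr) (f := Prod.fst) (t := Icc 0 1) _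
      (contMDiffOn_projIcc _ q.1.2) (contDiff_fst.contMDiff _).contMDiffWithinAt fun z hz ↦ hz.1
  have h2 : ContMDiffWithinAt 𝓘(ℝ, ℝ × ℝ) (𝓡∂ 1) ∞ (fun z : ℝ × ℝ ↦ pr z.2) unitSquare
      ((q.1 : ℝ), (q.2 : ℝ)) :=
    ContMDiffWithinAt.comp (I' := 𝓘(ℝ, ℝ)) (g := pr) (f := Prod.snd) (t := Icc 0 1) _
      (contMDiffOn_projIcc _ q.2.2) (contDiff_snd.contMDiff _).contMDiffWithinAt fun z hz ↦ hz.2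
  have h3 : ContMDiffAt squareModel 𝓘(ℝ, F) ∞ f (pr q.1, pr q.2) := by
    simpa [pr] using h
  exact ContMDiffAt.comp_contMDiffWithinAt (g := f) (f := fun z : ℝ × ℝ ↦ (pr z.1, pr z.2))
    ((q.1 : ℝ), (q.2 : ℝ)) h3 (h1.prodMk h2)

theorem uniqueDiffOn_unitSquare : UniqueDiffOn ℝ unitSquare :=
  (uniqueDiffOn_Icc zero_lt_one).prod (uniqueDiffOn_Icc zero_lt_one)

theorem contDiffWithinAt_velocity {f : I × I → F} {q : I × I}
    (h : ∀ᶠ z in 𝓝 q, ContMDiffAt squareModel 𝓘(ℝ, F) ∞ f z) :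
    ContDiffWithinAt ℝ 1 (fun z : ℝ × ℝ ↦ velocity (fun t ↦ f (pr z.1, t)) (pr z.2))
      unitSquare (q.1, q.2) := by
  let G : ℝ × ℝ → F := fun z ↦ f (pr z.1, pr z.2)
  have hq : ((q.1 : ℝ), (q.2 : ℝ)) ∈ unitSquare := ⟨q.1.2, q.2.2⟩
  have h1 : ContDiffWithinAt ℝ 1 (fun z ↦ fderivWithin ℝ G unitSquare z (0, 1))
      unitSquare (q.1, q.2) :=
    ((contDiffWithinAt_comp_pr_pr h.self_of_nhds).fderivWithin_right uniqueDiffOn_unitSquare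
      (by norm_cast) hq).clm_apply contDiffWithinAt_const
  have hpr : Tendsto (fun z : ℝ × ℝ ↦ (pr z.1, pr z.2)) (𝓝[unitSquare] (q.1, q.2)) (𝓝 q) := by
    have h2 : ContinuousAt (fun z : ℝ × ℝ ↦ (pr z.1, pr z.2)) (q.1, q.2) := by fun_prop
    have h3 := h2.tendsto
    simp only [pr, projIcc_val] at h3
    exact h3.mono_left nhdsWithin_le_nhds
  have key : ∀ z ∈ unitSquare, ContMDiffAt squareModel 𝓘(ℝ, F) ∞ f (pr z.1, pr z.2) →
      velocity (fun t ↦ f (pr z.1, t)) (pr z.2) = fderivWithin ℝ G unitSquare z (0, 1) := by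
    rintro ⟨x, y⟩ ⟨hx, hy⟩ hz
    obtain ⟨s, rfl⟩ : ∃ s : I, (s : ℝ) = x := ⟨⟨x, hx⟩, rfl⟩
    obtain ⟨t, rfl⟩ : ∃ t : I, (t : ℝ) = y := ⟨⟨y, hy⟩, rfl⟩
    simp only [pr, projIcc_val] at hz ⊢
    have h4 := ((contDiffWithinAt_comp_pr_pr hz).differentiableWithinAt (by simp)).hasFDerivWithinAt
    have h5 : HasDerivWithinAt (fun y : ℝ ↦ ((s : ℝ), y)) ((0 : ℝ), (1 : ℝ)) (Icc 0 1) t :=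
      (hasDerivWithinAt_const _ _ _).prodMk (hasDerivWithinAt_id _ _)
    have h6 := HasFDerivWithinAt.comp_hasDerivWithinAt (t := unitSquare) (t : ℝ) h4 h5
      (fun y hy ↦ ⟨s.2, hy⟩)
    refine velocity_eq ?_
    simpa [Function.comp_def, pr] using h6
  refine h1.congr_of_eventuallyEq ?_ (key _ hq (by simpa [pr] using h.self_of_nhds))
  filter_upwards [hpr.eventually h, self_mem_nhdsWithin] with z hz hz' using key z hz' hz

theorem eventually_velocity_ne {f : I × I → F} {q : I × I}
    (h : ∀ᶠ z in 𝓝 q, ContMDiffAt squareModel 𝓘(ℝ, F) ∞ f z)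
    (hne : velocity (fun t ↦ f (q.1, t)) q.2 ≠ 0) :
    ∀ᶠ z in 𝓝 q, velocity (fun t ↦ f (z.1, t)) z.2 ≠ 0 := by
  have h1 := (contDiffWithinAt_velocity h).continuousWithinAt
  have h2 : Tendsto (fun z : I × I ↦ ((z.1 : ℝ), (z.2 : ℝ))) (𝓝 q)
      (𝓝[unitSquare] ((q.1 : ℝ), (q.2 : ℝ))) := by
    refine tendsto_nhdsWithin_iff.2 ⟨?_, Eventually.of_forall fun z ↦ ⟨z.1.2, z.2.2⟩⟩
    exact Continuous.tendsto (by fun_prop) q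
  have h3 := h1.tendsto.comp h2
  simp only [Function.comp_def, pr, projIcc_val] at h3
  exact h3.eventually_ne hne

/-- Rolle's theorem. -/
theorem exists_velocity_eq_zero {g : I → ℝ} {t₁ t₂ : I} (hlt : t₁ < t₂)
    (hg : ContinuousOn g (Icc t₁ t₂)) (heq : g t₁ = g t₂) :
    ∃ t ∈ Ioo t₁ t₂, velocity g t = 0 := by
  obtain ⟨y, hy, hy'⟩ := exists_deriv_eq_zero (f := fun τ : ℝ ↦ g (pr τ)) (a := t₁) (b := t₂) hlt
    (hg.comp continuous_projIcc.continuousOn fun τ hτ ↦ ⟨by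
      simpa using monotone_projIcc (zero_le_one' ℝ) hτ.1, by
      simpa using monotone_projIcc (zero_le_one' ℝ) hτ.2⟩) (by simpa [pr] using heq)
  have hyI : y ∈ Ioo (0 : ℝ) 1 := ⟨t₁.2.1.trans_lt hy.1, hy.2.trans_le t₂.2.2⟩
  refine ⟨⟨y, Ioo_subset_Icc_self hyI⟩, ⟨hy.1, hy.2⟩, ?_⟩
  exact (derivWithin_of_mem_nhds (Icc_mem_nhds hyI.1 hyI.2)).trans hy'

/-- If `F`, `α`, `β`, `w` depend on at most three real parameters, then the pairs `(a, b)` that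
solve one of the nondegenerate linear equations `α a + β b = w` form a set of dimension less than
`8`: for each parameter, one of `a` and `b` is determined by the other. -/
theorem dimH_solutions_lt {Z : Type*} [NormedAddCommGroup Z] [NormedSpace ℝ Z]
    [FiniteDimensional ℝ Z] (hZ : finrank ℝ Z ≤ 3) {S : Set Z} {α β : Z → ℝ} {w : Z → R4}
    (hα : ∀ z ∈ S, ContDiffAt ℝ 1 α z) (hβ : ∀ z ∈ S, ContDiffAt ℝ 1 β z)
    (hw : ∀ z ∈ S, ContDiffAt ℝ 1 w z) :
    dimH {v : R4 × R4 | ∃ z ∈ S, (α z ≠ 0 ∨ β z ≠ 0) ∧ α z • v.1 + β z • v.2 = w z} <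
      finrank ℝ (R4 × R4) := by
  let f₁ : Z × R4 → R4 × R4 := fun z ↦ ((α z.1)⁻¹ • (w z.1 - β z.1 • z.2), z.2)
  let f₂ : Z × R4 → R4 × R4 := fun z ↦ (z.2, (β z.1)⁻¹ • (w z.1 - α z.1 • z.2))
  let S₁ : Set (Z × R4) := {z | z.1 ∈ S ∧ α z.1 ≠ 0}
  let S₂ : Set (Z × R4) := {z | z.1 ∈ S ∧ β z.1 ≠ 0}
  have hsub : {v : R4 × R4 | ∃ z ∈ S, (α z ≠ 0 ∨ β z ≠ 0) ∧ α z • v.1 + β z • v.2 = w z} ⊆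
      f₁ '' S₁ ∪ f₂ '' S₂ := by
    rintro ⟨a, b⟩ ⟨z, hz, h | h, he⟩
    · refine Or.inl ⟨(z, b), ⟨hz, h⟩, ?_⟩
      simp only [f₁, Prod.mk.injEq, and_true]
      rw [← he, add_sub_cancel_right, smul_smul, inv_mul_cancel₀ h, one_smul]
    · refine Or.inr ⟨(z, a), ⟨hz, h⟩, ?_⟩
      simp only [f₂, Prod.mk.injEq, true_and]
      rw [← he, add_sub_cancel_left, smul_smul, inv_mul_cancel₀ h, one_smul]
  have hdim : (finrank ℝ (Z × R4) : ENNReal) < finrank ℝ (R4 × R4) := by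
    simp only [finrank_prod, finrank_euclideanSpace, Fintype.card_fin]
    norm_cast
    omega
  have hc : ∀ z : Z × R4, z.1 ∈ S → ContDiffAt ℝ 1 (fun z : Z × R4 ↦ α z.1) z ∧
      ContDiffAt ℝ 1 (fun z : Z × R4 ↦ β z.1) z ∧ ContDiffAt ℝ 1 (fun z : Z × R4 ↦ w z.1) z :=
    fun z hz ↦ ⟨(hα _ hz).comp z contDiffAt_fst, (hβ _ hz).comp z contDiffAt_fst,
      (hw _ hz).comp z contDiffAt_fst⟩
  refine (dimH_mono hsub).trans_lt ?_
  rw [dimH_union]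
  refine max_lt (lt_of_le_of_lt ?_ hdim) (lt_of_le_of_lt ?_ hdim)
  · refine dimH_image_le_finrank convex_univ (subset_univ _) fun z hz ↦ ContDiffAt.contDiffWithinAt ?_
    obtain ⟨h1, h2, h3⟩ := hc z hz.1
    exact ((h1.inv hz.2).smul (h3.sub (h2.smul contDiffAt_snd))).prodMk contDiffAt_snd
  · refine dimH_image_le_finrank convex_univ (subset_univ _) fun z hz ↦ ContDiffAt.contDiffWithinAt ?_
    obtain ⟨h1, h2, h3⟩ := hc z hz.1
    exact contDiffAt_snd.prodMk ((h2.inv hz.2).smul (h3.sub (h1.smul contDiffAt_snd)))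

end Calculus

end

/-! ### Local embeddedness -/

section

open Set Filter Module

variable {M : Type*} [TopologicalSpace M]
  [ChartedSpace (EuclideanSpace ℝ (Fin 4)) M] {E B : Set M} {ψ : OpenPartialHomeomorph M R4}

/-- The triples `(s, t, t')` where the arc `H (s, ·)` fails to be an injective immersion: a double
point if `t ≠ t'`, a critical point if `t = t'`. -/
def embeddingDefect (H : I × I → M) : Set (I × I × I) :=
  {p | H (p.1, p.2.1) = H (p.1, p.2.2) ∧
    (p.2.1 = p.2.2 → mfderiv (𝓡∂ 1) (𝓡 4) (fun t ↦ H (p.1, t)) p.2.1 1 = 0)}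

theorem HalfSpaceChart.mem_embeddingDefect_iff (hψ : HalfSpaceChart E B ψ) {H : I × I → M}
    {s t : I} (hq : H (s, t) ∈ ψ.source)
    (hs : ContMDiffAt squareModel (𝓡 4) ∞ H (s, t)) :
    (s, t, t) ∈ embeddingDefect H ↔ velocity (fun t ↦ ψ (H (s, t))) t = 0 := by
  rw [hψ.velocity_eq_zero_iff (c := fun t ↦ H (s, t)) hq
    (contMDiffAt_slice (q := (s, t)) hs)]
  simp [embeddingDefect]

/-- Where the `0`-th coordinate of an arc has nonzero velocity, this arc and the nearby ones are
locally embedded, because the `0`-th coordinate is locally injective by Rolle's theorem. -/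
theorem HalfSpaceChart.eventually_notMem_embeddingDefect (hψ : HalfSpaceChart E B ψ)
    {H : C(I × I, M)} (hsm : ContMDiff squareModel (𝓡 4) ∞ H) {s₀ t₀ : I}
    (hq : H (s₀, t₀) ∈ ψ.source) (hv : velocity (fun t ↦ ψ (H (s₀, t)) 0) t₀ ≠ 0) :
    ∀ᶠ p in 𝓝 (s₀, t₀, t₀), p ∉ embeddingDefect H := by
  have hev : ∀ᶠ q in 𝓝 (s₀, t₀), H q ∈ ψ.source :=
    H.continuous.continuousAt (ψ.open_source.mem_nhds hq)
  have hsm' : ∀ᶠ q in 𝓝 (s₀, t₀), ContMDiffAt squareModel 𝓘(ℝ, ℝ) ∞ (fun q ↦ ψ (H q) 0) q :=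
    hev.mono fun q h ↦ ((EuclideanSpace.proj 0 : R4 →L[ℝ] ℝ).contMDiff.contMDiffAt).comp q
      (hψ.contMDiffAt_comp h (hsm q))
  obtain ⟨W₁, hW₁, W₂, hW₂, hW⟩ := mem_nhds_prod_iff.1
    (hev.and (eventually_velocity_ne hsm' hv))
  obtain ⟨b, c, -, hJ, hJW⟩ := exists_Icc_mem_subset_of_mem_nhds hW₂
  set J := Icc b c
  have hJo : OrdConnected J := ordConnected_Icc
  have hlt : ∀ s ∈ W₁, ∀ t ∈ J, ∀ t' ∈ J, t < t' → H (s, t) ≠ H (s, t') := by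
    intro s hs t ht t' ht' htt he
    have hsub : Icc t t' ⊆ W₂ := (hJo.out ht ht').trans hJW
    have hc : ContinuousOn (fun t ↦ ψ (H (s, t)) 0) (Icc t t') := fun τ hτ ↦
      (hψ.contMDiffAt_coord (q := (s, τ)) (hW ⟨hs, hsub hτ⟩).1 (hsm _) 0).continuousAt.continuousWithinAt
    obtain ⟨τ, hτ, hτ0⟩ := exists_velocity_eq_zero htt hc (by simp only [he])
    exact (hW (a := (s, τ)) ⟨hs, hsub (Ioo_subset_Icc_self hτ)⟩).2 hτ0
  filter_upwards [prod_mem_nhds hW₁ (prod_mem_nhds hJ hJ)]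
  rintro ⟨s, t, t'⟩ ⟨hs, ht, ht'⟩ hd
  rcases lt_trichotomy t t' with h | rfl | h
  · exact hlt s hs t ht t' ht' h hd.1
  · obtain ⟨h1, h2⟩ := hW (a := (s, t)) ⟨hs, hJW ht⟩
    rw [hψ.mem_embeddingDefect_iff h1 (hsm _)] at hd
    have h3 := velocity_coord (contMDiffAt_slice (hψ.contMDiffAt_comp h1 (hsm _))) 0
    refine h2 (h3.trans ?_)
    rw [hd]; rfl
  · exact hlt s hs t' ht' t ht h hd.1.symm

theorem IsArcFamily.mem_boundary_iff {H : C(I × I, M)} (hH : IsArcFamily E B H)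
    (htr : boundaryDefect B H = ∅) {q : I × I} : H q ∈ B ↔ q.2 = 0 ∨ q.2 = 1 := by
  refine ⟨fun h ↦ by_contra fun hq ↦ ?_, hH.2 q⟩
  exact (htr ▸ notMem_empty q : q ∉ boundaryDefect B H) ⟨h, fun h' ↦ (hq h').elim⟩

/-- If the arcs are transverse to `B` and have distinct end points, then parameters near `0` and `1`
are not involved in any defect. Thus defects need only be removed in the interior of the square. -/
theorem eventually_forall_notMem_embeddingDefect [T2Space M]
    (hE : ∀ y ∈ E, ∃ ψ, HalfSpaceChart E B ψ ∧ y ∈ ψ.source)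
    {H : C(I × I, M)} (hH : IsArcFamily E B H) (hsm : ContMDiff squareModel (𝓡 4) ∞ H)
    (htr : boundaryDefect B H = ∅) (hne : ∀ s, H (s, 0) ≠ H (s, 1)) {τ : I} (hτ : τ = 0 ∨ τ = 1) :
    ∀ᶠ t in 𝓝 τ, ∀ z ∈ (univ : Set (I × I)), (z.1, t, z.2) ∉ embeddingDefect H := by
  refine isCompact_univ.eventually_forall_of_forall_eventually fun z _ ↦ ?_
  obtain ⟨s, t'⟩ := z
  have hcont : Tendsto (fun p : I × I × I ↦ (p.2.1, p.1, p.2.2)) (𝓝 (τ, s, t')) (𝓝 (s, τ, t')) :=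
    Continuous.tendsto (by fun_prop) _
  by_cases he : H (s, τ) = H (s, t')
  · have ht' : t' = τ := by
      have h1 : H (s, t') ∈ B := he ▸ hH.2 (s, τ) hτ
      have h2 : t' = 0 ∨ t' = 1 := (hH.mem_boundary_iff htr).1 h1
      rcases hτ with rfl | rfl <;> rcases h2 with rfl | rfl
      · rfl
      · exact (hne s he).elim
      · exact (hne s he.symm).elim
      · rfl
    subst ht'
    obtain ⟨ψ, hψ, hq⟩ := hE _ (hH.1 (s, t'))
    have hv : velocity (fun t ↦ ψ (H (s, t)) 0) t' ≠ 0 := by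
      intro hv
      refine (htr ▸ notMem_empty _ : (s, t') ∉ boundaryDefect B H) ?_
      rw [hψ.mem_boundaryDefect_iff hq (hsm _)]
      exact ⟨(hψ.mem_boundary_iff _ hq).1 (hH.2 _ hτ), fun _ ↦ hv⟩
    exact hcont.eventually (hψ.eventually_notMem_embeddingDefect hsm hq hv)
  · have h1 : Tendsto (fun p : I × I × I ↦ H (p.1, p.2.1)) (𝓝 (s, τ, t')) (𝓝 (H (s, τ))) :=
      Continuous.tendsto (by fun_prop) _
    have h2 : Tendsto (fun p : I × I × I ↦ H (p.1, p.2.2)) (𝓝 (s, τ, t')) (𝓝 (H (s, t'))) :=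
      Continuous.tendsto (by fun_prop) _
    obtain ⟨u, v, hu, hv, huv⟩ := t2_separation_nhds he
    refine hcont.eventually (p := fun p ↦ p ∉ embeddingDefect H) ?_
    filter_upwards [h1 hu, h2 hv] with p hp1 hp2 hd
    refine disjoint_left.1 huv hp1 ?_
    have h3 : H (p.1, p.2.2) ∈ v := hp2
    rwa [← hd.1] at h3

end

/-! ### Generic perturbations -/

section

open Set Filter Module

variable {M : Type*} [TopologicalSpace M]
  [ChartedSpace (EuclideanSpace ℝ (Fin 4)) M] {E B : Set M} {ψ : OpenPartialHomeomorph M R4}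

theorem unitSquare_mem_nhds {q : I × I} (h1 : q.1 ≠ 0 ∧ q.1 ≠ 1) (h2 : q.2 ≠ 0 ∧ q.2 ≠ 1) :
    unitSquare ∈ 𝓝 ((q.1 : ℝ), (q.2 : ℝ)) :=
  prod_mem_nhds
    (Icc_mem_nhds (unitInterval.pos_iff_ne_zero.2 h1.1) (unitInterval.lt_one_iff_ne_one.2 h1.2))
    (Icc_mem_nhds (unitInterval.pos_iff_ne_zero.2 h2.1) (unitInterval.lt_one_iff_ne_one.2 h2.2))

/-- General position in one chart: for suitable arbitrarily small `a` and `b`, adding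
`χ (s, t) (a + t b)` to `H` in the chart `ψ` removes all double points and critical points that
involve a parameter with `χ (s, t) ≠ 0`. The linear dependence on `t` makes the displacements at two
different parameters `t ≠ t'` of the same arc independent, even where `χ` takes the same value. -/
theorem HalfSpaceChart.exists_generic (hψ : HalfSpaceChart E B ψ) {H : C(I × I, M)}
    (hsm : ContMDiff squareModel (𝓡 4) ∞ H) {χ : I × I → ℝ} (hχ : ContMDiff squareModel 𝓘(ℝ, ℝ) ∞ χ)
    (hχK : ∀ q ∈ tsupport χ, H q ∈ ψ.source ∧ (q.1 ≠ 0 ∧ q.1 ≠ 1) ∧ (q.2 ≠ 0 ∧ q.2 ≠ 1))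
    {δ : ℝ} (hδ : 0 < δ) : ∃ a b : R4, ‖a‖ < δ ∧ ‖b‖ < δ ∧ ∀ H' : C(I × I, M),
      IsArcFamily E B H' → ContMDiff squareModel (𝓡 4) ∞ H' → boundaryDefect B H' = ∅ →
      (∀ q, H q ∈ ψ.source →
        H' q ∈ ψ.source ∧ ψ (H' q) = ψ (H q) + χ q • (a + (q.2 : ℝ) • b)) →
      (∀ q ∉ tsupport χ, H' q = H q) →
      embeddingDefect H' ⊆ embeddingDefect H \ {p | χ (p.1, p.2.1) ≠ 0} := by
  have hχ0 : ∀ q ∉ tsupport χ, χ q = 0 := fun q hq ↦ image_eq_zero_of_notMem_tsupport hq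
  have hχt : ∀ q, χ q ≠ 0 → q ∈ tsupport χ := fun q hq ↦ subset_tsupport _ hq
  let F : ℝ × ℝ → R4 := fun z ↦ ψ (H (pr z.1, pr z.2))
  let X : ℝ × ℝ → ℝ := fun z ↦ χ (pr z.1, pr z.2)
  have hX : ∀ q : I × I, (q.1 ≠ 0 ∧ q.1 ≠ 1) → (q.2 ≠ 0 ∧ q.2 ≠ 1) →
      ContDiffAt ℝ 1 X (q.1, q.2) := fun q h1 h2 ↦
    ((contDiffWithinAt_comp_pr_pr (hχ q)).contDiffAt (unitSquare_mem_nhds h1 h2)).of_le (by simp)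
  have hF : ∀ q : I × I, (q.1 ≠ 0 ∧ q.1 ≠ 1) → (q.2 ≠ 0 ∧ q.2 ≠ 1) → H q ∈ ψ.source →
      ContDiffAt ℝ 1 F (q.1, q.2) := fun q h1 h2 hq ↦
    ((contDiffWithinAt_comp_pr_pr (hψ.contMDiffAt_comp hq (hsm q))).contDiffAt
      (unitSquare_mem_nhds h1 h2)).of_le (by simp)
  -- the exceptional displacements for double points
  let S₁ : Set (ℝ × ℝ × ℝ) := {z | ∃ s t t' : I, z = ((s : ℝ), (t : ℝ), (t' : ℝ)) ∧
    (s ≠ 0 ∧ s ≠ 1) ∧ (t ≠ 0 ∧ t ≠ 1) ∧ (t' ≠ 0 ∧ t' ≠ 1) ∧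
    H (s, t) ∈ ψ.source ∧ H (s, t') ∈ ψ.source}
  let α₁ : ℝ × ℝ × ℝ → ℝ := fun z ↦ X (z.1, z.2.1) - X (z.1, z.2.2)
  let β₁ : ℝ × ℝ × ℝ → ℝ := fun z ↦ X (z.1, z.2.1) * z.2.1 - X (z.1, z.2.2) * z.2.2
  let w₁ : ℝ × ℝ × ℝ → R4 := fun z ↦ F (z.1, z.2.2) - F (z.1, z.2.1)
  have hA₁ := dimH_solutions_lt (Z := ℝ × ℝ × ℝ) (by simp) (S := S₁) (α := α₁) (β := β₁) (w := w₁)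
    (by
      rintro _ ⟨s, t, t', rfl, hs, ht, ht', hq, hq'⟩
      exact ((hX (s, t) hs ht).comp (g := X) (f := fun z : ℝ × ℝ × ℝ ↦ (z.1, z.2.1))
          ((s : ℝ), (t : ℝ), (t' : ℝ)) (by fun_prop)).sub
        ((hX (s, t') hs ht').comp (g := X) (f := fun z : ℝ × ℝ × ℝ ↦ (z.1, z.2.2))
          ((s : ℝ), (t : ℝ), (t' : ℝ)) (by fun_prop)))
    (by
      rintro _ ⟨s, t, t', rfl, hs, ht, ht', hq, hq'⟩
      exact (((hX (s, t) hs ht).comp (g := X) (f := fun z : ℝ × ℝ × ℝ ↦ (z.1, z.2.1))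
          ((s : ℝ), (t : ℝ), (t' : ℝ)) (by fun_prop)).mul (by fun_prop)).sub
        (((hX (s, t') hs ht').comp (g := X) (f := fun z : ℝ × ℝ × ℝ ↦ (z.1, z.2.2))
          ((s : ℝ), (t : ℝ), (t' : ℝ)) (by fun_prop)).mul (by fun_prop)))
    (by
      rintro _ ⟨s, t, t', rfl, hs, ht, ht', hq, hq'⟩
      exact ((hF (s, t') hs ht' hq').comp (g := F) (f := fun z : ℝ × ℝ × ℝ ↦ (z.1, z.2.2))
          ((s : ℝ), (t : ℝ), (t' : ℝ)) (by fun_prop)).sub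
        ((hF (s, t) hs ht hq).comp (g := F) (f := fun z : ℝ × ℝ × ℝ ↦ (z.1, z.2.1))
          ((s : ℝ), (t : ℝ), (t' : ℝ)) (by fun_prop)))
  -- the exceptional displacements for critical points
  let S₂ : Set (ℝ × ℝ) := {z | ∃ q : I × I, z = ((q.1 : ℝ), (q.2 : ℝ)) ∧
    (q.1 ≠ 0 ∧ q.1 ≠ 1) ∧ (q.2 ≠ 0 ∧ q.2 ≠ 1) ∧ H q ∈ ψ.source}
  let X' : ℝ × ℝ → ℝ := fun z ↦ velocity (fun t ↦ χ (pr z.1, t)) (pr z.2)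
  let F' : ℝ × ℝ → R4 := fun z ↦ velocity (fun t ↦ ψ (H (pr z.1, t))) (pr z.2)
  have hX' : ∀ q : I × I, (q.1 ≠ 0 ∧ q.1 ≠ 1) → (q.2 ≠ 0 ∧ q.2 ≠ 1) →
      ContDiffAt ℝ 1 X' (q.1, q.2) := fun q h1 h2 ↦
    (contDiffWithinAt_velocity (Eventually.of_forall hχ)).contDiffAt (unitSquare_mem_nhds h1 h2)
  have hA₂ := dimH_solutions_lt (Z := ℝ × ℝ) (by simp) (S := S₂) (α := X')
    (β := fun z ↦ X' z * z.2 + X z) (w := fun z ↦ - F' z)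
    (by rintro _ ⟨q, rfl, h1, h2, hq⟩; exact hX' q h1 h2)
    (by
      rintro _ ⟨q, rfl, h1, h2, hq⟩
      exact ((hX' q h1 h2).mul contDiffAt_snd).add (hX q h1 h2))
    (by
      rintro _ ⟨q, rfl, h1, h2, hq⟩
      have hev : ∀ᶠ x in 𝓝 q, H x ∈ ψ.source :=
        H.continuous.continuousAt (ψ.open_source.mem_nhds hq)
      exact ((contDiffWithinAt_velocity (f := fun x ↦ ψ (H x))
        (hev.mono fun x hx ↦ hψ.contMDiffAt_comp hx (hsm x))).contDiffAt
          (unitSquare_mem_nhds h1 h2)).neg)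
  have hA := max_lt hA₁ hA₂
  rw [← dimH_union] at hA
  obtain ⟨v, hvδ, hv⟩ := exists_norm_lt_notMem hA hδ
  rw [mem_union, not_or] at hv
  refine ⟨v.1, v.2, (norm_fst_le v).trans_lt hvδ, (norm_snd_le v).trans_lt hvδ, ?_⟩
  intro H' hH' hsm' htr' hch hoff
  -- points that the deformation does not move
  have hfix : ∀ q, χ q = 0 → H' q = H q := by
    intro q hq
    by_cases hqs : H q ∈ ψ.source
    · obtain ⟨k1, k2⟩ := hch q hqs
      exact ψ.injOn k1 hqs (by rw [k2, hq]; simp)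
    · exact hoff q fun h ↦ hqs (hχK q h).1
  have hnd : ∀ s t t' : I, χ (s, t) ≠ 0 → t ≠ t' → H' (s, t) ≠ H' (s, t') := by
    intro s t t' hχst htt he
    obtain ⟨hq, hs, ht⟩ := hχK _ (hχt _ hχst)
    obtain ⟨k1, k2⟩ := hch _ hq
    have ht' : t' ≠ 0 ∧ t' ≠ 1 := by
      have h1 : ¬ (t' = 0 ∨ t' = 1) := fun h ↦ by
        have h2 := (hH'.mem_boundary_iff htr' (q := (s, t))).1 (he ▸ hH'.2 (s, t') h)
        exact h2.elim ht.1 ht.2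
      exact not_or.1 h1
    have hq' : H (s, t') ∈ ψ.source := by
      by_contra hq'
      have h1 := hoff (s, t') fun h ↦ hq' (hχK _ h).1
      rw [he, h1] at k1
      exact hq' k1
    obtain ⟨k3, k4⟩ := hch _ hq'
    refine hv.1 ⟨((s : ℝ), (t : ℝ), (t' : ℝ)), ⟨s, t, t', rfl, hs, ht, ht', hq, hq'⟩, ?_, ?_⟩
    · simp only [α₁, β₁, X, pr, projIcc_val]
      by_contra! h
      have h1 : χ (s, t) = χ (s, t') := sub_eq_zero.1 h.1
      have h2 := h.2
      rw [← h1, ← mul_sub, mul_eq_zero, sub_eq_zero] at h2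
      exact h2.elim hχst fun h ↦ htt (Subtype.ext h)
    · simp only [α₁, β₁, w₁, X, F, pr, projIcc_val]
      rw [he, k4] at k2
      have k5 : ψ (H (s, t')) = ψ (H (s, t)) + χ (s, t) • (v.1 + (t : ℝ) • v.2) -
        χ (s, t') • (v.1 + (t' : ℝ) • v.2) := by
        rw [← k2]; simp
      rw [k5]
      module
  have hnc : ∀ s t : I, (s, t) ∈ tsupport χ → (s, t, t) ∈ embeddingDefect H' →
      χ (s, t) = 0 ∧ (s, t, t) ∈ embeddingDefect H := by
    intro s t hst hd
    obtain ⟨hq, hs, ht⟩ := hχK _ hst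
    obtain ⟨k1, k2⟩ := hch _ hq
    rw [hψ.mem_embeddingDefect_iff k1 (hsm' _)] at hd
    have hev : ∀ᶠ τ in 𝓝 t, H (s, τ) ∈ ψ.source :=
      (H.continuous.comp (Continuous.prodMk_right s)).continuousAt (ψ.open_source.mem_nhds hq)
    have h1 : HasDerivWithinAt (fun τ : ℝ ↦ ψ (H (s, pr τ))) (velocity (fun t ↦ ψ (H (s, t))) t)
        (Icc 0 1) t :=
      hasDerivWithinAt_velocity (contMDiffAt_slice (q := (s, t)) (hψ.contMDiffAt_comp hq (hsm _)))
    have h2 : HasDerivWithinAt (fun τ : ℝ ↦ χ (s, pr τ)) (velocity (fun t ↦ χ (s, t)) t)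
        (Icc 0 1) t := hasDerivWithinAt_velocity (contMDiffAt_slice (q := (s, t)) (hχ _))
    have h3 : HasDerivWithinAt (fun τ : ℝ ↦ v.1 + τ • v.2) v.2 (Icc 0 1) t := by
      simpa using ((hasDerivWithinAt_id (t : ℝ) (Icc 0 1)).smul_const v.2).const_add v.1
    have h4 : velocity (fun τ ↦ ψ (H (s, τ)) + χ (s, τ) • (v.1 + (τ : ℝ) • v.2)) t =
        velocity (fun t ↦ ψ (H (s, t))) t + (χ (s, t) • v.2 +
          velocity (fun t ↦ χ (s, t)) t • (v.1 + (t : ℝ) • v.2)) := by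
      have h5 := h1.add (h2.smul h3)
      simp only [pr, projIcc_val] at h5
      refine velocity_eq (h5.congr (fun τ hτ ↦ ?_) ?_)
      · simp [pr, projIcc_of_mem zero_le_one hτ]
      · simp [pr]
    rw [velocity_congr (hev.mono fun τ hτ ↦ (hch _ hτ).2), h4] at hd
    rw [hψ.mem_embeddingDefect_iff hq (hsm _)]
    by_cases hz : χ (s, t) = 0 ∧ velocity (fun t ↦ χ (s, t)) t = 0
    · rw [hz.1, hz.2] at hd
      exact ⟨hz.1, by simpa using hd⟩
    exfalso
    refine hv.2 ⟨((s : ℝ), (t : ℝ)), ⟨(s, t), rfl, hs, ht, hq⟩, ?_, ?_⟩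
    · simp only [X', X, pr, projIcc_val]
      by_contra! h
      have h6 := h.2
      rw [h.1, zero_mul, zero_add] at h6
      exact hz ⟨h6, h.1⟩
    · simp only [X', X, F', pr, projIcc_val]
      rw [eq_neg_iff_add_eq_zero, ← hd]
      module
  rintro ⟨s, t, t'⟩ hd
  by_cases htt : t = t'
  · subst htt
    by_cases hst : (s, t) ∈ tsupport χ
    · obtain ⟨h1, h2⟩ := hnc s t hst hd
      exact ⟨h2, fun h ↦ h h1⟩
    · refine ⟨⟨rfl, fun _ ↦ ?_⟩, fun h ↦ hst (hχt _ h)⟩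
      have hev : (fun τ ↦ H' (s, τ)) =ᶠ[𝓝 t] fun τ ↦ H (s, τ) := by
        filter_upwards [(Continuous.prodMk_right s).continuousAt.eventually
          ((isClosed_tsupport χ).isOpen_compl.mem_nhds hst)] with τ hτ using hoff _ hτ
      have h1 := hd.2 rfl
      rwa [hev.mfderiv_eq] at h1
  · have hne : χ (s, t) = 0 := by_contra fun hc ↦ hnd s t t' hc htt hd.1
    have hne' : χ (s, t') = 0 := by_contra fun hc ↦ hnd s t' t hc (Ne.symm htt) hd.1.symm
    refine ⟨⟨?_, fun h ↦ (htt h).elim⟩, fun h ↦ h hne⟩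
    have := hd.1
    rwa [hfix _ hne, hfix _ hne'] at this

end

/-! ### Embedding a family of arcs -/

section

open Set Filter Module

variable {M : Type*} [TopologicalSpace M]
  [ChartedSpace (EuclideanSpace ℝ (Fin 4)) M] {E B : Set M} {ψ : OpenPartialHomeomorph M R4}

/-- The double points and critical points of the arcs with parameter in `C` can be removed by a
deformation over `U`. Since a double point is described by the parameters `s`, `t`, `t'`, fewer than
the dimension of `M`, a generic displacement in a chart has none. The defects are covered by the
compact set of those `(s, t, t')` for which `t` is not close to an end point, and a displacement
supported near `(s, t)` removes the defects near `(s, t, t')` whatever `t'` is. -/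
theorem exists_embedded [T2Space M] (hE : ∀ y ∈ E, ∃ ψ, HalfSpaceChart E B ψ ∧ y ∈ ψ.source)
    {H : C(I × I, M)} (hH : IsArcFamily E B H) (hsm : ContMDiff squareModel (𝓡 4) ∞ H)
    (htr : boundaryDefect B H = ∅) (hne : ∀ s, H (s, 0) ≠ H (s, 1)) {C U : Set I}
    (hC : IsCompact C) (hU : IsOpen U) (hCU : C ⊆ U) (hU01 : ∀ s ∈ U, s ≠ 0 ∧ s ≠ 1) :
    ∃ H' : C(I × I, M), IsArcFamily E B H' ∧ DeformsOver E B U H H' ∧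
      ContMDiff squareModel (𝓡 4) ∞ H' ∧ boundaryDefect B H' = ∅ ∧
      ∀ p ∈ embeddingDefect H', p ∈ embeddingDefect H ∧ p.1 ∉ C := by
  have h0 := eventually_forall_notMem_embeddingDefect hE hH hsm htr hne (Or.inl rfl)
  have h1 := eventually_forall_notMem_embeddingDefect hE hH hsm htr hne (Or.inr rfl)
  set V : Set I := interior {t | ∀ z ∈ (univ : Set (I × I)), (z.1, t, z.2) ∉ embeddingDefect H}
  have hV0 : (0 : I) ∈ V := mem_interior_iff_mem_nhds.2 h0
  have hV1 : (1 : I) ∈ V := mem_interior_iff_mem_nhds.2 h1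
  have hCc : IsCompact {p : I × I × I | p.1 ∈ C ∧ p.2.1 ∉ V} :=
    ((hC.isClosed.preimage continuous_fst).inter
      (isOpen_interior.isClosed_compl.preimage (continuous_fst.comp continuous_snd))).isCompact
  obtain ⟨H', h1, h2, h3⟩ := exists_removing
    (Adm := fun H ↦ IsArcFamily E B H ∧ ContMDiff squareModel (𝓡 4) ∞ H ∧ boundaryDefect B H = ∅)
    (R := DeformsOver E B U) (bad := fun H ↦ embeddingDefect H) (fun _ h ↦ .refl h.1)
    (fun _ _ _ ↦ .trans) hCc ⟨hH, hsm, htr⟩ (fun p hp ↦ by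
      obtain ⟨s₀, t₀, t₁⟩ := p
      obtain ⟨hs₀, ht₀⟩ : s₀ ∈ C ∧ t₀ ∉ V := hp
      obtain ⟨ψ, hψ, hbψ⟩ := hE _ (hH.1 (s₀, t₀))
      obtain ⟨χ, hχ, hχW, hχ1, hχI⟩ := exists_bump (q := (s₀, t₀))
        (W := {q | H q ∈ ψ.source ∧ q.1 ∈ U ∧ q.2 ≠ 0 ∧ q.2 ≠ 1}) (inter_mem
          (H.continuous.continuousAt (ψ.open_source.mem_nhds hbψ))
          (inter_mem (continuousAt_fst (hU.mem_nhds (hCU hs₀)))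
            (inter_mem
              (continuousAt_snd.eventually_ne fun h : t₀ = 0 ↦ ht₀ (h ▸ hV0))
              (continuousAt_snd.eventually_ne fun h : t₀ = 1 ↦ ht₀ (h ▸ hV1)))))
      have hK := isClosed_tsupport χ
      refine ⟨{H | MapsTo H (tsupport χ) ψ.source},
        ContinuousMap.isOpen_setOfPred_mapsTo hK.isCompact ψ.open_source, fun q hq ↦ (hχW hq).1,
        {p | χ (p.1, p.2.1) = 1}, ?_, ?_⟩
      · have hc : Tendsto (fun p : I × I × I ↦ (p.1, p.2.1)) (𝓝 (s₀, t₀, t₁)) (𝓝 (s₀, t₀)) :=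
          Continuous.tendsto (by fun_prop) _
        exact hc.eventually hχ1
      rintro H₁ hO ⟨hH₁, hs₁, ht₁⟩ N hN
      obtain ⟨δ, hδ, hdef⟩ := hψ.exists_deformation hH₁ hK hO (fun q hq ↦ (hχW hq).2.1) hN
      have hχ0 : ∀ q ∉ tsupport χ, χ q = 0 := fun q hq ↦ image_eq_zero_of_notMem_tsupport hq
      -- over the support of `χ` the arcs stay at a positive distance `m` from `B`, and displacements
      -- smaller than `m` do not reach `B`
      obtain ⟨m, hm, hmK⟩ := hK.isCompact.exists_forall_le' (f := fun q ↦ ψ (H₁ q) 0) (a := 0)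
        (fun q hq ↦ ((EuclideanSpace.proj 0 : R4 →L[ℝ] ℝ).continuous.continuousAt.comp
          (continuousAt_chart_comp H₁ (hO hq))).continuousWithinAt)
        (fun q hq ↦ by
          refine lt_of_le_of_ne ((hψ.mem_iff _ (hO hq)).1 (hH₁.1 q)) fun h ↦ ?_
          have h1 := (hH₁.mem_boundary_iff ht₁).1 ((hψ.mem_boundary_iff _ (hO hq)).2 h.symm)
          exact h1.elim (hχW hq).2.2.1 (hχW hq).2.2.2)
      obtain ⟨a, b, ha, hb, hgen⟩ := hψ.exists_generic hs₁ hχ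
        (fun q hq ↦ ⟨hO hq, hU01 _ (hχW hq).2.1, (hχW hq).2.2⟩)
        (half_pos (lt_min hδ hm))
      let D : I × I → R4 := fun q ↦ χ q • (a + (q.2 : ℝ) • b)
      have hDs : ContMDiff squareModel (𝓡 4) ∞ D :=
        hχ.smul (contMDiff_const.add ((contMDiff_subtypeVal_Icc.comp contMDiff_snd).smul
          contMDiff_const))
      have hDn : ∀ q, ‖D q‖ < min δ m := fun q ↦ by
        have k1 := hχI q
        have k2 := q.2.2
        have k3 : ‖a + (q.2 : ℝ) • b‖ ≤ ‖a‖ + 1 * ‖b‖ := by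
          refine (norm_add_le _ _).trans ?_
          rw [norm_smul, Real.norm_of_nonneg k2.1]
          gcongr
          exact k2.2
        have k4 : ‖D q‖ ≤ 1 * ‖a + (q.2 : ℝ) • b‖ := by
          simp only [D, norm_smul, Real.norm_of_nonneg k1.1]
          gcongr
          exact k1.2
        linarith
      have hpos : ∀ q ∈ tsupport χ, 0 < ψ (H₁ q) 0 + D q 0 := fun q hq ↦ by
        have k1 := hmK q hq
        have k2 : |D q 0| ≤ ‖D q‖ := PiLp.norm_apply_le (D q) 0
        have k3 := (hDn q).trans_le (min_le_right _ _)
        have k4 := neg_abs_le (D q 0)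
        linarith
      obtain ⟨H₂, hN₂, hA, hdf, hch, hoff⟩ := hdef ⟨D, hDs.continuous⟩
        (fun q hq ↦ by simp [D, hχ0 q hq])
        (fun q ↦ (hDn q).trans_le (min_le_left _ _))
        (fun q hq ↦ by
          by_cases hqK : q ∈ tsupport χ
          · exact (hpos q hqK).le
          · simpa [D, hχ0 q hqK] using (hψ.mem_iff _ hq).1 (hH₁.1 q))
        (fun q hq hq2 ↦ by
          have hqK : q ∉ tsupport χ := fun h ↦ hq2.elim (hχW h).2.2.1 (hχW h).2.2.2
          simp [D, hχ0 q hqK])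
      have hs₂ : ContMDiff squareModel (𝓡 4) ∞ H₂ := hψ.contMDiff_of_add hK hO hDs hs₁ hch hoff
      have ht₂ : boundaryDefect B H₂ = ∅ := by
        refine eq_empty_of_forall_notMem fun q hq ↦ ?_
        by_cases hqK : q ∈ tsupport χ
        · obtain ⟨k1, k2⟩ := hch q (hO hqK)
          have k3 := (hψ.mem_boundary_iff _ k1).1 hq.1
          rw [k2] at k3
          exact (hpos q hqK).ne' k3
        · refine (ht₁ ▸ notMem_empty q : q ∉ boundaryDefect B H₁) ((boundaryDefect_congr ?_).1 hq)
          filter_upwards [hK.isOpen_compl.mem_nhds hqK] with x hx using hoff x hx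
      refine ⟨H₂, hN₂, ⟨hA, hs₂, ht₂⟩, hdf, ?_⟩
      refine (hgen H₂ hA hs₂ ht₂ hch hoff).trans (sdiff_subset_sdiff_right fun p hp ↦ ?_)
      have k1 : χ (p.1, p.2.1) = 1 := hp
      simp [k1])
  refine ⟨H', h1.1, h2, h1.2.1, h1.2.2, fun p hp ↦ ?_⟩
  obtain ⟨h4, h5⟩ := h3 hp
  refine ⟨h4, fun hpC ↦ h5 ⟨hpC, fun hpV ↦ ?_⟩⟩
  exact interior_subset hpV (p.1, p.2.2) (mem_univ _) h4

/-- A family of arcs without defects consists of cords. -/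
theorem exists_cord_of_family {H : C(I × I, M)} (hH : IsArcFamily E B H)
    (hsm : ContMDiff squareModel (𝓡 4) ∞ H) (htr : boundaryDefect B H = ∅) (s : I)
    (hemb : ∀ p ∈ embeddingDefect H, p.1 ≠ s) : ∃ c : Cord E B, ∀ t, c.toFun t = H (s, t) := by
  refine ⟨⟨fun t ↦ H (s, t), fun t ↦ contMDiffAt_slice (hsm (s, t)), fun t t' h ↦ ?_,
    fun t h ↦ ?_, fun t ↦ hH.1 _, fun t ↦ hH.mem_boundary_iff htr (q := (s, t)),
    fun t ht h ↦ ?_⟩, fun t ↦ rfl⟩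
  · by_contra htt
    exact hemb (s, t, t') ⟨h, fun h' ↦ (htt h').elim⟩ rfl
  · exact hemb (s, t, t) ⟨rfl, fun _ ↦ h⟩ rfl
  · exact (htr ▸ notMem_empty _ : (s, t) ∉ boundaryDefect B H) ⟨hH.2 (s, t) ht, fun _ ↦ h⟩

theorem Cord.notMem_boundaryDefect (c : Cord E B) {H : I × I → M} {s : I}
    (h : ∀ t, H (s, t) = c.toFun t) (t : I) : (s, t) ∉ boundaryDefect B H := by
  obtain ⟨c, _, _, _, _, hB, htr⟩ := c
  obtain rfl : c = fun t ↦ H (s, t) := funext fun t ↦ (h t).symm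
  rintro ⟨h1, h2⟩
  have h3 := (hB t).1 h1
  exact htr t h3 (h2 h3)

theorem Cord.notMem_embeddingDefect (c : Cord E B) {H : I × I → M} {s : I}
    (h : ∀ t, H (s, t) = c.toFun t) (t t' : I) : (s, t, t') ∉ embeddingDefect H := by
  obtain ⟨c, _, hinj, himm, _, _, _⟩ := c
  obtain rfl : c = fun t ↦ H (s, t) := funext fun t ↦ (h t).symm
  rintro ⟨h1, h2⟩
  exact himm t (h2 (hinj h1))

end

/-! ### Cords and homotopies of arcs -/

section

open Set Filter Module

variable {M : Type*} [TopologicalSpace M]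

/-- A continuous arc in `E` with end points in `B`. -/
def IsArc (E B : Set M) (γ : C(I, M)) : Prop := (∀ t, γ t ∈ E) ∧ γ 0 ∈ B ∧ γ 1 ∈ B

theorem IsArcFamily.slice {E B : Set M} {H : C(I × I, M)}
    (h : IsArcFamily E B H) (s : I) :
    IsArc E B ⟨fun t ↦ H (s, t), by fun_prop⟩ :=
  ⟨fun _ ↦ h.1 _, h.2 _ (Or.inl rfl), h.2 _ (Or.inr rfl)⟩

variable [ChartedSpace (EuclideanSpace ℝ (Fin 4)) M] {E B : Set M}

/-- The continuous map underlying a cord. -/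
def Cord.toContinuousMap (c : Cord E B) : C(I, M) := ⟨c.toFun, c.smooth.continuous⟩

theorem Cord.isArc (c : Cord E B) : IsArc E B c.toContinuousMap :=
  ⟨c.mem, (c.mem_boundary_iff 0).2 (Or.inl rfl), (c.mem_boundary_iff 1).2 (Or.inr rfl)⟩

/-- Every arc in `E` with end points in `B` is homotopic, through such arcs, to a cord. -/
theorem exists_cord_homotopicWith [T2Space M]
    (hE : ∀ y ∈ E, ∃ ψ, HalfSpaceChart E B ψ ∧ y ∈ ψ.source) {γ : C(I, M)} (hγ : IsArc E B γ) :
    ∃ c : Cord E B, γ.HomotopicWith c.toContinuousMap (IsArc E B) := by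
  have hH : IsArcFamily E B (γ.comp ⟨Prod.snd, continuous_snd⟩) := by
    refine ⟨fun q ↦ hγ.1 _, fun q hq ↦ ?_⟩
    rcases hq with h | h
    · simpa [h] using hγ.2.1
    · simpa [h] using hγ.2.2
  -- remove the defects of the constant family; only one arc has to be embedded in the end
  obtain ⟨H₁, h₁, d₁, s₁⟩ := exists_smoothing hE hH isCompact_univ isOpen_univ subset_rfl
    fun q hq ↦ (hq (mem_univ _)).elim
  obtain ⟨H₂, h₂, d₂, s₂, t₂⟩ := exists_transverse hE h₁ s₁ isCompact_univ isOpen_univ subset_rfl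
    fun q hq ↦ (hq (mem_univ _)).elim
  obtain ⟨H₃, h₃, d₃, s₃, t₃, e₃⟩ := exists_endpoints_ne hE h₂ s₂ t₂ isCompact_univ isOpen_univ
    subset_rfl fun q hq ↦ (hq (mem_univ _)).elim
  let m : I := ⟨1 / 2, by norm_num, by norm_num⟩
  have hm : m ∈ ({0}ᶜ ∩ {1}ᶜ : Set I) := by
    constructor <;> intro h <;> have := congrArg Subtype.val h <;> norm_num [m] at this
  obtain ⟨H₄, h₄, d₄, s₄, t₄, e₄⟩ := exists_embedded hE h₃ s₃ t₃ e₃ (isCompact_singleton (x := m))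
    (isOpen_compl_singleton.inter isOpen_compl_singleton) (singleton_subset_iff.2 hm)
    (fun s hs ↦ ⟨hs.1, hs.2⟩)
  obtain ⟨c, hc⟩ := exists_cord_of_family h₄ s₄ t₄ m fun p hp ↦ (e₄ p hp).2
  refine ⟨c, ?_⟩
  obtain ⟨F⟩ := ((d₁.1.trans d₂.1).trans d₃.1).trans d₄.1
  refine ⟨⟨⟨⟨fun z ↦ F (z.1, (m, z.2)), by fun_prop⟩, fun t ↦ ?_, fun t ↦ ?_⟩, fun r ↦ ?_⟩⟩
  · exact F.apply_zero _
  · exact (F.apply_one _).trans (hc t).symm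
  · exact (F.prop r).slice m

/-- Cords that are homotopic through arcs in `E` with end points in `B` are isotopic. -/
theorem Cord.isotopic_of_homotopicWith [T2Space M]
    (hE : ∀ y ∈ E, ∃ ψ, HalfSpaceChart E B ψ ∧ y ∈ ψ.source) {c d : Cord E B}
    (h : c.toContinuousMap.HomotopicWith d.toContinuousMap (IsArc E B)) : c.Isotopic d := by
  obtain ⟨F⟩ := h
  -- the homotopy, reparametrized to be constant on `[0, 1/3]` and on `[2/3, 1]`
  let H : C(I × I, M) := ⟨fun q ↦ F (cutoff 1 q.1, q.2),
    F.continuous.comp (((contMDiff_cutoff 1).continuous.comp continuous_fst).prodMk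
      continuous_snd)⟩
  have hH : IsArcFamily E B H := by
    refine ⟨fun q ↦ (F.prop (cutoff 1 q.1)).1 q.2, fun q hq ↦ ?_⟩
    have := (F.prop (cutoff 1 q.1)).2
    rcases hq with h | h
    · simpa [H, h] using this.1
    · simpa [H, h] using this.2
  -- The parameters at distance at least (resp. more than) `a` from `0` and `1`. A deformation which
  -- removes the defects over `C a` changes the family over `U a'` for some `a' < a`. Outside `C a`
  -- the family still consists of copies of `c` and `d`, and has no defects there.
  let C : ℝ → Set I := fun a ↦ {s | a ≤ (s : ℝ) ∧ (s : ℝ) ≤ 1 - a}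
  let U : ℝ → Set I := fun a ↦ {s | a < (s : ℝ) ∧ (s : ℝ) < 1 - a}
  have hC : ∀ a, IsCompact (C a) := fun a ↦ (isClosed_le continuous_const continuous_subtype_val).inter
    (isClosed_le continuous_subtype_val continuous_const) |>.isCompact
  have hU : ∀ a, IsOpen (U a) := fun a ↦ (isOpen_lt continuous_const continuous_subtype_val).inter
    (isOpen_lt continuous_subtype_val continuous_const)
  have hCU : ∀ a b, b < a → C a ⊆ U b := fun a b hab s hs ↦
    ⟨hab.trans_le hs.1, hs.2.trans_lt (by linarith)⟩
  have hlow : ∀ q : I × I, (q.1 : ℝ) ≤ 1 / 3 → H q = c.toFun q.2 := fun q hq ↦ by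
    have : cutoff 1 q.1 = 0 := Subtype.ext (Real.smoothTransition.zero_of_nonpos (by linarith))
    simp only [H, ContinuousMap.coe_mk, this]
    exact F.apply_zero _
  have hhigh : ∀ q : I × I, 2 / 3 ≤ (q.1 : ℝ) → H q = d.toFun q.2 := fun q hq ↦ by
    have : cutoff 1 q.1 = 1 := Subtype.ext (Real.smoothTransition.one_of_one_le (by linarith))
    simp only [H, ContinuousMap.coe_mk, this]
    exact F.apply_one _
  have hcord : ∀ s ∉ U (1 / 3), ∃ e : Cord E B, ∀ t, H (s, t) = e.toFun t := by
    intro s hs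
    by_cases h : (s : ℝ) ≤ 1 / 3
    · exact ⟨c, fun t ↦ hlow (s, t) h⟩
    · refine ⟨d, fun t ↦ hhigh (s, t) ?_⟩
      by_contra h'
      push Not at h h'
      exact hs ⟨h, by linarith⟩
  have hcont : Continuous fun q : I × I ↦ (q.1 : ℝ) := by fun_prop
  obtain ⟨H₁, h₁, d₁, s₁⟩ := exists_smoothing hE hH (hC (1 / 3)) (hU (1 / 4))
    (hCU _ _ (by norm_num)) fun q hq ↦ by
      have hq' : (q.1 : ℝ) < 1 / 3 ∨ 2 / 3 < (q.1 : ℝ) := by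
        by_contra! h
        exact hq ⟨h.1, by linarith⟩
      rcases hq' with h | h
      · refine (c.smooth.comp contMDiff_snd q).congr_of_eventuallyEq ?_
        filter_upwards [hcont.continuousAt.eventually_lt_const h] with x hx using hlow x hx.le
      · refine (d.smooth.comp contMDiff_snd q).congr_of_eventuallyEq ?_
        filter_upwards [hcont.continuousAt.eventually_const_lt h] with x hx using hhigh x hx.le
  have hsub : ∀ a b, a ≤ b → ∀ s ∉ U a, s ∉ U b := fun a b hab s hs hs' ↦
    hs ⟨hab.trans_lt hs'.1, hs'.2.trans_le (by linarith)⟩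
  have hUC : ∀ a, ∀ s ∉ C a, s ∉ U a := fun a s hs hs' ↦ hs ⟨hs'.1.le, hs'.2.le⟩
  have k₁ : ∀ s ∉ U (1 / 4), ∀ t, H₁ (s, t) = H (s, t) := fun s hs t ↦ d₁.2 _ hs
  obtain ⟨H₂, h₂, d₂, s₂, t₂⟩ := exists_transverse hE h₁ s₁ (hC (1 / 4)) (hU (1 / 5))
    (hCU _ _ (by norm_num)) fun q hq ↦ by
      have hq' := hUC _ _ hq
      obtain ⟨e, he⟩ := hcord q.1 (hsub _ _ (by norm_num) _ hq')
      exact e.notMem_boundaryDefect (fun t ↦ (k₁ _ hq' t).trans (he t)) q.2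
  have k₂ : ∀ s ∉ U (1 / 5), ∀ t, H₂ (s, t) = H (s, t) := fun s hs t ↦
    (d₂.2 _ hs).trans (k₁ s (hsub _ _ (by norm_num) _ hs) t)
  obtain ⟨H₃, h₃, d₃, s₃, t₃, e₃⟩ := exists_endpoints_ne hE h₂ s₂ t₂ (hC (1 / 5)) (hU (1 / 6))
    (hCU _ _ (by norm_num)) fun s hs ↦ by
      have hs' := hUC _ _ hs
      obtain ⟨e, he⟩ := hcord s (hsub _ _ (by norm_num) _ hs')
      rw [k₂ s hs', k₂ s hs', he, he]
      exact e.injective.ne zero_ne_one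
  have k₃ : ∀ s ∉ U (1 / 6), ∀ t, H₃ (s, t) = H (s, t) := fun s hs t ↦
    (d₃.2 _ hs).trans (k₂ s (hsub _ _ (by norm_num) _ hs) t)
  obtain ⟨H₄, h₄, d₄, s₄, t₄, e₄⟩ := exists_embedded hE h₃ s₃ t₃ e₃ (hC (1 / 6)) (hU (1 / 7))
    (hCU _ _ (by norm_num)) fun s hs ↦ by
      constructor
      · rintro rfl; have := hs.1; norm_num at this
      · rintro rfl; have := hs.2; norm_num at this
  have k₄ : ∀ s ∉ U (1 / 7), ∀ t, H₄ (s, t) = H (s, t) := fun s hs t ↦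
    (d₄.2 _ hs).trans (k₃ s (hsub _ _ (by norm_num) _ hs) t)
  refine ⟨H₄, s₄, fun s ↦ ?_, fun t ↦ ?_, fun t ↦ ?_⟩
  · refine exists_cord_of_family h₄ s₄ t₄ s fun p hp _ ↦ ?_
    obtain ⟨hp₁, hp₂⟩ := e₄ p hp
    have hp' := hUC _ _ hp₂
    obtain ⟨e, he⟩ := hcord p.1 (hsub _ _ (by norm_num) _ hp')
    exact e.notMem_embeddingDefect (fun t ↦ (k₃ _ hp' t).trans (he t)) _ _ hp₁
  · rw [k₄ 0 (fun h ↦ by have := h.1; norm_num at this)]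
    exact hlow (0, t) (by norm_num)
  · rw [k₄ 1 (fun h ↦ by have := h.2; norm_num at this)]
    exact hhigh (1, t) (by norm_num)

end

/-! ### Half-space charts for the exterior -/

section

open Set Filter Module Bundle

section InverseFunction

/-- A function on `ℝ⁴` whose differential at `z` is nonzero is, near `z`, the `0`-th coordinate of a
smooth coordinate system. -/
theorem exists_coordinates {W : Set R4} (hW : IsOpen W) {g : R4 → ℝ} (hg : ContDiffOn ℝ ∞ g W)
    {z : R4} (hz : z ∈ W) (hd : fderiv ℝ g z ≠ 0) :
    ∃ Θ : OpenPartialHomeomorph R4 R4, z ∈ Θ.source ∧ Θ.source ⊆ W ∧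
      ContDiffOn ℝ ∞ Θ Θ.source ∧ ContDiffOn ℝ ∞ Θ.symm Θ.target ∧ ∀ v, Θ v 0 = g v := by
  obtain ⟨i, hi⟩ : ∃ i, fderiv ℝ g z (EuclideanSpace.single i 1) ≠ 0 := by
    by_contra! h
    refine hd (ContinuousLinearMap.coe_injective
      ((EuclideanSpace.basisFun (Fin 4) ℝ).toBasis.ext fun i ↦ ?_))
    simpa using h i
  -- exchange the coordinates `0` and `i`, and then replace the `0`-th coordinate by `g`
  let τ : R4 ≃ₗᵢ[ℝ] R4 := LinearIsometryEquiv.piLpCongrLeft 2 ℝ ℝ (Equiv.swap 0 i)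
  have hτ : ∀ (v : R4) j, τ v j = v (Equiv.swap 0 i j) := fun v j ↦ by
    simp [τ, LinearIsometryEquiv.piLpCongrLeft_apply, Equiv.piCongrLeft']
  let e0 : R4 := EuclideanSpace.single 0 1
  let Θ : R4 → R4 := fun v ↦ τ v + (g v - v i) • e0
  have hΘ0 : ∀ v, Θ v 0 = g v := fun v ↦ by simp [Θ, hτ, e0]
  have hΘ : ContDiffOn ℝ ∞ Θ W := by
    have h1 : ContDiff ℝ ∞ (fun v : R4 ↦ v i) := by fun_prop
    exact τ.contDiff.contDiffOn.add ((hg.sub h1.contDiffOn).smul contDiffOn_const)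
  let A : R4 →L[ℝ] R4 := (τ : R4 →L[ℝ] R4) +
    (fderiv ℝ g z - EuclideanSpace.proj i).smulRight e0
  have hgz : HasFDerivAt g (fderiv ℝ g z) z :=
    ((hg.contDiffAt (hW.mem_nhds hz)).differentiableAt (by simp)).hasFDerivAt
  have hA : HasFDerivAt Θ A z :=
    (τ : R4 →L[ℝ] R4).hasFDerivAt.add
      ((hgz.sub (EuclideanSpace.proj (𝕜 := ℝ) i).hasFDerivAt).smul_const e0)
  have hinj : Function.Injective A := by
    refine (injective_iff_map_eq_zero A).2 fun w hw ↦ ?_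
    have hc : ∀ j, w (Equiv.swap 0 i j) + (fderiv ℝ g z w - w i) * e0 j = 0 := fun j ↦ by
      have := congrArg (fun v : R4 ↦ v j) hw
      simpa [A, hτ] using this
    have hk : ∀ k, k ≠ i → w k = 0 := fun k hk ↦ by
      have h := hc (Equiv.swap 0 i k)
      have : Equiv.swap 0 i k ≠ 0 := fun h0 ↦ hk (by
        simpa using congrArg (Equiv.swap 0 i) h0)
      simpa [e0, this] using h
    have hwi : w = w i • EuclideanSpace.single i 1 := by
      ext k
      by_cases h : k = i
      · simp [h]
      · simp [h, hk k h]
    have h0 : fderiv ℝ g z w = 0 := by simpa [e0] using hc 0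
    rw [hwi, map_smul, smul_eq_mul, mul_eq_zero, or_iff_left hi] at h0
    rw [hwi, h0, zero_smul]
  let A' : R4 ≃L[ℝ] R4 := (LinearEquiv.ofInjectiveEndo A.toLinearMap hinj).toContinuousLinearEquiv
  have hAA' : (A' : R4 →L[ℝ] R4) = A := by ext; rfl
  have hzc : ContDiffAt ℝ ∞ Θ z := hΘ.contDiffAt (hW.mem_nhds hz)
  rw [← hAA'] at hA
  let Ψ := hzc.toOpenPartialHomeomorph Θ hA (by simp)
  -- the points where the differential is invertible form an open set
  have hfd : ContinuousOn (fderiv ℝ Θ) W := hΘ.continuousOn_fderiv_of_isOpen hW (by simp)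
  let U : Set R4 := W ∩ fderiv ℝ Θ ⁻¹' (range ((↑) : (R4 ≃L[ℝ] R4) → R4 →L[ℝ] R4))
  have hU : IsOpen U := hfd.isOpen_inter_preimage hW ContinuousLinearEquiv.isOpen
  have hzU : z ∈ U := ⟨hz, A', hA.fderiv.symm⟩
  have hsrc : (Ψ.restrOpen U hU).source = Ψ.source ∩ U := rfl
  refine ⟨Ψ.restrOpen U hU, ⟨hzc.mem_toOpenPartialHomeomorph_source hA _, hzU⟩,
    fun v hv ↦ hv.2.1, hΘ.mono fun v hv ↦ hv.2.1, ?_, hΘ0⟩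
  intro v hv
  have hv' := (Ψ.restrOpen U hU).map_target hv
  obtain ⟨⟨B, hB⟩, hW'⟩ : (_ ∈ range _) ∧ _ := ⟨hv'.2.2, hv'.2.1⟩
  refine (OpenPartialHomeomorph.contDiffAt_symm _ hv (f₀' := B) ?_
    (hΘ.contDiffAt (hW.mem_nhds hW'))).contDiffWithinAt
  rw [hB]
  exact ((hΘ.contDiffAt (hW.mem_nhds hW')).differentiableAt (by simp)).hasFDerivAt

end InverseFunction

variable {M : Type*} [TopologicalSpace M] [ChartedSpace (EuclideanSpace ℝ (Fin 4)) M]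

section

variable [IsManifold (𝓡 4) ∞ M] {E B : Set M}

/-- If, near `y`, the sets `E` and `B` are cut out by `g ≥ 0` and `g = 0` for a smooth function `g`
of a chart with nonzero differential, then there is a half-space chart at `y`. -/
theorem exists_halfSpaceChart {y : M} {W : Set R4} (hW : IsOpen W) {g : R4 → ℝ}
    (hg : ContDiffOn ℝ ∞ g W) (hy : chartAt R4 y y ∈ W)
    (hd : fderiv ℝ g (chartAt R4 y y) ≠ 0)
    (hEB : ∀ᶠ x in 𝓝 y, (x ∈ E ↔ 0 ≤ g (chartAt R4 y x)) ∧ (x ∈ B ↔ g (chartAt R4 y x) = 0)) :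
    ∃ ψ, HalfSpaceChart E B ψ ∧ y ∈ ψ.source := by
  obtain ⟨Θ, hz, -, hΘ, hΘ', hΘg⟩ := exists_coordinates hW hg hy hd
  obtain ⟨N, hN, hNo, hyN⟩ := mem_nhds_iff.1 hEB
  let φ := chartAt R4 y
  have h1 : ContMDiffOn (𝓡 4) (𝓡 4) ∞ φ φ.source := contMDiffOn_chart
  have h2 : ContMDiffOn (𝓡 4) (𝓡 4) ∞ φ.symm φ.target := contMDiffOn_chart_symm
  refine ⟨(φ.trans Θ).restrOpen N hNo, ⟨?_, ?_, ?_, ?_⟩, ⟨⟨mem_chart_source _ y, hz⟩, hyN⟩⟩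
  · exact hΘ.contMDiffOn.comp (h1.mono fun x hx ↦ hx.1.1) fun x hx ↦ hx.1.2
  · exact h2.comp (hΘ'.contMDiffOn.mono fun x hx ↦ hx.1.1) fun x hx ↦ hx.1.2
  · intro x hx
    have := (hN hx.2).1
    simpa [hΘg] using this
  · intro x hx
    have := (hN hx.2).2
    simpa [hΘg] using this

/-- Around an interior point of `E` there is a half-space chart which misses the boundary. -/
theorem exists_halfSpaceChart_of_interior {y : M} (hE : E ∈ 𝓝 y) (hB : Bᶜ ∈ 𝓝 y) :
    ∃ ψ, HalfSpaceChart E B ψ ∧ y ∈ ψ.source := by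
  -- a coordinate, translated so as to be positive near `y`
  let g : R4 → ℝ := fun v ↦ EuclideanSpace.proj (𝕜 := ℝ) 0 v + (1 - chartAt R4 y y 0)
  refine exists_halfSpaceChart isOpen_univ (g := g) (by fun_prop) (mem_univ _) ?_ ?_
  · rw [fderiv_add_const, ContinuousLinearMap.fderiv]
    intro h
    simpa using congrArg (fun L : R4 →L[ℝ] ℝ ↦ L (EuclideanSpace.single 0 1)) h
  · have hc : ContinuousAt (fun x ↦ g (chartAt R4 y x)) y :=
      (by fun_prop : Continuous g).continuousAt.comp
        ((chartAt R4 y).continuousAt (mem_chart_source _ y))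
    have hpos : (0 : ℝ) < g (chartAt R4 y y) := by simp [g]
    filter_upwards [hE, hB, hc.eventually (lt_mem_nhds hpos)] with x h1 h2 h3
    exact ⟨iff_of_true h1 h3.le, iff_of_false h2 h3.ne'⟩

end

section Bundle

variable {V : Sphere2 → Type*} [TopologicalSpace (Bundle.TotalSpace Plane V)]
  [∀ x, NormedAddCommGroup (V x)] [∀ x, InnerProductSpace ℝ (V x)]
  [FiberBundle Plane V] [VectorBundle ℝ Plane V]

theorem continuous_norm_bundle [IsContinuousRiemannianBundle Plane V] :
    Continuous fun ξ : TotalSpace Plane V ↦ ‖ξ.2‖ := by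
  have h : Continuous fun ξ : TotalSpace Plane V ↦ inner ℝ ξ.2 ξ.2 :=
    Continuous.inner_bundle (F := Plane) (E := V) (b := fun ξ : TotalSpace Plane V ↦ ξ.proj)
      (v := fun ξ ↦ ξ.2) (w := fun ξ ↦ ξ.2) continuous_id continuous_id
  simpa [real_inner_self_eq_norm_sq, Real.sqrt_sq] using h.sqrt

/-- The closed unit disc bundle of a Riemannian plane bundle over the sphere is compact. -/
theorem isCompact_discBundle [IsContinuousRiemannianBundle Plane V] :
    IsCompact {ξ : TotalSpace Plane V | ‖ξ.2‖ ≤ 1} := by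
  have hcl : IsClosed {ξ : TotalSpace Plane V | ‖ξ.2‖ ≤ 1} :=
    isClosed_le continuous_norm_bundle continuous_const
  have hproj : Continuous fun ξ : TotalSpace Plane V ↦ ξ.proj := FiberBundle.continuous_proj Plane V
  have key : ∀ x : Sphere2, ∃ K ∈ 𝓝 x, IsCompact {ξ : TotalSpace Plane V | ξ.proj ∈ K ∧ ‖ξ.2‖ ≤ 1} := by
    intro x
    let e := trivializationAt Plane V x
    obtain ⟨C, -, hC⟩ := eventually_norm_trivializationAt_lt Plane V x
    have hb : e.baseSet ∈ 𝓝 x := e.open_baseSet.mem_nhds (FiberBundle.mem_baseSet_trivializationAt' x)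
    obtain ⟨K, hK, hKs, hKc⟩ := local_compact_nhds (inter_mem hC hb)
    refine ⟨K, hK, ?_⟩
    have hc : IsCompact (e.toOpenPartialHomeomorph.symm '' (K ×ˢ Metric.closedBall (0 : Plane) C)) :=
      (hKc.prod (isCompact_closedBall _ _)).image_of_continuousOn
        (e.continuousOn_invFun.mono fun z hz ↦ e.mem_target.2 (hKs hz.1).2)
    refine hc.of_isClosed_subset ((hKc.isClosed.preimage hproj).inter hcl) ?_
    rintro ξ ⟨h1, h2⟩
    have hξ : ξ ∈ e.source := e.mem_source.2 (hKs h1).2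
    refine ⟨e ξ, ⟨by rwa [e.coe_fst hξ], ?_⟩, e.toOpenPartialHomeomorph.left_inv hξ⟩
    have h3 : (e ξ).2 = e.continuousLinearMapAt ℝ ξ.proj ξ.2 := by
      rw [Bundle.Trivialization.continuousLinearMapAt_apply, e.coe_linearMapAt_of_mem (hKs h1).2]
    rw [mem_closedBall_zero_iff, h3]
    refine (ContinuousLinearMap.le_opNorm _ _).trans ?_
    have := (hKs h1).1
    calc _ ≤ C * 1 := mul_le_mul this.le h2 (norm_nonneg _) ((norm_nonneg _).trans this.le)
      _ = C := mul_one _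
  choose K hK hKc using key
  obtain ⟨t, -, ht⟩ := isCompact_univ.elim_nhds_subcover K fun x _ ↦ hK x
  refine (t.finite_toSet.isCompact_biUnion fun x _ ↦ hKc x).of_isClosed_subset hcl fun ξ hξ ↦ ?_
  obtain ⟨x, hx, h⟩ := mem_iUnion₂.1 (ht (mem_univ ξ.proj))
  exact mem_iUnion₂.2 ⟨x, hx, h, hξ⟩

theorem isContinuousRiemannianBundle [h : IsContMDiffRiemannianBundle (𝓡 2) ∞ Plane V] :
    IsContinuousRiemannianBundle Plane V := by
  obtain ⟨g, hg, hg'⟩ := h.exists_contMDiff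
  exact ⟨g, hg.continuous, hg'⟩

theorem contMDiff_norm_sq_bundle [IsContMDiffRiemannianBundle (𝓡 2) ∞ Plane V] :
    ContMDiff ((𝓡 2).prod 𝓘(ℝ, Plane)) 𝓘(ℝ, ℝ) ∞ fun ξ : TotalSpace Plane V ↦ ‖ξ.2‖ ^ 2 := by
  have h : ContMDiff ((𝓡 2).prod 𝓘(ℝ, Plane)) 𝓘(ℝ, ℝ) ∞
      fun ξ : TotalSpace Plane V ↦ inner ℝ ξ.2 ξ.2 :=
    ContMDiff.inner_bundle (IB := 𝓡 2) (F := Plane) (E := V)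
      (b := fun ξ : TotalSpace Plane V ↦ ξ.proj)
      (v := fun ξ ↦ ξ.2) (w := fun ξ ↦ ξ.2) contMDiff_id contMDiff_id
  simpa [real_inner_self_eq_norm_sq] using h

theorem contMDiff_smul_fibre [ContMDiffVectorBundle ∞ Plane V (𝓡 2)] (ξ : TotalSpace Plane V) :
    ContMDiff 𝓘(ℝ, ℝ) ((𝓡 2).prod 𝓘(ℝ, Plane)) ∞
      fun s : ℝ ↦ (⟨ξ.proj, s • ξ.2⟩ : TotalSpace Plane V) := by
  intro s
  refine contMDiffAt_totalSpace.2 ⟨contMDiffAt_const, ?_⟩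
  let e := trivializationAt Plane V ξ.proj
  have hx : ξ.proj ∈ e.baseSet := FiberBundle.mem_baseSet_trivializationAt' _
  have h : ∀ s : ℝ, (e ⟨ξ.proj, s • ξ.2⟩).2 = s • (e ξ).2 := fun s ↦
    (e.linear ℝ hx).map_smul s ξ.2
  simp only [e] at h
  simp only [h]
  exact contMDiffAt_id.smul contMDiffAt_const

namespace TubularNeighborhood

variable {f : Sphere2 → M} (ν : TubularNeighborhood f V)

theorem mem_exterior_iff (ξ : TotalSpace Plane V) : ν.toFun ξ ∈ ν.exterior ↔ 1 ≤ ‖ξ.2‖ := by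
  rw [exterior, openNbhd, mem_compl_iff, ν.injective.mem_set_image, mem_ofPred_eq, not_lt]

theorem mem_boundary_iff (ξ : TotalSpace Plane V) : ν.toFun ξ ∈ ν.boundary ↔ ‖ξ.2‖ = 1 := by
  rw [boundary, ν.injective.mem_set_image, mem_ofPred_eq]

variable [IsManifold (𝓡 4) ∞ M] [IsContMDiffRiemannianBundle (𝓡 2) ∞ Plane V]
  [ContMDiffVectorBundle ∞ Plane V (𝓡 2)]

/-- Near the boundary, the exterior is the region where the squared norm, transported to `M` by the
tubular neighborhood, is at least `1`. The squared norm has nonzero differential on the unit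
circle bundle, since it is `s ^ 2` along the radius `s ↦ s • ξ`. -/
theorem exists_halfSpaceChart_of_mem_boundary {y : M} (hy : y ∈ ν.boundary) :
    ∃ ψ, HalfSpaceChart ν.exterior ν.boundary ψ ∧ y ∈ ψ.source := by
  obtain ⟨ξ, hξ, rfl⟩ := hy
  replace hξ : ‖ξ.2‖ = 1 := hξ
  obtain ⟨Φ, hΦ, hνΦ⟩ := ν.isLocalDiffeomorph ξ
  let φ := chartAt R4 (ν.toFun ξ)
  have hφc : ContMDiffOn (𝓡 4) (𝓡 4) ∞ φ.symm φ.target := contMDiffOn_chart_symm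
  have hyt : ν.toFun ξ ∈ Φ.target := by rw [hνΦ hΦ]; exact Φ.map_source hΦ
  have hys : ν.toFun ξ ∈ φ.source := mem_chart_source _ _
  let W : Set R4 := φ.target ∩ φ.symm ⁻¹' Φ.target
  have hW : IsOpen W := φ.symm.isOpen_inter_preimage Φ.open_target
  let g : R4 → ℝ := fun v ↦ ‖(Φ.toPartialEquiv.symm (φ.symm v)).2‖ ^ 2 - 1
  have hg : ContDiffOn ℝ ∞ g W := by
    have h1 : ContMDiffOn (𝓡 4) ((𝓡 2).prod 𝓘(ℝ, Plane)) ∞ (fun v ↦ Φ.toPartialEquiv.symm (φ.symm v)) W :=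
      Φ.contMDiffOn_invFun.comp (hφc.mono fun _ h ↦ h.1) fun _ h ↦ h.2
    exact ((contMDiff_norm_sq_bundle.comp_contMDiffOn h1).contDiffOn).sub contDiffOn_const
  have hgν : ∀ η ∈ Φ.source, ν.toFun η ∈ φ.source → g (φ (ν.toFun η)) = ‖η.2‖ ^ 2 - 1 := by
    intro η hη hs
    simp only [g]
    rw [φ.left_inv hs, hνΦ hη, Φ.left_inv hη]
  have hyW : φ (ν.toFun ξ) ∈ W := ⟨φ.map_source hys, by
    rw [mem_preimage, φ.left_inv hys]; exact hyt⟩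
  refine exists_halfSpaceChart hW hg hyW ?_ ?_
  · intro h0
    -- differentiate along the radius through `ξ`
    let r : ℝ → R4 := fun s ↦ φ (ν.toFun ⟨ξ.proj, s • ξ.2⟩)
    have hξ1 : (⟨ξ.proj, (1 : ℝ) • ξ.2⟩ : TotalSpace Plane V) = ξ := by rw [one_smul]
    have hsm := contMDiff_smul_fibre ξ
    have hr1 : r 1 = φ (ν.toFun ξ) := by simp only [r, hξ1]
    have hνs : ContMDiffAt 𝓘(ℝ, ℝ) (𝓡 4) ∞ (fun s : ℝ ↦ ν.toFun ⟨ξ.proj, s • ξ.2⟩) 1 :=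
      (ν.isLocalDiffeomorph.contMDiff _).comp 1 (hsm 1)
    have hr : DifferentiableAt ℝ r 1 := by
      have h1 : ContMDiffAt (𝓡 4) (𝓡 4) ∞ φ (ν.toFun ⟨ξ.proj, (1 : ℝ) • ξ.2⟩) := by
        rw [hξ1]
        exact contMDiffOn_chart.contMDiffAt (φ.open_source.mem_nhds hys)
      exact ((h1.comp 1 hνs).contDiffAt).differentiableAt (by simp)
    have hgr : (fun s ↦ g (r s)) =ᶠ[𝓝 1] fun s ↦ s ^ 2 - 1 := by
      have e1 : ∀ᶠ s : ℝ in 𝓝 1, (⟨ξ.proj, s • ξ.2⟩ : TotalSpace Plane V) ∈ Φ.source :=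
        (hsm 1).continuousAt.eventually_mem (by rw [hξ1]; exact Φ.open_source.mem_nhds hΦ)
      have e2 : ∀ᶠ s : ℝ in 𝓝 1, ν.toFun ⟨ξ.proj, s • ξ.2⟩ ∈ φ.source :=
        hνs.continuousAt.eventually_mem (by rw [hξ1]; exact φ.open_source.mem_nhds hys)
      filter_upwards [e1, e2] with s h1 h2
      simp only [r, hgν _ h1 h2, norm_smul, hξ, mul_one, Real.norm_eq_abs, sq_abs]
    have hgd : HasFDerivAt g (0 : R4 →L[ℝ] ℝ) (r 1) := by
      rw [hr1, ← h0]
      exact ((hg.contDiffAt (hW.mem_nhds hyW)).differentiableAt (by simp)).hasFDerivAt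
    have h2 := hgd.comp_hasDerivAt 1 hr.hasDerivAt
    have h3 : HasDerivAt (fun s : ℝ ↦ s ^ 2 - 1) (2 * 1) 1 := by
      simpa using (hasDerivAt_pow 2 (1 : ℝ)).sub_const 1
    have h4 := h3.unique (h2.congr_of_eventuallyEq hgr.symm)
    norm_num at h4
  · filter_upwards [Φ.open_target.mem_nhds hyt, φ.open_source.mem_nhds hys] with x hx hxs
    have hη := Φ.map_target hx
    have hxη : ν.toFun (Φ.toPartialEquiv.symm x) = x := by
      rw [hνΦ hη]; exact Φ.right_inv hx
    have h1 := hgν _ hη (by rwa [hxη])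
    rw [hxη] at h1
    have h2 := ν.mem_exterior_iff (Φ.toPartialEquiv.symm x)
    have h3 := ν.mem_boundary_iff (Φ.toPartialEquiv.symm x)
    rw [hxη] at h2 h3
    have h0 := norm_nonneg (Φ.toPartialEquiv.symm x).2
    rw [h2, h3, h1]
    constructor
    · rw [sub_nonneg, one_le_sq_iff₀ h0]
    · rw [sub_eq_zero, pow_eq_one_iff_of_nonneg h0 two_ne_zero]

theorem exists_halfSpaceChart [T2Space M] {y : M} (hy : y ∈ ν.exterior) :
    ∃ ψ, HalfSpaceChart ν.exterior ν.boundary ψ ∧ y ∈ ψ.source := by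
  have := isContinuousRiemannianBundle (V := V)
  by_cases hB : y ∈ ν.boundary
  · exact ν.exists_halfSpaceChart_of_mem_boundary hB
  · have hD : IsClosed (ν.toFun '' {ξ | ‖ξ.2‖ ≤ 1}) :=
      (isCompact_discBundle.image ν.continuous).isClosed
    have hyD : y ∉ ν.toFun '' {ξ | ‖ξ.2‖ ≤ 1} := by
      rintro ⟨ξ, h, rfl⟩
      rw [mem_exterior_iff] at hy
      exact hB ((ν.mem_boundary_iff ξ).2 (le_antisymm h hy))
    have hn := hD.isOpen_compl.mem_nhds hyD
    refine exists_halfSpaceChart_of_interior (mem_of_superset hn ?_) (mem_of_superset hn ?_)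
    · exact compl_subset_compl.2 (image_mono fun ξ (h : ‖ξ.2‖ < 1) ↦ h.le)
    · exact compl_subset_compl.2 (image_mono fun ξ (h : ‖ξ.2‖ = 1) ↦ h.le)

end TubularNeighborhood

end Bundle

end

/-! ### Homotopy lifting in the circle bundle -/

section

open Set Filter Module Bundle

section Transport

variable {V : Sphere2 → Type*} [TopologicalSpace (Bundle.TotalSpace Plane V)]
  [∀ x, NormedAddCommGroup (V x)] [∀ x, InnerProductSpace ℝ (V x)]
  [FiberBundle Plane V] [VectorBundle ℝ Plane V]

section Continuity

variable {Z : Type*} [TopologicalSpace Z] {b : Z → Sphere2} {z₀ : Z}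

theorem continuousAt_mk_iff (hb : ContinuousAt b z₀) {v : ∀ z, V (b z)} :
    ContinuousAt (fun z ↦ (⟨b z, v z⟩ : TotalSpace Plane V)) z₀ ↔
      ContinuousAt (fun z ↦ (trivializationAt Plane V (b z₀)).continuousLinearMapAt ℝ (b z) (v z))
        z₀ := by
  rw [FiberBundle.continuousAt_totalSpace Plane]
  refine (and_iff_right hb).trans (continuousAt_congr ?_)
  filter_upwards [hb.eventually_mem ((trivializationAt Plane V (b z₀)).open_baseSet.mem_nhds
    (FiberBundle.mem_baseSet_trivializationAt' _))] with z hz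
  rw [Bundle.Trivialization.continuousLinearMapAt_apply, Bundle.Trivialization.coe_linearMapAt_of_mem _ hz]

theorem continuousAt_mk_smul {r : Z → ℝ} (hr : ContinuousAt r z₀) {v : ∀ z, V (b z)}
    (hv : ContinuousAt (fun z ↦ (⟨b z, v z⟩ : TotalSpace Plane V)) z₀) :
    ContinuousAt (fun z ↦ (⟨b z, r z • v z⟩ : TotalSpace Plane V)) z₀ := by
  have hb : ContinuousAt b z₀ := ((FiberBundle.continuousAt_totalSpace Plane _).1 hv).1
  rw [continuousAt_mk_iff hb] at hv ⊢
  simp only [map_smul]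
  exact hr.smul hv

theorem continuousAt_mk_sum {ι : Type*} (t : Finset ι) (hb : ContinuousAt b z₀)
    {v : ι → ∀ z, V (b z)}
    (hv : ∀ i ∈ t, ContinuousAt (fun z ↦ (⟨b z, v i z⟩ : TotalSpace Plane V)) z₀) :
    ContinuousAt (fun z ↦ (⟨b z, ∑ i ∈ t, v i z⟩ : TotalSpace Plane V)) z₀ := by
  rw [continuousAt_mk_iff hb]
  simp only [map_sum]
  exact tendsto_finsetSum _ fun i hi ↦ (continuousAt_mk_iff hb).1 (hv i hi)

end Continuity

/-- A rule transporting unit vectors of a Riemannian plane bundle over the sphere to nearby fibres,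
continuously and without moving the vectors which are transported to their own fibre. -/
theorem exists_transport [IsContinuousRiemannianBundle Plane V] :
    ∃ δ > 0, ∃ T : (z : Sphere2 × TotalSpace Plane V) → V z.1,
      (∀ z, ‖z.2.2‖ = 1 → dist z.1 z.2.proj < δ → ‖T z‖ = 1 ∧
        ContinuousAt (fun z ↦ (⟨z.1, T z⟩ : TotalSpace Plane V)) z) ∧
      ∀ ξ : TotalSpace Plane V, ‖ξ.2‖ = 1 → T (ξ.proj, ξ) = ξ.2 := by
  have hproj : Continuous fun ξ : TotalSpace Plane V ↦ ξ.proj := FiberBundle.continuous_proj Plane V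
  let e : ∀ x : Sphere2, Trivialization Plane (π Plane V) := fun x ↦ trivializationAt Plane V x
  obtain ⟨t, -, ht⟩ := isCompact_univ.elim_nhds_subcover (fun x : Sphere2 ↦ (e x).baseSet)
    fun x _ ↦ (e x).open_baseSet.mem_nhds (FiberBundle.mem_baseSet_trivializationAt' x)
  obtain ⟨ρ, hρ⟩ := PartitionOfUnity.exists_isSubordinate (ι := t) isClosed_univ
    (fun i ↦ (e i).baseSet) (fun i ↦ (e i).open_baseSet) fun x _ ↦ by
      obtain ⟨i, hi, h⟩ := mem_iUnion₂.1 (ht (mem_univ x))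
      exact mem_iUnion.2 ⟨⟨i, hi⟩, h⟩
  -- average the transports in the trivializations, with weights `ρ i (π ξ) * ρ i x`
  let S : (i : t) → (z : Sphere2 × TotalSpace Plane V) → V z.1 := fun i z ↦
    (ρ i z.2.proj * ρ i z.1) • (e i).symm z.1 (e i z.2).2
  let T : (z : Sphere2 × TotalSpace Plane V) → V z.1 := fun z ↦ ∑ i, S i z
  have hSc : ∀ i, Continuous fun z ↦ (⟨z.1, S i z⟩ : TotalSpace Plane V) := by
    intro i
    refine continuous_iff_continuousAt.2 fun z₀ ↦ ?_
    by_cases hz : z₀.1 ∈ tsupport (ρ i) ∧ z₀.2.proj ∈ tsupport (ρ i)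
    · refine continuousAt_mk_smul (b := Prod.fst) (by fun_prop) ?_
      have h1 := hρ i hz.1
      have h2 := hρ i hz.2
      have hev : ∀ᶠ z : Sphere2 × TotalSpace Plane V in 𝓝 z₀, z.1 ∈ (e i).baseSet :=
        continuous_fst.continuousAt.eventually_mem ((e i).open_baseSet.mem_nhds h1)
      have h3 : ContinuousAt (fun z : Sphere2 × TotalSpace Plane V ↦
          (e i).toOpenPartialHomeomorph.symm (z.1, (e i z.2).2)) z₀ := by
        have h4 : ContinuousAt (fun z : Sphere2 × TotalSpace Plane V ↦ (z.1, (e i z.2).2)) z₀ :=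
          continuousAt_fst.prodMk (((e i).continuousAt ((e i).mem_source.2 h2)).comp
            continuousAt_snd).snd
        have h5 : ContinuousAt (e i).toOpenPartialHomeomorph.symm (z₀.1, (e i z₀.2).2) :=
          (e i).toOpenPartialHomeomorph.symm.continuousAt ((e i).mem_target.2 h1)
        exact ContinuousAt.comp (g := (e i).toOpenPartialHomeomorph.symm)
          (f := fun z : Sphere2 × TotalSpace Plane V ↦ (z.1, (e i z.2).2)) h5 h4
      refine h3.congr ?_
      filter_upwards [hev] with z hz'
      exact ((e i).mk_symm hz' _).symm
    · have hev : ∀ᶠ z : Sphere2 × TotalSpace Plane V in 𝓝 z₀, ρ i z.2.proj * ρ i z.1 = 0 := by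
        rcases not_and_or.1 hz with h | h
        · have := notMem_tsupport_iff_eventuallyEq.1 h
          filter_upwards [continuousAt_fst.eventually this] with z hz'
          rw [hz']; simp
        · have := notMem_tsupport_iff_eventuallyEq.1 h
          filter_upwards [(hproj.comp continuous_snd).continuousAt.eventually this] with z hz'
          simp only [Function.comp_apply] at hz'
          rw [hz']; simp
      have h0 : ContinuousAt (fun z : Sphere2 × TotalSpace Plane V ↦
          (⟨z.1, 0⟩ : TotalSpace Plane V)) z₀ := by
        rw [continuousAt_mk_iff (b := Prod.fst) continuousAt_fst]
        simp only [map_zero]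
        exact continuousAt_const
      refine h0.congr ?_
      filter_upwards [hev] with z hz'
      simp only [S, hz', zero_smul]
  have hTc : Continuous fun z ↦ (⟨z.1, T z⟩ : TotalSpace Plane V) :=
    continuous_iff_continuousAt.2 fun z₀ ↦ continuousAt_mk_sum (b := Prod.fst) Finset.univ
      continuousAt_fst fun i _ ↦ (hSc i).continuousAt
  have hTn : Continuous fun z ↦ ‖T z‖ := continuous_norm_bundle.comp hTc
  have hdiag : ∀ ξ : TotalSpace Plane V, ∃ c : ℝ, 0 < c ∧ T (ξ.proj, ξ) = c • ξ.2 := by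
    intro ξ
    refine ⟨∑ i, ρ i ξ.proj * ρ i ξ.proj, ?_, ?_⟩
    · obtain ⟨i, hi⟩ := ρ.exists_pos (mem_univ ξ.proj)
      exact Finset.sum_pos' (fun i _ ↦ mul_self_nonneg _) ⟨i, Finset.mem_univ _, mul_pos hi hi⟩
    · simp only [T, S, Finset.sum_smul]
      refine Finset.sum_congr rfl fun i _ ↦ ?_
      by_cases h : ρ i ξ.proj = 0
      · simp [h]
      · have hb : ξ.proj ∈ (e i).baseSet := hρ i (subset_tsupport _ h)
        exact congrArg _ ((e i).symm_apply_apply_mk hb ξ.2)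
  -- by compactness, `T` does not vanish on unit vectors transported over less than some `δ`
  have hK : IsCompact {z : Sphere2 × TotalSpace Plane V | ‖z.2.2‖ = 1 ∧ T z = 0} := by
    have hcl : IsClosed {z : Sphere2 × TotalSpace Plane V | ‖z.2.2‖ = 1 ∧ T z = 0} := by
      simp only [← norm_eq_zero (a := T _)]
      exact (isClosed_eq (continuous_norm_bundle.comp continuous_snd) continuous_const).inter
        (isClosed_eq hTn continuous_const)
    exact ((isCompact_univ (X := Sphere2)).prod (isCompact_discBundle (V := V))).of_isClosed_subset
      hcl fun z hz ↦ ⟨mem_univ _, hz.1.le⟩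
  obtain ⟨δ, hδ, hKδ⟩ : ∃ δ > 0, ∀ z : Sphere2 × TotalSpace Plane V, ‖z.2.2‖ = 1 → T z = 0 →
      δ ≤ dist z.1 z.2.proj := by
    rcases eq_empty_or_nonempty {z : Sphere2 × TotalSpace Plane V | ‖z.2.2‖ = 1 ∧ T z = 0} with h | h
    · exact ⟨1, one_pos, fun z h1 h2 ↦ ((h ▸ ⟨h1, h2⟩ : z ∈ (∅ : Set _))).elim⟩
    · obtain ⟨z, hz, hmin⟩ := hK.exists_isMinOn h
        (f := fun z : Sphere2 × TotalSpace Plane V ↦ dist z.1 z.2.proj)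
        (continuous_fst.dist (hproj.comp continuous_snd)).continuousOn
      refine ⟨_, dist_pos.2 fun h0 ↦ ?_, fun w h1 h2 ↦ hmin ⟨h1, h2⟩⟩
      obtain ⟨c, hc, hcz⟩ := hdiag z.2
      have h3 : T (z.2.proj, z.2) = 0 := by
        obtain ⟨z1, z2⟩ := z
        simp only at h0
        subst h0
        exact hz.2
      rw [h3] at hcz
      have h4 : z.2.2 = 0 := (smul_eq_zero.1 hcz.symm).resolve_left hc.ne'
      have := hz.1
      rw [h4, norm_zero] at this
      exact zero_ne_one this
  refine ⟨δ, hδ, fun z ↦ ‖T z‖⁻¹ • T z, fun z h1 h2 ↦ ?_, fun ξ hξ ↦ ?_⟩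
  · have hT : ‖T z‖ ≠ 0 := fun h ↦ (hKδ z h1 (norm_eq_zero.1 h)).not_gt h2
    refine ⟨by rw [norm_smul, norm_inv, norm_norm, inv_mul_cancel₀ hT], ?_⟩
    exact continuousAt_mk_smul (b := Prod.fst) (hTn.continuousAt.inv₀ hT) hTc.continuousAt
  · obtain ⟨c, hc, h⟩ := hdiag ξ
    simp only [h, norm_smul, hξ, mul_one, Real.norm_of_nonneg hc.le]
    rw [smul_smul, inv_mul_cancel₀ hc.ne', one_smul]

/-- Homotopy lifting for the unit circle bundle of a Riemannian plane bundle over the sphere. The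
lift is stationary wherever the given homotopy is. -/
theorem exists_lift [IsContinuousRiemannianBundle Plane V] {Y : Type*} [TopologicalSpace Y]
    [CompactSpace Y] (D : C(I × Y, Sphere2)) (g : C(Y, TotalSpace Plane V))
    (hg : ∀ y, ‖(g y).2‖ = 1) (hgD : ∀ y, (g y).proj = D (0, y)) :
    ∃ L : C(I × Y, TotalSpace Plane V), (∀ z, ‖(L z).2‖ = 1) ∧ (∀ z, (L z).proj = D z) ∧
      (∀ y, L (0, y) = g y) ∧ ∀ y, (∀ s, D (s, y) = D (0, y)) → ∀ s, L (s, y) = g y := by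
  obtain ⟨δ, hδ, T, hT, hTdiag⟩ := exists_transport (V := V)
  have hu := CompactSpace.uniformContinuous_of_continuous D.curry.continuous
  obtain ⟨ε, hε, hDε⟩ := Metric.uniformContinuous_iff.1 hu δ hδ
  obtain ⟨n, hn⟩ := exists_nat_one_div_lt hε
  -- lift the homotopy stopped at time `k / (n + 1)`, by induction on `k`
  let c : ℕ → C(I, I) := fun k ↦ ⟨fun s ↦ projIcc 0 1 zero_le_one (min (s : ℝ) (k / (n + 1))),
    continuous_projIcc.comp (by fun_prop)⟩
  have hcv : ∀ k s, ((c k s : I) : ℝ) = min (s : ℝ) (k / (n + 1)) := fun k s ↦ by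
    have h : min (s : ℝ) (k / (n + 1)) ∈ Icc (0 : ℝ) 1 :=
      ⟨le_min s.2.1 (by positivity), (min_le_left _ _).trans s.2.2⟩
    simp only [c, ContinuousMap.coe_mk, projIcc_of_mem _ h]
  have hc0 : ∀ k, c k 0 = 0 := fun k ↦ Subtype.ext (by
    rw [hcv]; exact min_eq_left (by positivity))
  have key : ∀ k, ∃ L : C(I × Y, TotalSpace Plane V), (∀ z, ‖(L z).2‖ = 1) ∧
      (∀ z, (L z).proj = D (c k z.1, z.2)) ∧
      (∀ y, L (0, y) = g y) ∧ ∀ y, (∀ s, D (s, y) = D (0, y)) → ∀ s, L (s, y) = g y := by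
    intro k
    induction k with
    | zero =>
      refine ⟨g.comp ⟨Prod.snd, continuous_snd⟩, fun z ↦ hg _, fun z ↦ ?_, fun y ↦ rfl,
        fun y _ s ↦ rfl⟩
      have : c 0 z.1 = 0 := Subtype.ext (by rw [hcv]; simp [z.1.2.1])
      rw [this]
      exact hgD z.2
    | succ k ih =>
      obtain ⟨L, h1, h2, h3, h4⟩ := ih
      have hd : ∀ z : I × Y, dist (D (c (k + 1) z.1, z.2)) (L z).proj < δ := by
        intro z
        rw [h2]
        refine (ContinuousMap.dist_apply_le_dist (f := D.curry (c (k + 1) z.1))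
          (g := D.curry (c k z.1)) z.2).trans_lt (hDε ?_)
        rw [Subtype.dist_eq, hcv, hcv, Real.dist_eq]
        refine lt_of_le_of_lt ?_ hn
        refine (abs_min_sub_min_le_max _ _ _ _).trans ?_
        rw [sub_self, abs_zero, ← sub_div]
        push_cast
        rw [add_sub_cancel_left, abs_of_pos (by positivity)]
        exact max_le (by positivity) le_rfl
      let A : I × Y → Sphere2 × TotalSpace Plane V := fun z ↦ (D (c (k + 1) z.1, z.2), L z)
      have hA : Continuous A := by fun_prop
      have hdiag : ∀ z, D (c (k + 1) z.1, z.2) = (L z).proj →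
          (⟨(A z).1, T (A z)⟩ : TotalSpace Plane V) = L z := by
        intro z hz
        have : A z = ((L z).proj, L z) := Prod.ext hz rfl
        rw [this, hTdiag _ (h1 z)]
      refine ⟨⟨fun z ↦ ⟨(A z).1, T (A z)⟩, continuous_iff_continuousAt.2 fun z ↦ ?_⟩, fun z ↦ ?_,
        fun z ↦ rfl, fun y ↦ ?_, fun y hy s ↦ ?_⟩
      · exact ContinuousAt.comp (g := fun z ↦ (⟨z.1, T z⟩ : TotalSpace Plane V)) (f := A)
          (hT (A z) (h1 z) (hd z)).2 hA.continuousAt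
      · exact (hT (A z) (h1 z) (hd z)).1
      · exact (hdiag (0, y) (by rw [h2, hc0, hc0])).trans (h3 y)
      · exact (hdiag (s, y) ((hy _).trans ((h2 _).trans (hy _)).symm)).trans (h4 y hy s)
  obtain ⟨L, h1, h2, h3, h4⟩ := key (n + 1)
  refine ⟨L, h1, fun z ↦ ?_, h3, h4⟩
  have : c (n + 1) z.1 = z.1 := Subtype.ext (by
    rw [hcv]; push_cast; rw [div_self (by positivity)]; exact min_eq_left z.1.2.2)
  rw [h2, this]

end Transport

end

/-! ### The two-sphere is simply connected -/

section

open Set Filter Module Bundle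

section Sphere

/-- A continuous curve in a Euclidean space is uniformly close to a smooth one with the same end
points. -/
theorem exists_contDiff_near {n : ℕ} (γ : C(I, EuclideanSpace ℝ (Fin n))) {ε : ℝ} (hε : 0 < ε) :
    ∃ q : ℝ → EuclideanSpace ℝ (Fin n), ContDiff ℝ 1 q ∧ q 0 = γ 0 ∧ q 1 = γ 1 ∧
      ∀ t : I, ‖q t - γ t‖ < ε := by
  have h : ∀ i, ∃ p : Polynomial ℝ, ∀ t : I, |p.eval (t : ℝ) - γ t i| < ε / (2 * (n + 1)) := by
    intro i
    obtain ⟨p, hp⟩ := exists_polynomial_near_continuousMap 0 1 ⟨fun t ↦ γ t i, by fun_prop⟩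
      (ε / (2 * (n + 1))) (by positivity)
    refine ⟨p, fun t ↦ ?_⟩
    have := (ContinuousMap.norm_coe_le_norm _ t).trans_lt hp
    simpa using this
  choose p hp using h
  -- correct the end points by an affine function
  let q : ℝ → EuclideanSpace ℝ (Fin n) := fun t ↦ WithLp.toLp 2 fun i ↦
    (p i).eval t + (1 - t) * (γ 0 i - (p i).eval 0) + t * (γ 1 i - (p i).eval 1)
  have hqi : ∀ t i, q t i =
    (p i).eval t + (1 - t) * (γ 0 i - (p i).eval 0) + t * (γ 1 i - (p i).eval 1) := fun t i ↦ rfl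
  refine ⟨q, ?_, ?_, ?_, fun t ↦ ?_⟩
  · refine contDiff_euclidean.2 fun i ↦ ?_
    simp only [hqi]
    have : ContDiff ℝ 1 fun t ↦ (p i).eval t := by simpa using (p i).contDiff_aeval (𝕜 := ℝ) 1
    fun_prop
  · ext i; rw [hqi]; ring
  · ext i; rw [hqi]; ring
  · have hi : ∀ i, |(q t - γ t) i| ≤ ε / (n + 1) := by
      intro i
      have h0 := hp i 0
      have h1 := hp i 1
      have ht := hp i t
      rw [PiLp.sub_apply, hqi]
      simp only [Icc.coe_zero, Icc.coe_one] at h0 h1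
      have hsum : ε / (n + 1) = ε / (2 * (n + 1)) + ε / (2 * (n + 1)) := by
        field_simp; norm_num
      rw [abs_lt] at h0 h1 ht
      rw [hsum, abs_le]
      have t0 := t.2.1
      have t1 := t.2.2
      constructor <;> nlinarith
    calc ‖q t - γ t‖ ≤ ∑ i, |(q t - γ t) i| := by
          rw [EuclideanSpace.norm_eq]
          refine Real.sqrt_le_iff.2 ⟨Finset.sum_nonneg fun i _ ↦ abs_nonneg _, ?_⟩
          exact Finset.sum_sq_le_sq_sum_of_nonneg fun i _ ↦ abs_nonneg _
      _ ≤ ∑ _i : Fin n, ε / (n + 1) := Finset.sum_le_sum fun i _ ↦ hi i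
      _ = ε * (n / (n + 1)) := by
          rw [Finset.sum_const, Finset.card_univ, Fintype.card_fin, nsmul_eq_mul]; ring
      _ < ε * 1 := by
          gcongr
          rw [div_lt_one (by positivity)]
          linarith
      _ = ε := mul_one ε

/-- Radial projection to the unit sphere. -/
def radialProjection (v : EuclideanSpace ℝ (Fin 3)) (hv : v ≠ 0) : Sphere2 :=
  ⟨‖v‖⁻¹ • v, by
    rw [mem_sphere_zero_iff_norm, norm_smul, norm_inv, norm_norm,
      inv_mul_cancel₀ (norm_ne_zero_iff.2 hv)]⟩

theorem radialProjection_coe (x : Sphere2) (h : (x : EuclideanSpace ℝ (Fin 3)) ≠ 0) :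
    radialProjection x h = x :=
  Subtype.ext (by simp [radialProjection])

theorem continuous_radialProjection {Z : Type*} [TopologicalSpace Z]
    {v : Z → EuclideanSpace ℝ (Fin 3)} (hv : Continuous v) (h : ∀ z, v z ≠ 0) :
    Continuous fun z ↦ radialProjection (v z) (h z) :=
  Continuous.subtype_mk ((hv.norm.inv₀ fun z ↦ norm_ne_zero_iff.2 (h z)).smul hv) _

/-- The sphere is simply connected: a loop is homotopic to a smooth one, which misses a point for
reasons of dimension, and the complement of a point is contractible. -/
theorem Sphere2.homotopic_refl {x : Sphere2} (γ : Path x x) : γ.Homotopic (Path.refl x) := by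
  obtain ⟨q, hq, hq0, hq1, hqγ⟩ := exists_contDiff_near
    (⟨fun t ↦ (γ t : EuclideanSpace ℝ (Fin 3)), by fun_prop⟩) one_pos
  simp only [ContinuousMap.coe_mk, γ.source, γ.target] at hq0 hq1 hqγ
  have hn : ∀ y : Sphere2, ‖(y : EuclideanSpace ℝ (Fin 3))‖ = 1 := fun y ↦ by simp
  have hne : ∀ z : I × I, (γ z.2 : EuclideanSpace ℝ (Fin 3)) +
      (z.1 : ℝ) • (q z.2 - γ z.2) ≠ 0 := by
    intro z hz
    have h1 : ‖(z.1 : ℝ) • (q z.2 - γ z.2)‖ = 1 := by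
      rw [← norm_neg, ← eq_neg_of_add_eq_zero_left hz, hn]
    rw [norm_smul, Real.norm_of_nonneg z.1.2.1] at h1
    have := hqγ z.2
    nlinarith [z.1.2.2, z.1.2.1, norm_nonneg (q z.2 - γ z.2)]
  have hq0' : ∀ t : I, q t ≠ 0 := fun t ↦ by simpa using hne (1, t)
  have hx0 : (x : EuclideanSpace ℝ (Fin 3)) ≠ 0 := norm_ne_zero_iff.1 (by simp)
  let γ' : Path x x :=
    { toFun := fun t ↦ radialProjection (q t) (hq0' t)
      continuous_toFun := continuous_radialProjection
        (hq.continuous.comp continuous_subtype_val) _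
      source' := by
        simp only [Icc.coe_zero, hq0, radialProjection_coe]
      target' := by
        simp only [Icc.coe_one, hq1, radialProjection_coe] }
  have h1 : γ.Homotopic γ' := by
    refine ⟨⟨⟨⟨fun z ↦ radialProjection _ (hne z), continuous_radialProjection ?_ _⟩,
      fun t ↦ ?_, fun t ↦ ?_⟩, ?_⟩⟩
    · have := hq.continuous
      fun_prop
    · simp [radialProjection_coe]
    · simp [γ']
    · rintro s t (rfl | ht)
      · simp [hq0, radialProjection_coe]
      · rw [mem_singleton_iff] at ht
        subst ht
        simp [hq1, radialProjection_coe]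
  -- a direction which the smooth curve misses
  obtain ⟨w, hw⟩ : ∃ w, w ∉ range fun z : ℝ × ℝ ↦ z.1 • q z.2 := by
    have hc : ContDiff ℝ 1 fun z : ℝ × ℝ ↦ z.1 • q z.2 := by fun_prop
    exact (hc.dense_compl_range_of_finrank_lt_finrank (by simp)).nonempty
  have hw0 : w ≠ 0 := fun h ↦ hw ⟨(0, 0), by simp [h]⟩
  let v := radialProjection w hw0
  have hv : ∀ t, γ' t ≠ v := by
    intro t ht
    have h2 : ‖q t‖⁻¹ • q t = ‖w‖⁻¹ • w := congrArg Subtype.val ht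
    refine hw ⟨(‖w‖ * ‖q t‖⁻¹, t), ?_⟩
    simp only
    rw [mul_smul, h2, smul_inv_smul₀ (norm_ne_zero_iff.2 hw0)]
  have : Fact (finrank ℝ (EuclideanSpace ℝ (Fin 3)) = 2 + 1) := ⟨by simp⟩
  let φ := stereographic' 2 v
  have hs : ∀ t, γ' t ∈ φ.source := fun t ↦ by
    rw [stereographic'_source]; exact hv t
  have hxs : x ∈ φ.source := by simpa using hs 0
  have hφ' : Continuous φ.symm := by
    rw [← continuousOn_univ, ← stereographic'_target v]
    exact φ.continuousOn_symm
  have hφγ : Continuous fun t ↦ φ (γ' t) :=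
    continuous_iff_continuousAt.2 fun t ↦ ContinuousAt.comp (g := φ) (f := γ')
      (φ.continuousAt (hs t)) γ'.continuous.continuousAt
  refine h1.trans ⟨⟨⟨⟨fun z ↦ φ.symm ((1 - (z.1 : ℝ)) • φ (γ' z.2) + (z.1 : ℝ) • φ x), ?_⟩,
      fun t ↦ ?_, fun t ↦ ?_⟩, ?_⟩⟩
  · exact hφ'.comp (((by fun_prop : Continuous fun z : I × I ↦ 1 - (z.1 : ℝ)).smul
      (hφγ.comp continuous_snd)).add (by fun_prop))
  · simpa using φ.left_inv (hs t)
  · simpa using φ.left_inv hxs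
  · have : ∀ (s : I), (1 - (s : ℝ)) • φ x + (s : ℝ) • φ x = φ x := fun s ↦ by
      rw [← add_smul]; simp
    rintro s t (rfl | ht)
    · simp [this, φ.left_inv hxs]
    · rw [mem_singleton_iff] at ht
      subst ht
      simp [this, φ.left_inv hxs]

theorem Sphere2.joined (x y : Sphere2) : Joined x y := by
  have h : IsPathConnected (Metric.sphere (0 : EuclideanSpace ℝ (Fin 3)) 1) :=
    isPathConnected_sphere (by
      rw [← finrank_eq_rank]; norm_num) 0 zero_le_one
  have := isPathConnected_iff_pathConnectedSpace.1 h
  exact PathConnectedSpace.joined x y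

end Sphere

end

/-! ### Loops in the boundary of the exterior -/

section

open Set Filter Module Bundle Topology

/-- Paths which lift to curves in `ℝ` with common end points are homotopic. -/
theorem homotopic_of_real_lift {X : Type*} [TopologicalSpace X] (e : C(ℝ, X)) {y z : X}
    {p q : Path y z} (u w : C(I, ℝ)) (hp : ∀ t, p t = e (u t)) (hq : ∀ t, q t = e (w t))
    (h0 : u 0 = w 0) (h1 : u 1 = w 1) : p.Homotopic q := by
  refine ⟨⟨⟨⟨fun z ↦ e ((1 - (z.1 : ℝ)) * u z.2 + z.1 * w z.2), by fun_prop⟩,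
    fun t ↦ ?_, fun t ↦ ?_⟩, ?_⟩⟩
  · simp [hp]
  · simp [hq]
  · rintro s t (rfl | ht)
    · simp [hp, ← h0, ← add_mul]
    · rw [mem_singleton_iff] at ht
      subst ht
      simp [hp, ← h1, ← add_mul]

theorem exists_continuousMap_fibre {V : Sphere2 → Type*} [TopologicalSpace (TotalSpace Plane V)]
    [∀ x, TopologicalSpace (V x)] [FiberBundle Plane V] {x : Sphere2} {Y : Type*}
    [TopologicalSpace Y] (g : C(Y, TotalSpace Plane V))
    (hg : ∀ y, (g y).proj = x) : ∃ v : C(Y, V x), ∀ y, g y = ⟨x, v y⟩ := by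
  have h : ∀ y, ∃ v : V x, g y = ⟨x, v⟩ := fun y ↦ by
    have := hg y
    rcases hgy : g y with ⟨x', v⟩
    rw [hgy] at this
    subst this
    exact ⟨v, rfl⟩
  choose v hv using h
  refine ⟨⟨v, (FiberBundle.totalSpaceMk_isInducing Plane V x).continuous_iff.2 ?_⟩, hv⟩
  exact g.continuous.congr hv

section CircleBundle

variable {M : Type*} [TopologicalSpace M] [ChartedSpace (EuclideanSpace ℝ (Fin 4)) M]
  {V : Sphere2 → Type*} [TopologicalSpace (Bundle.TotalSpace Plane V)]
  [∀ x, NormedAddCommGroup (V x)] [∀ x, InnerProductSpace ℝ (V x)]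
  [FiberBundle Plane V] [VectorBundle ℝ Plane V]
  {f : Sphere2 → M} (ν : TubularNeighborhood f V)

/-- An orthonormal pair in a fibre of a plane bundle is a basis. -/
theorem eq_inner_smul_add {x : Sphere2} {a b : V x} (ha : ‖a‖ = 1) (hb : ‖b‖ = 1)
    (hab : inner ℝ a b = 0) (v : V x) : v = inner ℝ a v • a + inner ℝ b v • b := by
  have hfr : finrank ℝ (V x) = 2 := by
    rw [((trivializationAt Plane V x).continuousLinearEquivAt ℝ x
      (FiberBundle.mem_baseSet_trivializationAt' x)).toLinearEquiv.finrank_eq]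
    simp
  have hon : Orthonormal ℝ ![a, b] := by
    rw [orthonormal_vecCons_iff]
    simp [ha, hb, hab]
  have hsp := hon.linearIndependent.span_eq_top_of_card_eq_finrank (by simp [hfr])
  have := (OrthonormalBasis.mk hon hsp.ge).sum_repr' v
  simpa [Fin.sum_univ_two] using this.symm

namespace TubularNeighborhood

theorem isOpenEmbedding : IsOpenEmbedding ν.toFun :=
  ν.isLocalDiffeomorph.isLocalHomeomorph.isOpenEmbedding_of_injective ν.injective

variable {x : Sphere2} {a b : V x} (ha : ‖a‖ = 1) (hb : ‖b‖ = 1) (hab : inner ℝ a b = 0)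

/-- The line, wrapped around the unit circle of a fibre. -/
def fibreCircle : C(ℝ, ν.exterior) where
  toFun θ := ν.boundaryPoint (Real.cos θ • a + Real.sin θ • b) (norm_circle ha hb hab θ)
  continuous_toFun := by
    refine Continuous.subtype_mk (ν.continuous.comp ?_) _
    refine (FiberBundle.continuous_totalSpaceMk Plane V x).comp ?_
    fun_prop

theorem fibreCircle_mem_boundary (θ : ℝ) : (ν.fibreCircle ha hb hab θ : M) ∈ ν.boundary :=
  ⟨_, norm_circle ha hb hab θ, rfl⟩

theorem fibreCircle_zero : ν.fibreCircle ha hb hab 0 = ν.boundaryPoint a ha :=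
  Subtype.ext (congrArg ν.toFun (by simp))

theorem fibreCircle_add_int (θ : ℝ) (k : ℤ) :
    ν.fibreCircle ha hb hab (θ + k * (2 * Real.pi)) = ν.fibreCircle ha hb hab θ :=
  Subtype.ext (congrArg ν.toFun (by rw [Real.cos_add_int_mul_two_pi, Real.sin_add_int_mul_two_pi]))

/-- The unit circle of a fibre, travelled `k` times. -/
def meridianPow (k : ℤ) : Path (ν.boundaryPoint a ha) (ν.boundaryPoint a ha) where
  toFun t := ν.fibreCircle ha hb hab (t * (k * (2 * Real.pi)))
  continuous_toFun := by fun_prop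
  source' := by simpa using ν.fibreCircle_zero ha hb hab
  target' := by simpa [fibreCircle_zero] using ν.fibreCircle_add_int ha hb hab 0 k

/-- The class of the circle travelled `k` times. -/
def meridianPowClass (k : ℤ) : FundamentalGroup ν.exterior (ν.boundaryPoint a ha) :=
  FundamentalGroup.fromPath (Path.Homotopic.Quotient.mk (ν.meridianPow ha hb hab k))

theorem meridianPowClass_add (k l : ℤ) : ν.meridianPowClass ha hb hab (k + l) =
    ν.meridianPowClass ha hb hab k * ν.meridianPowClass ha hb hab l := by
  rw [FundamentalGroup.mul_def]
  refine (Path.Homotopic.Quotient.eq.2 ?_ :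
    Path.Homotopic.Quotient.mk _ = Path.Homotopic.Quotient.mk
      ((ν.meridianPow ha hb hab l).trans (ν.meridianPow ha hb hab k)))
  refine homotopic_of_real_lift (ν.fibreCircle ha hb hab)
    ⟨fun t : I ↦ (t : ℝ) * ((k + l : ℤ) * (2 * Real.pi)), by fun_prop⟩
    ⟨fun t : I ↦ max (2 * (t : ℝ) - 1) 0 * (k * (2 * Real.pi)) +
      min (2 * (t : ℝ)) 1 * (l * (2 * Real.pi)), by fun_prop⟩ (fun t ↦ rfl) (fun t ↦ ?_) ?_ ?_
  · rw [Path.trans_apply]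
    split_ifs with ht
    · have h1 : min (2 * (t : ℝ)) 1 = 2 * t := min_eq_left (by linarith)
      have h2 : max (2 * (t : ℝ) - 1) 0 = 0 := max_eq_right (by linarith)
      simp [meridianPow, h1, h2]
    · have h1 : min (2 * (t : ℝ)) 1 = 1 := min_eq_right (by linarith)
      have h2 : max (2 * (t : ℝ) - 1) 0 = 2 * t - 1 := max_eq_left (by linarith)
      simp only [ContinuousMap.coe_mk, h1, h2, one_mul, fibreCircle_add_int]
      rfl
  · simp
  · norm_num
    ring

theorem meridianPowClass_eq (k : ℤ) :
    ν.meridianPowClass ha hb hab k = ν.meridian ha hb hab ^ k := by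
  let φ : Multiplicative ℤ →* FundamentalGroup ν.exterior (ν.boundaryPoint a ha) :=
    MonoidHom.mk' (fun k ↦ ν.meridianPowClass ha hb hab k.toAdd)
      fun k l ↦ ν.meridianPowClass_add ha hb hab _ _
  have h1 : φ (Multiplicative.ofAdd 1) = ν.meridian ha hb hab := by
    refine congrArg (fun p ↦ FundamentalGroup.fromPath (Path.Homotopic.Quotient.mk p)) ?_
    refine Path.ext (funext fun t ↦ ?_)
    change ν.fibreCircle ha hb hab (t * ((1 : ℤ) * (2 * Real.pi))) =
      ν.fibreCircle ha hb hab (2 * Real.pi * t)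
    rw [Int.cast_one, one_mul, mul_comm]
  rw [← h1, ← map_zpow]
  simp [φ, ← ofAdd_zsmul]

include ha hb hab in
theorem inner_sq_add_inner_sq (v : V x) :
    inner ℝ a v ^ 2 + inner ℝ b v ^ 2 = ‖v‖ ^ 2 := by
  have h := congrArg (fun w ↦ inner ℝ w v) (eq_inner_smul_add ha hb hab v)
  simp only [real_inner_self_eq_norm_sq, inner_add_left, inner_smul_left] at h
  rw [h]
  simp
  ring

include ha hb hab in
/-- Along a curve of unit vectors in a fibre, the angle from `a` can be chosen continuously. -/
theorem exists_angle (v : C(I, V x)) (hv : ∀ t, ‖v t‖ = 1) (hv0 : v 0 = a) :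
    ∃ θ : C(I, ℝ), θ 0 = 0 ∧ ∀ t, v t = Real.cos (θ t) • a + Real.sin (θ t) • b := by
  let z : C(I, Circle) := ⟨fun t ↦ ⟨(inner ℝ a (v t) : ℝ) + (inner ℝ b (v t) : ℝ) * Complex.I,
    mem_sphere_zero_iff_norm.2 (by
      rw [Complex.norm_add_mul_I, inner_sq_add_inner_sq ha hb hab, hv, one_pow, Real.sqrt_one])⟩,
    Continuous.subtype_mk (by fun_prop) _⟩
  have hz : ∀ t, (z t : ℂ) = (inner ℝ a (v t) : ℝ) + (inner ℝ b (v t) : ℝ) * Complex.I :=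
    fun t ↦ rfl
  obtain ⟨Γ, hΓ, hΓ0⟩ := Circle.isCoveringMap_exp.exists_path_lifts z 0 (by
    refine Circle.ext ?_
    rw [hz, hv0, real_inner_self_eq_norm_sq, ha, real_inner_comm, hab]
    simp)
  refine ⟨Γ, hΓ0, fun t ↦ ?_⟩
  have h : (Circle.exp (Γ t) : ℂ) = _ := (congrArg _ (congrFun hΓ t)).trans (hz t)
  have h1 : Real.cos (Γ t) = inner ℝ a (v t) := by
    simpa [Complex.exp_ofReal_mul_I_re] using congrArg Complex.re h
  have h2 : Real.sin (Γ t) = inner ℝ b (v t) := by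
    simpa [Complex.exp_ofReal_mul_I_im] using congrArg Complex.im h
  rw [h1, h2]
  exact eq_inner_smul_add ha hb hab _

section

variable [IsContinuousRiemannianBundle Plane V]

/-- A loop in the boundary of the exterior is homotopic, in the exterior, to a power of the
meridian. Its projection to the sphere is null-homotopic, and the null-homotopy lifts to a homotopy
into the circle over the base point. -/
theorem mem_zpowers_of_mem_boundary
    (p : Path (ν.boundaryPoint a ha) (ν.boundaryPoint a ha)) (hp : ∀ t, (p t : M) ∈ ν.boundary) :
    FundamentalGroup.fromPath (Path.Homotopic.Quotient.mk p) ∈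
      Subgroup.zpowers (ν.meridian ha hb hab) := by
  choose g hg1 hgp using hp
  replace hg1 : ∀ t, ‖(g t).2‖ = 1 := hg1
  have hgc : Continuous g := by
    rw [ν.isOpenEmbedding.continuous_iff]
    exact (continuous_subtype_val.comp p.continuous).congr fun t ↦ (hgp t).symm
  have hg0 : g 0 = ⟨x, a⟩ := ν.injective ((hgp 0).trans (congrArg Subtype.val p.source))
  have hg1' : g 1 = ⟨x, a⟩ := ν.injective ((hgp 1).trans (congrArg Subtype.val p.target))
  let γ : Path x x :=
    { toFun := fun t ↦ (g t).proj
      continuous_toFun := (FiberBundle.continuous_proj Plane V).comp hgc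
      source' := by rw [hg0]
      target' := by rw [hg1'] }
  obtain ⟨F⟩ := Sphere2.homotopic_refl γ
  obtain ⟨L, hL1, hLF, hL0, hLc⟩ := exists_lift ⟨fun z ↦ F z, by fun_prop⟩ ⟨g, hgc⟩ hg1
    fun y ↦ (F.apply_zero y).symm
  obtain ⟨v, hv⟩ := exists_continuousMap_fibre (x := x) (L.comp ⟨fun t ↦ (1, t), by fun_prop⟩)
    fun t ↦ (hLF (1, t)).trans (F.apply_one t)
  simp only [ContinuousMap.comp_apply, ContinuousMap.coe_mk] at hv
  have hc0 : ∀ s, L (s, 0) = ⟨x, a⟩ := fun s ↦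
    (hLc 0 (fun s ↦ (F.source s).trans (F.source 0).symm) s).trans hg0
  have hc1 : ∀ s, L (s, 1) = ⟨x, a⟩ := fun s ↦
    (hLc 1 (fun s ↦ (F.target s).trans (F.target 0).symm) s).trans hg1'
  have hmk : ∀ {w w' : V x}, (⟨x, w⟩ : TotalSpace Plane V) = ⟨x, w'⟩ → w = w' :=
    fun h ↦ TotalSpace.mk_injective x h
  have hv1 : ∀ t, ‖v t‖ = 1 := fun t ↦ by
    have := hL1 (1, t)
    rwa [hv t] at this
  obtain ⟨θ, hθ0, hθ⟩ := exists_angle ha hb hab v hv1 (hmk ((hv 0).symm.trans (hc0 1)))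
  obtain ⟨k, hk⟩ : ∃ k : ℤ, k * (2 * Real.pi) = θ 1 := by
    rw [← Real.cos_eq_one_iff]
    have h := hθ 1
    rw [hmk ((hv 1).symm.trans (hc1 1))] at h
    have := congrArg (fun w ↦ inner ℝ a w) h
    simp only [inner_add_right, inner_smul_right, real_inner_self_eq_norm_sq, ha, hab] at this
    linarith
  refine ⟨k, ?_⟩
  simp only
  rw [← meridianPowClass_eq]
  refine Path.Homotopic.Quotient.eq.2 (Path.Homotopic.symm ?_)
  let p' : Path (ν.boundaryPoint a ha) (ν.boundaryPoint a ha) :=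
    { toFun := fun t ↦ ν.fibreCircle ha hb hab (θ t)
      continuous_toFun := by fun_prop
      source' := by rw [hθ0, fibreCircle_zero]
      target' := by
        rw [← hk, ← zero_add (_ * _), fibreCircle_add_int, fibreCircle_zero] }
  have h1 : p.Homotopic p' := by
    have hmem : ∀ z, ν.toFun (L z) ∈ ν.exterior := fun z ↦
      ν.boundary_subset_exterior ⟨L z, hL1 z, rfl⟩
    refine ⟨⟨⟨⟨fun z ↦ ⟨ν.toFun (L z), hmem z⟩,
      (ν.continuous.comp L.continuous).subtype_mk _⟩, fun t ↦ ?_, fun t ↦ ?_⟩, ?_⟩⟩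
    · exact Subtype.ext ((congrArg ν.toFun (hL0 t)).trans (hgp t))
    · refine Subtype.ext (congrArg ν.toFun ((hv t).trans ?_))
      rw [hθ t]
    · rintro s t (rfl | ht)
      · exact Subtype.ext ((congrArg ν.toFun ((hc0 s).trans hg0.symm)).trans (hgp 0))
      · rw [mem_singleton_iff] at ht
        subst ht
        exact Subtype.ext ((congrArg ν.toFun ((hc1 s).trans hg1'.symm)).trans (hgp 1))
  exact h1.trans (homotopic_of_real_lift (ν.fibreCircle ha hb hab) θ
    ⟨fun t : I ↦ (t : ℝ) * (k * (2 * Real.pi)), by fun_prop⟩ (fun t ↦ rfl) (fun t ↦ rfl)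
    (by simp [hθ0]) (by simp [hk]))

include hb hab in
/-- Any point of the boundary of the exterior is joined to the base point inside the boundary. -/
theorem exists_path_boundary (y : ν.exterior) (hy : (y : M) ∈ ν.boundary) :
    ∃ p : Path (ν.boundaryPoint a ha) y, ∀ t, (p t : M) ∈ ν.boundary := by
  -- lift a path in the sphere from `ξ` into the fibre over `x`, and go round the circle there
  suffices h : JoinedIn ν.boundary (ν.boundaryPoint a ha : M) (y : M) by
    obtain ⟨p, hp⟩ := h
    exact ⟨⟨⟨fun t ↦ ⟨p t, ν.boundary_subset_exterior (hp t)⟩, p.continuous.subtype_mk _⟩,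
      Subtype.ext p.source, Subtype.ext p.target⟩, hp⟩
  obtain ⟨ξ, hξ, hξy⟩ := hy
  replace hξ : ‖ξ.2‖ = 1 := hξ
  obtain ⟨δ⟩ := Sphere2.joined ξ.proj x
  obtain ⟨L, hL1, hLδ, hL0, -⟩ := exists_lift (Y := Unit) ⟨fun z ↦ δ z.1, by fun_prop⟩
    ⟨fun _ ↦ ξ, continuous_const⟩ (fun _ ↦ hξ) fun _ ↦ δ.source.symm
  obtain ⟨v, hv⟩ := exists_continuousMap_fibre (x := x) (L.comp ⟨fun t ↦ (1, t), by fun_prop⟩)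
    fun t ↦ (hLδ (1, t)).trans δ.target
  obtain ⟨w, hw⟩ : ∃ w : V x, L (1, ()) = ⟨x, w⟩ := ⟨v (), hv ()⟩
  have hw1 : ‖w‖ = 1 := by
    have := hL1 (1, ())
    rwa [hw] at this
  obtain ⟨θ, hθ⟩ : ∃ θ : ℝ, w = Real.cos θ • a + Real.sin θ • b := by
    let z : ℂ := (inner ℝ a w : ℝ) + (inner ℝ b w : ℝ) * Complex.I
    have hz : ‖z‖ = 1 := by
      rw [Complex.norm_add_mul_I, inner_sq_add_inner_sq ha hb hab, hw1, one_pow, Real.sqrt_one]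
    have h := Complex.norm_mul_exp_arg_mul_I z
    rw [hz, Complex.ofReal_one, one_mul] at h
    refine ⟨z.arg, ?_⟩
    rw [← Complex.exp_ofReal_mul_I_re, ← Complex.exp_ofReal_mul_I_im, h]
    simpa [z] using eq_inner_smul_add ha hb hab w
  refine JoinedIn.trans (y := ν.toFun ⟨x, w⟩) ?_ (JoinedIn.symm ?_)
  · refine ⟨⟨⟨fun t : I ↦ (ν.fibreCircle ha hb hab (t * θ) : M),
      continuous_subtype_val.comp (by fun_prop)⟩, ?_, ?_⟩,
      fun t ↦ ν.fibreCircle_mem_boundary ha hb hab _⟩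
    · simp [fibreCircle_zero]
    · simp [fibreCircle, boundaryPoint, hθ]
  · refine ⟨⟨⟨fun t : I ↦ ν.toFun (L (t, ())), ν.continuous.comp (by fun_prop)⟩, ?_, ?_⟩,
      fun t ↦ ⟨L (t, ()), hL1 _, rfl⟩⟩
    · simp [hL0, hξy]
    · simp [hw]

end

end TubularNeighborhood

end CircleBundle

end

/-! ### Arcs and double cosets -/

section

open Set Filter Module Bundle CategoryTheory

section Square

variable {X : Type*} [TopologicalSpace X]

/-- The homotopy class of a path, as a morphism of the fundamental groupoid. -/
def pathClass {y z : X} (p : Path y z) : FundamentalGroupoid.mk y ⟶ FundamentalGroupoid.mk z :=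
  Path.Homotopic.Quotient.mk p

theorem pathClass_trans {x y z : X} (p : Path x y) (q : Path y z) :
    pathClass (p.trans q) = pathClass p ≫ pathClass q := rfl

theorem pathClass_refl (x : X) : pathClass (Path.refl x) = 𝟙 _ := rfl

theorem pathClass_symm {y z : X} (p : Path y z) : pathClass p.symm = inv (pathClass p) := by
  rw [← Groupoid.inv_eq_inv]; rfl

theorem pathClass_eq {y z : X} {p q : Path y z} : pathClass p = pathClass q ↔ p.Homotopic q :=
  Path.Homotopic.Quotient.eq

theorem pathClass_surjective {y z : X} (g : FundamentalGroupoid.mk y ⟶ FundamentalGroupoid.mk z) :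
    ∃ p : Path y z, pathClass p = g :=
  Path.Homotopic.Quotient.mk_surjective g

/-- Here `p` and `q` are constant and `r` is `γ`, but with end points `y₀`, `y₁` that are only
propositionally equal to `y`. -/
theorem pathClass_trans_trans {y y₀ y₁ : X} (h₀ : y₀ = y) (h₁ : y₁ = y) {p : Path y y₀}
    {r : Path y₀ y₁} {q : Path y₁ y} {γ : Path y y} (hp : ∀ t, p t = y) (hr : ∀ t, r t = γ t)
    (hq : ∀ t, q t = y) : pathClass ((p.trans r).trans q) = pathClass γ := by
  subst h₀ h₁
  obtain rfl : p = Path.refl _ := Path.ext (funext hp)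
  obtain rfl : q = Path.refl _ := Path.ext (funext hq)
  obtain rfl : r = γ := Path.ext (funext hr)
  simp only [pathClass_trans, pathClass_refl, Category.id_comp, Category.comp_id]

/-- The two ways around the boundary of a square are homotopic. -/
theorem pathClass_square (F : C(I × I, X)) {x₀₀ x₀₁ x₁₀ x₁₁ : X} (u : Path x₀₀ x₁₀)
    (r : Path x₁₀ x₁₁) (l : Path x₀₀ x₀₁) (w : Path x₀₁ x₁₁) (hu : ∀ s, u s = F (s, 0))
    (hr : ∀ t, r t = F (1, t)) (hl : ∀ t, l t = F (0, t)) (hw : ∀ s, w s = F (s, 1)) :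
    pathClass u ≫ pathClass r = pathClass l ≫ pathClass w := by
  obtain rfl : F (0, 0) = x₀₀ := (hu 0).symm.trans u.source
  obtain rfl : F (1, 0) = x₁₀ := (hu 1).symm.trans u.target
  obtain rfl : F (0, 1) = x₀₁ := (hl 1).symm.trans l.target
  obtain rfl : F (1, 1) = x₁₁ := (hr 1).symm.trans r.target
  -- extend to the plane, which is simply connected
  let G : C(ℝ × ℝ, X) := F.comp ⟨fun z ↦ (projIcc 0 1 zero_le_one z.1, projIcc 0 1 zero_le_one z.2),
    (continuous_projIcc.comp continuous_fst).prodMk (continuous_projIcc.comp continuous_snd)⟩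
  have hG : ∀ s t : I, G (s, t) = F (s, t) := fun s t ↦ by simp [G]
  let e : Path (0 : ℝ) 1 := ⟨⟨fun t ↦ t, continuous_subtype_val⟩, rfl, rfl⟩
  have h : ((e.prod (.refl 0)).trans ((Path.refl 1).prod e)).Homotopic
      (((Path.refl 0).prod e).trans (e.prod (.refl 1))) :=
    SimplyConnectedSpace.paths_homotopic _ _
  have hF := pathClass_eq.2 (h.map G)
  rw [Path.map_trans, Path.map_trans, pathClass_trans, pathClass_trans] at hF
  have h00 : F (0, 0) = G (0, 0) := (hG 0 0).symm
  have h01 : F (0, 1) = G (0, 1) := (hG 0 1).symm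
  have h10 : F (1, 0) = G (1, 0) := (hG 1 0).symm
  have h11 : F (1, 1) = G (1, 1) := (hG 1 1).symm
  have key : ∀ {y₀₀ y₀₁ y₁₀ y₁₁ : X} (u' : Path y₀₀ y₁₀) (r' : Path y₁₀ y₁₁) (l' : Path y₀₀ y₀₁)
      (w' : Path y₀₁ y₁₁), F (0, 0) = y₀₀ → F (0, 1) = y₀₁ → F (1, 0) = y₁₀ → F (1, 1) = y₁₁ →
      (∀ s, u s = u' s) → (∀ t, r t = r' t) → (∀ t, l t = l' t) → (∀ s, w s = w' s) →
      pathClass u' ≫ pathClass r' = pathClass l' ≫ pathClass w' →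
      pathClass u ≫ pathClass r = pathClass l ≫ pathClass w := by
    rintro _ _ _ _ u' r' l' w' rfl rfl rfl rfl h1 h2 h3 h4 h
    rwa [Path.ext (funext h1), Path.ext (funext h2), Path.ext (funext h3), Path.ext (funext h4)]
  refine key _ _ _ _ h00 h01 h10 h11 (fun s ↦ ?_) (fun t ↦ ?_) (fun t ↦ ?_) (fun s ↦ ?_) hF
  · exact (hu s).trans (hG s 0).symm
  · exact (hr t).trans (hG 1 t).symm
  · exact (hl t).trans (hG 0 t).symm
  · exact (hw s).trans (hG s 1).symm

end Square

section Arcs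

variable {M : Type*} [TopologicalSpace M] {E B : Set M}

/-- A path of `E` which runs inside `B`. -/
def StaysIn (B : Set M) {y z : E} (p : Path y z) : Prop := ∀ t, (p t : M) ∈ B

theorem StaysIn.trans {x y z : E} {p : Path x y} {q : Path y z} (hp : StaysIn B p)
    (hq : StaysIn B q) : StaysIn B (p.trans q) := by
  intro t
  rw [Path.trans_apply]
  split_ifs
  exacts [hp _, hq _]

theorem StaysIn.symm {y z : E} {p : Path y z} (hp : StaysIn B p) : StaysIn B p.symm :=
  fun _ ↦ hp _

/-- An arc, as a path in the space `E`. -/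
def IsArc.toPath {γ : C(I, M)} (h : IsArc E B γ) :
    Path (⟨γ 0, h.1 0⟩ : E) (⟨γ 1, h.1 1⟩ : E) where
  toFun t := ⟨γ t, h.1 t⟩
  continuous_toFun := γ.continuous.subtype_mk _
  source' := rfl
  target' := rfl

/-- A path of `E`, as a map to the ambient space. -/
def ambientPath {y z : E} (p : Path y z) : C(I, M) := ⟨fun t ↦ p t, by fun_prop⟩

theorem isArc_ambientPath {y z : E} (p : Path y z) (hy : (y : M) ∈ B) (hz : (z : M) ∈ B) :
    IsArc E B (ambientPath p) :=
  ⟨fun t ↦ (p t).2, by simpa [ambientPath], by simpa [ambientPath]⟩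

theorem homotopicWith_of_homotopic {y z : E} {p q : Path y z} (h : p.Homotopic q)
    (hy : (y : M) ∈ B) (hz : (z : M) ∈ B) :
    (ambientPath p).HomotopicWith (ambientPath q) (IsArc E B) := by
  obtain ⟨F⟩ := h
  refine ⟨⟨⟨⟨fun z ↦ F z, by fun_prop⟩, fun t ↦ ?_, fun t ↦ ?_⟩, fun s ↦ ⟨fun _ ↦ (F _).2, ?_, ?_⟩⟩⟩
  · simp [ambientPath]
  · simp [ambientPath]
  · simpa using hy
  · simpa using hz

/-- Paths in `B` attached to the ends of an arc can be absorbed by sliding the end points. -/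
theorem homotopicWith_trans {x y z w : E} {u : Path x y} {p : Path y z} {v : Path z w}
    (hu : StaysIn B u) (hv : StaysIn B v) :
    (ambientPath ((u.trans p).trans v)).HomotopicWith (ambientPath p) (IsArc E B) := by
  -- `(u · p) · v` runs through `p` during `[1/4, 1/2]`, and in `B` before and after; shrink `[0, 1]`
  -- to this interval
  let θ : I × I → ℝ := fun q ↦ (1 - (q.1 : ℝ)) * q.2 + q.1 * (1 / 4 + q.2 / 4)
  have hB : ∀ {y z : E} {p : Path y z}, StaysIn B p → ∀ r, (p.extend r : M) ∈ B :=
    fun hp r ↦ hp (projIcc 0 1 zero_le_one r)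
  refine ⟨⟨⟨⟨fun q ↦ ((u.trans p).trans v).extend (θ q), by fun_prop⟩, fun t ↦ ?_, fun t ↦ ?_⟩,
    fun s ↦ ⟨fun _ ↦ (((u.trans p).trans v).extend _).2, ?_, ?_⟩⟩⟩
  · simp [θ, ambientPath]
  · have ht0 := t.2.1
    have ht1 := t.2.2
    have h1 : θ (1, t) = 1 / 4 + t / 4 := by simp [θ]
    simp only [h1]
    rw [Path.extend_trans_of_le_half _ _ (by linarith),
      Path.extend_trans_of_half_le _ _ (by linarith)]
    have h2 : 2 * (2 * (1 / 4 + (t : ℝ) / 4)) - 1 = t := by ring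
    rw [h2, Path.extend_extends']
    rfl
  · have h1 : θ (s, 0) = s / 4 := by simp [θ]; ring
    have hs := s.2.2
    change ((((u.trans p).trans v).extend (θ (s, 0)) : E) : M) ∈ B
    rw [h1, Path.extend_trans_of_le_half _ _ (by linarith),
      Path.extend_trans_of_le_half _ _ (by linarith)]
    exact hB hu _
  · have h1 : θ (s, 1) = 1 - s / 2 := by simp [θ]; ring
    have hs := s.2.2
    change ((((u.trans p).trans v).extend (θ (s, 1)) : E) : M) ∈ B
    rw [h1, Path.extend_trans_of_half_le _ _ (by linarith)]
    exact hB hv _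

variable {x₀ : E} {H : Subgroup (FundamentalGroup E x₀)}

/-- The double coset of `p · γ · q` does not depend on the paths `p` and `q` in `B`, nor on the arc
`γ` up to homotopy. -/
theorem doubleCoset_eq
    (hH : ∀ p : Path x₀ x₀, StaysIn B p → FundamentalGroup.fromPath (.mk p) ∈ H)
    {γ γ' : C(I, M)} (hγ : IsArc E B γ) (hγ' : IsArc E B γ')
    (h : γ.HomotopicWith γ' (IsArc E B))
    {p : Path x₀ ⟨γ 0, hγ.1 0⟩} {q : Path ⟨γ 1, hγ.1 1⟩ x₀}
    {p' : Path x₀ ⟨γ' 0, hγ'.1 0⟩} {q' : Path ⟨γ' 1, hγ'.1 1⟩ x₀}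
    (hp : StaysIn B p) (hq : StaysIn B q) (hp' : StaysIn B p') (hq' : StaysIn B q') :
    DoubleCoset.mk H H (FundamentalGroup.fromPath (.mk ((p.trans hγ.toPath).trans q))) =
      DoubleCoset.mk H H (FundamentalGroup.fromPath (.mk ((p'.trans hγ'.toPath).trans q'))) := by
  obtain ⟨F⟩ := h
  let F' : C(I × I, E) := ⟨fun z ↦ ⟨F z, (F.prop z.1).1 z.2⟩, F.continuous.subtype_mk _⟩
  let u : Path (⟨γ 0, hγ.1 0⟩ : E) ⟨γ' 0, hγ'.1 0⟩ :=
    ⟨⟨fun s ↦ F' (s, 0), by fun_prop⟩, Subtype.ext (F.apply_zero 0), Subtype.ext (F.apply_one 0)⟩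
  let w : Path (⟨γ 1, hγ.1 1⟩ : E) ⟨γ' 1, hγ'.1 1⟩ :=
    ⟨⟨fun s ↦ F' (s, 1), by fun_prop⟩, Subtype.ext (F.apply_zero 1), Subtype.ext (F.apply_one 1)⟩
  have hu : StaysIn B u := fun s ↦ (F.prop s).2.1
  have hw : StaysIn B w := fun s ↦ (F.prop s).2.2
  have hsq := pathClass_square F' u hγ'.toPath hγ.toPath w (fun s ↦ rfl)
    (fun t ↦ Subtype.ext (F.apply_one t).symm) (fun t ↦ Subtype.ext (F.apply_zero t).symm)
    fun s ↦ rfl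
  -- multiplication in the fundamental group is composition in the opposite order
  refine (DoubleCoset.eq H H _ _).2 ⟨_, hH _ ((hq.symm.trans hw).trans hq'), _,
    hH _ ((hp'.trans hu.symm).trans hp.symm), ?_⟩
  change pathClass _ = pathClass _ ≫ pathClass _ ≫ pathClass _
  simp only [pathClass_trans, pathClass_symm, Category.assoc, IsIso.inv_hom_id_assoc,
    IsIso.hom_inv_id_assoc]
  have := reassoc_of% hsq
  rw [← this, IsIso.inv_hom_id_assoc]

/-- If `p · γ · q` and `p' · γ' · q'` lie in the same double coset, then the arcs `γ` and `γ'` are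
homotopic. -/
theorem homotopicWith_of_doubleCoset_eq
    (hH : ∀ g ∈ H, ∃ p : Path x₀ x₀, StaysIn B p ∧ FundamentalGroup.fromPath (.mk p) = g)
    {γ γ' : C(I, M)} (hγ : IsArc E B γ) (hγ' : IsArc E B γ')
    {p : Path x₀ ⟨γ 0, hγ.1 0⟩} {q : Path ⟨γ 1, hγ.1 1⟩ x₀}
    {p' : Path x₀ ⟨γ' 0, hγ'.1 0⟩} {q' : Path ⟨γ' 1, hγ'.1 1⟩ x₀}
    (hp : StaysIn B p) (hq : StaysIn B q) (hp' : StaysIn B p') (hq' : StaysIn B q')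
    (h : DoubleCoset.mk H H (FundamentalGroup.fromPath (.mk ((p.trans hγ.toPath).trans q))) =
      DoubleCoset.mk H H (FundamentalGroup.fromPath (.mk ((p'.trans hγ'.toPath).trans q')))) :
    γ.HomotopicWith γ' (IsArc E B) := by
  obtain ⟨g, hg, k, hk, hgk⟩ := (DoubleCoset.eq H H _ _).1 h
  obtain ⟨η, hη, rfl⟩ := hH g hg
  obtain ⟨κ, hκ, rfl⟩ := hH k hk
  change pathClass _ = pathClass κ ≫ pathClass _ ≫ pathClass η at hgk
  have hhom : hγ'.toPath.Homotopic
      ((((p'.symm.trans κ).trans p).trans hγ.toPath).trans ((q.trans η).trans q'.symm)) := by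
    rw [← pathClass_eq]
    simp only [pathClass_trans, pathClass_symm, Category.assoc] at hgk ⊢
    rw [← reassoc_of% hgk]
    simp
  have h1 := homotopicWith_of_homotopic hhom hγ'.2.1 hγ'.2.2
  have h2 := homotopicWith_trans (p := hγ.toPath) ((hp'.symm.trans hκ).trans hp)
    ((hq.trans hη).trans hq'.symm)
  exact (h1.trans h2).symm

end Arcs

end

section

open Set Filter Module Bundle

section

variable {M : Type*} [TopologicalSpace M] [ChartedSpace (EuclideanSpace ℝ (Fin 4)) M] {E B : Set M}

theorem Cord.Isotopic.homotopicWith {c d : Cord E B} (h : c.Isotopic d) :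
    c.toContinuousMap.HomotopicWith d.toContinuousMap (IsArc E B) := by
  obtain ⟨H, hH, he, h0, h1⟩ := h
  refine ⟨⟨⟨⟨H, hH.continuous⟩, h0, h1⟩, fun s ↦ ?_⟩⟩
  obtain ⟨e, hes⟩ := he s
  convert e.isArc using 1
  exact ContinuousMap.ext fun t ↦ (hes t).symm

end

end

end CordLemma

end

theorem lemma2p1
    -- a homology 4-sphere
    (M : Type*) [TopologicalSpace M] [T2Space M] [CompactSpace M] [ConnectedSpace M]
    [ChartedSpace (EuclideanSpace ℝ (Fin 4)) M] [IsManifold (𝓡 4) ∞ M]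
    (hM : CordLemma.HasHomologyOfSphere4 M)
    -- a 2-knot
    (f : CordLemma.Sphere2 → M) (hf : Manifold.IsSmoothEmbedding (𝓡 2) (𝓡 4) ∞ f)
    -- a tubular neighborhood of the 2-knot
    (V : CordLemma.Sphere2 → Type*) [TopologicalSpace (Bundle.TotalSpace CordLemma.Plane V)]
    [∀ x, NormedAddCommGroup (V x)] [∀ x, InnerProductSpace ℝ (V x)]
    [FiberBundle CordLemma.Plane V] [VectorBundle ℝ CordLemma.Plane V]
    [ContMDiffVectorBundle ∞ CordLemma.Plane V (𝓡 2)]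
    [IsContMDiffRiemannianBundle (𝓡 2) ∞ CordLemma.Plane V]
    (ν : CordLemma.TubularNeighborhood f V)
    -- a base point on the boundary of the exterior, and the meridian through it
    (x : CordLemma.Sphere2) (a b : V x) (ha : ‖a‖ = 1) (hb : ‖b‖ = 1) (hab : inner ℝ a b = 0) :
    ∃ Φ : CordLemma.Cord.IsotopyClass ν.exterior ν.boundary ≃
        DoubleCoset.Quotient
          (Subgroup.zpowers (ν.meridian ha hb hab) :
            Set (FundamentalGroup ν.exterior (ν.boundaryPoint a ha)))
          (Subgroup.zpowers (ν.meridian ha hb hab)),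
      -- the class of a cord `c` goes to the double coset of any loop `p * c * q` with `p` and `q`
      -- paths in the boundary from the base point to `c 0` and from `c 1` to the base point
      ∀ (c : CordLemma.Cord ν.exterior ν.boundary)
        (p : Path (ν.boundaryPoint a ha) ⟨c.toFun 0, c.mem 0⟩)
        (q : Path ⟨c.toFun 1, c.mem 1⟩ (ν.boundaryPoint a ha)),
        (∀ t, (p t : M) ∈ ν.boundary) → (∀ t, (q t : M) ∈ ν.boundary) →
        Φ c.isotopyClass = DoubleCoset.mk _ _
          (FundamentalGroup.fromPath
            (Path.Homotopic.Quotient.mk ((p.trans c.toPath).trans q))) := by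
  have hR := CordLemma.isContinuousRiemannianBundle (V := V)
  have hE : ∀ y ∈ ν.exterior, ∃ ψ, CordLemma.HalfSpaceChart ν.exterior ν.boundary ψ ∧ y ∈ ψ.source :=
    fun y hy ↦ ν.exists_halfSpaceChart hy
  have hloop := ν.mem_zpowers_of_mem_boundary ha hb hab
  have hpow : ∀ g ∈ Subgroup.zpowers (ν.meridian ha hb hab),
      ∃ p : Path (ν.boundaryPoint a ha) (ν.boundaryPoint a ha), CordLemma.StaysIn ν.boundary p ∧
        FundamentalGroup.fromPath (.mk p) = g := by
    rintro _ ⟨k, rfl⟩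
    exact ⟨ν.meridianPow ha hb hab k, fun t ↦ ν.fibreCircle_mem_boundary ha hb hab _,
      ν.meridianPowClass_eq ha hb hab k⟩
  have hp : ∀ c : CordLemma.Cord ν.exterior ν.boundary,
      ∃ p : Path (ν.boundaryPoint a ha) ⟨c.toFun 0, c.mem 0⟩, CordLemma.StaysIn ν.boundary p :=
    fun c ↦ ν.exists_path_boundary ha hb hab _ c.isArc.2.1
  have hq : ∀ c : CordLemma.Cord ν.exterior ν.boundary,
      ∃ q : Path ⟨c.toFun 1, c.mem 1⟩ (ν.boundaryPoint a ha), CordLemma.StaysIn ν.boundary q := fun c ↦ by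
    obtain ⟨q, hq⟩ := ν.exists_path_boundary ha hb hab ⟨c.toFun 1, c.mem 1⟩ c.isArc.2.2
    exact ⟨q.symm, CordLemma.StaysIn.symm hq⟩
  -- the double coset of a cord, by means of arbitrarily chosen paths in the boundary
  choose p hp using hp
  choose q hq using hq
  let Ψ : CordLemma.Cord ν.exterior ν.boundary → DoubleCoset.Quotient
      (Subgroup.zpowers (ν.meridian ha hb hab) :
        Set (FundamentalGroup ν.exterior (ν.boundaryPoint a ha)))
      (Subgroup.zpowers (ν.meridian ha hb hab)) := fun c ↦
    DoubleCoset.mk _ _ (FundamentalGroup.fromPath (.mk (((p c).trans c.toPath).trans (q c))))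
  let Φ : CordLemma.Cord.IsotopyClass ν.exterior ν.boundary → DoubleCoset.Quotient
      (Subgroup.zpowers (ν.meridian ha hb hab) :
        Set (FundamentalGroup ν.exterior (ν.boundaryPoint a ha)))
      (Subgroup.zpowers (ν.meridian ha hb hab)) :=
    Quotient.lift Ψ fun c d h ↦ CordLemma.doubleCoset_eq hloop c.isArc d.isArc
      (CordLemma.Cord.Isotopic.homotopicWith h) (hp c) (hq c) (hp d) (hq d)
  have hinj : Function.Injective Φ := by
    rintro ⟨c⟩ ⟨d⟩ h
    exact Quotient.sound (CordLemma.Cord.isotopic_of_homotopicWith hE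
      (CordLemma.homotopicWith_of_doubleCoset_eq hpow c.isArc d.isArc (hp c) (hq c) (hp d) (hq d) h))
  have hx : (ν.boundaryPoint a ha : M) ∈ ν.boundary := ⟨_, ha, rfl⟩
  have hsurj : Function.Surjective Φ := by
    rintro ⟨g⟩
    -- a loop at the base point is an arc with end points in the boundary
    obtain ⟨γ, rfl⟩ := CordLemma.pathClass_surjective g
    have hγ := CordLemma.isArc_ambientPath γ hx hx
    obtain ⟨c, hc⟩ := CordLemma.exists_cord_homotopicWith hE hγ
    refine ⟨c.isotopyClass, ?_⟩
    let p₀ : Path (ν.boundaryPoint a ha) ⟨CordLemma.ambientPath γ 0, hγ.1 0⟩ :=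
      (Path.refl _).cast rfl (Subtype.ext (congrArg Subtype.val γ.source))
    let q₀ : Path ⟨CordLemma.ambientPath γ 1, hγ.1 1⟩ (ν.boundaryPoint a ha) :=
      (Path.refl _).cast (Subtype.ext (congrArg Subtype.val γ.target)) rfl
    have h := CordLemma.doubleCoset_eq hloop hγ c.isArc hc (p := p₀) (q := q₀) (fun _ ↦ hx) (fun _ ↦ hx)
      (hp c) (hq c)
    refine h.symm.trans (congrArg (DoubleCoset.mk _ _) ?_)
    exact CordLemma.pathClass_trans_trans (Subtype.ext (congrArg Subtype.val γ.source))
      (Subtype.ext (congrArg Subtype.val γ.target)) (fun _ ↦ rfl) (fun _ ↦ rfl) (fun _ ↦ rfl)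
  refine ⟨Equiv.ofBijective Φ ⟨hinj, hsurj⟩, fun c p' q' hp' hq' ↦ ?_⟩
  exact CordLemma.doubleCoset_eq hloop c.isArc c.isArc (.refl _ c.isArc) (hp c) (hq c) hp' hq'
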